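/- Let $n\ge 1$, let $\mathcal R$ be the family of bounded non-degenerate rectangles in $\mathbb R^n$ with sides parallel to the coordinate axes, and let $$M_{\mathcal R}f(x)=\sup_{R\in\mathcal R,\,R\ni x}\frac1{|R|}\int_R|f(y)|\,dy$$ be the strong maximal operator. A weight is a locally integrable function on $\mathbb R^n$ that is positive almost everywhere, and $w(E)=\int_E w\,dx$. For $p\in(1,\infty)$ put $p'=\frac p{p-1}$ and $$[w]_{A_{p,\mathcal R}}=\sup_{R\in\mathcal R}\Big(\frac1{|R|}\int_R w\,dx\Big)\Big(\frac1{|R|}\int_R w^{-\frac1{p-1}}\,dx\Big)^{p-1},\qquad [w]_{A_{\infty,\mathcal R}}=\sup_{R\in\mathcal R}\frac1{w(R)}\int_R M_{\mathcal R}(w\chi_R)\,dx,$$ and write $w\in A_{p,\mathcal R}$ if $[w]_{A_{p,\mathcal R}}<\infty$. For $0<q<\infty$ let $$\|f\|_{L^{p,q}(w)}=\Big(p\int_0^\infty s^q\,w(\{|f|>s\})^{q/p}\,\frac{ds}s\Big)^{1/q},\qquad \|f\|_{L^{p,\infty}(w)}=\sup_{s>0}s\,w(\{|f|>s\})^{1/p},$$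 and let $\|M_{\mathcal R}\|_{L^{p,q}(w)}=\sup\|M_{\mathcal R}f\|_{L^{p,q}(w)}/\|f\|_{L^{p,q}(w)}$, the supremum being over all measurable $f$ with $\|f\|_{L^{p,q}(w)}<\infty$ that do not vanish almost everywhere. (1) There is a constant $C_n>0$ depending only on $n$ such that for all $p\in(1,\infty)$, $q\in(0,\infty]$ and $w\in A_{p,\mathcal R}$, with $\sigma:=w^{1-p'}$, $$\|M_{\mathcal R}\|_{L^{p,q}(w)}\le C_n\begin{cases}(p')^n\,\log(e+[w]_{A_{p,\mathcal R}})^{\frac1p}\,[w]_{A_{p,\mathcal R}}^{\frac1p+\frac{n-1}{p-1}}\,[\sigma]_{A_{\infty,\mathcal R}}^{\frac1p}&\text{if }p\le q\le\infty,\\[4pt]\big(\tfrac{2^{n+3}}q\big)^{\frac1q}(p')^{\frac1q+(n-1)}\,\log(e+[w]_{A_{p,\mathcal R}})^{\frac1q}\,[w]_{A_{p,\mathcal R}}^{\frac1p+\frac{n-1}{p-1}}\,[\sigma]_{A_{\infty,\mathcal R}}^{\frac1q}&\text{if }0<q\le p.\end{cases}$$ (2) In particular, for every $q\in(0,\infty]$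 there is a constant $C_{q,n}>0$ depending only on $q$ and $n$ such that for all $p\in(1,\infty)$ and $w\in A_{p,\mathcal R}$, with $\sigma:=w^{1-p'}$, $$\|M_{\mathcal R}\|_{L^{p,q}(w)}\le C_{q,n}\,(p')^{n-1+\frac1{\min(p,q)}}\,\log(e+[w]_{A_{p,\mathcal R}})^{\frac1{\min(p,q)}}\,[w]_{A_{p,\mathcal R}}^{\frac1p+\frac{n-1}{p-1}}\,[\sigma]_{A_{\infty,\mathcal R}}^{\frac1{\min(p,q)}}.$$ -/

import Mathlib

open MeasureTheory Set
open scoped ENNReal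

noncomputable section

namespace StrongMaximal

/-- The open rectangle `∏ i, (a i, b i)` with sides parallel to the coordinate axes.  Points of
`ℝⁿ` are functions `Fin n → ℝ`, whose `volume` is Lebesgue measure (no norm on `ℝⁿ` is used). -/
def box {n : ℕ} (a b : Fin n → ℝ) : Set (Fin n → ℝ) :=
  Set.pi Set.univ fun i => Set.Ioo (a i) (b i)

/-- The family of all nondegenerate bounded axis-parallel rectangles in `ℝⁿ`.  (Open rectangles
are used; closed ones have the same averages and give the same maximal function.) -/
def rectangles (n : ℕ) : Set (Set (Fin n → ℝ)) :=
  {R | ∃ a b : Fin n → ℝ, (∀ i, a i < b i) ∧ R = box a b}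

/-- The strong maximal function `M f(x) = sup_{R ∋ x} ⨍_R |f|`, with values in `[0, ∞]`. -/
def strongMaximal {n : ℕ} {E : Type*} [ENorm E] (f : (Fin n → ℝ) → E) (x : Fin n → ℝ) : ℝ≥0∞ :=
  ⨆ R ∈ {R ∈ rectangles n | x ∈ R}, ⨍⁻ y in R, ‖f y‖ₑ ∂volume

/-- A weight: a locally integrable function that is positive almost everywhere. -/
structure IsWeight {n : ℕ} (w : (Fin n → ℝ) → ℝ) : Prop where
  locallyIntegrable : LocallyIntegrable w
  pos : ∀ᵐ x, 0 < w x

/-- The measure `w(E) = ∫_E w(x) dx`. -/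
def weightMeasure {n : ℕ} (w : (Fin n → ℝ) → ℝ) : Measure (Fin n → ℝ) :=
  volume.withDensity fun x => ENNReal.ofReal (w x)

/-- The strong `A_p` constant
`[w]_{A_p} = sup_R (⨍_R w) (⨍_R w ^ (-1/(p-1))) ^ (p-1)`. -/
def apConst {n : ℕ} (p : ℝ) (w : (Fin n → ℝ) → ℝ) : ℝ≥0∞ :=
  ⨆ R ∈ rectangles n, (⨍⁻ x in R, ENNReal.ofReal (w x) ∂volume) *
    (⨍⁻ x in R, ENNReal.ofReal (w x ^ (-1 / (p - 1))) ∂volume) ^ (p - 1)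

/-- The class of strong `A_p` weights. -/
structure MemAp {n : ℕ} (p : ℝ) (w : (Fin n → ℝ) → ℝ) : Prop where
  isWeight : IsWeight w
  apConst_lt_top : apConst p w < ∞

/-- The strong Fujii–Wilson constant `[w]_{A_∞} = sup_R w(R)⁻¹ ∫_R M(w χ_R)`. -/
def aInftyConst {n : ℕ} (w : (Fin n → ℝ) → ℝ) : ℝ≥0∞ :=
  ⨆ R ∈ rectangles n, (∫⁻ x in R, strongMaximal (R.indicator w) x) / weightMeasure w R

/-- The dual weight `σ = w ^ (1 - p')`, where `p' = p / (p - 1)`. -/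
def dualWeight {n : ℕ} (p : ℝ) (w : (Fin n → ℝ) → ℝ) : (Fin n → ℝ) → ℝ :=
  fun x => w x ^ (1 - p.conjExponent)

/-- The weighted Lorentz (quasi-)norm through the distribution function:
`(p ∫_0^∞ s^q w{|f| > s}^(q/p) ds/s)^(1/q)` for `q < ∞`, and
`sup_{s > 0} s w{|f| > s}^(1/p)` for `q = ∞`. -/
def lorentzNorm {n : ℕ} {E : Type*} [ENorm E] (p : ℝ) (q : ℝ≥0∞) (w : (Fin n → ℝ) → ℝ)
    (f : (Fin n → ℝ) → E) : ℝ≥0∞ :=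
  if q = ∞ then
    ⨆ s ∈ Set.Ioi (0 : ℝ),
      ENNReal.ofReal s * weightMeasure w {x | ENNReal.ofReal s < ‖f x‖ₑ} ^ (1 / p)
  else
    (ENNReal.ofReal p * ∫⁻ s in Set.Ioi (0 : ℝ), ENNReal.ofReal (s ^ q.toReal) *
      weightMeasure w {x | ENNReal.ofReal s < ‖f x‖ₑ} ^ (q.toReal / p) / ENNReal.ofReal s)
      ^ (1 / q.toReal)

/-- Membership of a (complex-valued, almost everywhere measurable) function in `L^{p,q}(w)`. -/
def MemLorentz {n : ℕ} (p : ℝ) (q : ℝ≥0∞) (w : (Fin n → ℝ) → ℝ) (f : (Fin n → ℝ) → ℂ) : Prop :=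
  AEMeasurable f ∧ lorentzNorm p q w f < ∞

/-- The norm `‖T‖_{L^{p,q}(w)} = sup_{f ≠ 0} ‖T f‖ / ‖f‖` of a (not necessarily linear) operator
`T`, the supremum being over all `f ∈ L^{p,q}(w)` that do not vanish almost everywhere. -/
def lorentzOpNorm {n : ℕ} {E : Type*} [ENorm E] (p : ℝ) (q : ℝ≥0∞) (w : (Fin n → ℝ) → ℝ)
    (T : ((Fin n → ℝ) → ℂ) → (Fin n → ℝ) → E) : ℝ≥0∞ :=
  ⨆ f ∈ {f : (Fin n → ℝ) → ℂ | MemLorentz p q w f ∧ ¬ f =ᵐ[volume] 0},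
    lorentzNorm p q w (T f) / lorentzNorm p q w f

end StrongMaximal

end

/-! Write `κ` for the A_p constant of `w`, `σ` for the dual weight and `τ` for the Fujii-Wilson
constant of `σ`. The bound comes from a weak type inequality at an exponent `r` slightly below `p`,
followed by real interpolation with all constants tracked. `MemAp.lorentzOpNorm_le` gives a stronger
estimate, with no logarithm and smaller powers of `p'`; the stated one follows because the logarithm
and `p'` are at least 1.

Weak type. On a line, any finite family of intervals can be thinned to overlap at most two without
changing its union, so an A_r weight with constant `K` gives weak type (r, r) with constant `2K`.
Almost every line section of a strong A_r weight is an A_r weight with the same constant, so Fubini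
carries this to each coordinate direction. The strong maximal function is dominated by the
composition of the n directional ones (`strongMaximal_le_iterMax`).

Openness. A stopping time argument that bisects one side of a rectangle at a time gives `σ` a
reverse Hölder inequality with exponent `1 + ε` whenever `ε ≤ 1/(4τ)` (`reverse_holder`). Hence `w`
is an A_r weight for `r = 1 + (p-1)/(1+ε)`, with constant at most `2^p κ`. The choices `ε = 1/(4τ)`
and `ε = 1/(8τ)` give exponents `r₀ < r < p`. One direction is handled by weak type (r, r), the
other n-1 by strong type (r, r), interpolated from `r₀`; each of these costs about `κ p' τ`. In
these factors `τ` is replaced by a dimensional multiple of `κ^(1/(p-1))`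
(`BoxMuckenhoupt.fujiiWilson_dual_le`), so the total power of `κ` is `1 + p(n-1)/(p-1)`, and its
p-th root is the power in the theorem.

Lorentz norms. Truncation at height `s/2` and a splitting into level sets with ratio 4 bound `s^p
w{Mf > s}` by a geometric sum, with ratio `4^(-(p-r))`, of the same quantity for `f` at heights `4^k
s/2`. Since `ds/s` is dilation invariant, only the sum of the series matters. It is of order
`1/(p-r) = (8τ+1)/(p-1)`, up to `9 p' τ`, and enters to the power `1/p` if `p ≤ q` and `1/q` if `q ≤
p`. This is the only place where `τ` survives in the final bound. -/

noncomputable section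

namespace StrongMaximal

/-! ### The maximal function on the line -/

/-- A finite family of intervals has a subfamily with the same union and overlap at most two. -/
theorem exists_subset_overlap_le_two {ι : Type*} [DecidableEq ι] (a b : ι → ℝ) (s : Finset ι) :
    ∃ t ⊆ s, (⋃ j ∈ s, Ioo (a j) (b j)) ⊆ (⋃ j ∈ t, Ioo (a j) (b j)) ∧
      ∀ x, (t.filter fun j => x ∈ Ioo (a j) (b j)).card ≤ 2 := by
  induction s using Finset.strongInduction with
  | H s ih =>
    by_cases h : ∀ x, (s.filter fun j => x ∈ Ioo (a j) (b j)).card ≤ 2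
    · exact ⟨s, subset_rfl, subset_rfl, h⟩
    push Not at h
    obtain ⟨x, hx⟩ := h
    set u := s.filter fun j => x ∈ Ioo (a j) (b j) with hu
    have hne : u.Nonempty := Finset.card_pos.1 (by omega)
    -- Among three or more intervals through `x`, the one reaching furthest left and the one
    -- reaching furthest right cover all the others, so a third one is redundant.
    obtain ⟨j₁, hj₁, hmin⟩ := u.exists_min_image a hne
    obtain ⟨j₂, hj₂, hmax⟩ := u.exists_max_image b hne
    obtain ⟨j, hj, hjn⟩ : ∃ j ∈ u, j ∉ ({j₁, j₂} : Finset ι) := by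
      apply Finset.exists_mem_notMem_of_card_lt_card
      exact (Finset.card_le_two).trans_lt hx
    have hj1 : j ≠ j₁ := by rintro rfl; simp at hjn
    have hj2 : j ≠ j₂ := by rintro rfl; simp at hjn
    have hjs := hj
    rw [hu, Finset.mem_filter] at hjs hj₁ hj₂
    obtain ⟨t, hts, htu, ht⟩ := ih (s.erase j) (Finset.erase_ssubset hjs.1)
    refine ⟨t, hts.trans (Finset.erase_subset _ _), ?_, ht⟩
    refine Subset.trans ?_ htu
    intro y hy
    simp only [mem_iUnion, exists_prop] at hy ⊢
    obtain ⟨k, hk, hyk⟩ := hy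
    by_cases hkj : k = j
    · subst hkj
      rcases le_total y x with hyx | hyx
      · exact ⟨j₁, Finset.mem_erase.2 ⟨hj1.symm, hj₁.1⟩,
          (hmin k hj).trans_lt hyk.1, hyx.trans_lt hj₁.2.2⟩
      · exact ⟨j₂, Finset.mem_erase.2 ⟨hj2.symm, hj₂.1⟩,
          hj₂.2.1.trans_le hyx, hyk.2.trans_le (hmax k hj)⟩
    · exact ⟨k, Finset.mem_erase.2 ⟨hkj, hk⟩, hyk⟩

/-- If `ν J ≤ ρ J` for countably many intervals `J`, then `ν (⋃ J) ≤ 2 ρ(ℝ)`. -/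
theorem measure_iUnion_Ioo_le {ι : Type*} [Countable ι] (a b : ι → ℝ) (ν ρ : Measure ℝ)
    (h : ∀ j, ν (Ioo (a j) (b j)) ≤ ρ (Ioo (a j) (b j))) :
    ν (⋃ j, Ioo (a j) (b j)) ≤ 2 * ρ univ := by
  classical
  have hfin : ∀ s : Finset ι, ν (⋃ j ∈ s, Ioo (a j) (b j)) ≤ 2 * ρ univ := by
    intro s
    obtain ⟨t, -, htu, ht⟩ := exists_subset_overlap_le_two a b s
    calc ν (⋃ j ∈ s, Ioo (a j) (b j)) ≤ ν (⋃ j ∈ t, Ioo (a j) (b j)) := measure_mono htu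
      _ ≤ ∑ j ∈ t, ν (Ioo (a j) (b j)) := measure_biUnion_finset_le _ _
      _ ≤ ∑ j ∈ t, ρ (Ioo (a j) (b j)) := Finset.sum_le_sum fun j _ => h j
      _ = ∑ j ∈ t, ∫⁻ x, (Ioo (a j) (b j)).indicator 1 x ∂ρ := by
        simp [lintegral_indicator_one measurableSet_Ioo]
      _ = ∫⁻ x, ∑ j ∈ t, (Ioo (a j) (b j)).indicator 1 x ∂ρ := by
        rw [lintegral_finsetSum]
        intro j _
        exact measurable_one.indicator measurableSet_Ioo
      _ ≤ ∫⁻ _, 2 ∂ρ := by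
        refine lintegral_mono fun x => ?_
        have : ∑ j ∈ t, (Ioo (a j) (b j)).indicator (1 : ℝ → ℝ≥0∞) x
            = ((t.filter fun j => x ∈ Ioo (a j) (b j)).card : ℝ≥0∞) := by
          simp [Set.indicator_apply]
        rw [this]
        exact le_trans (Nat.cast_le.2 (ht x)) (by norm_num)
      _ = 2 * ρ univ := by simp
  have hU : (⋃ j, Ioo (a j) (b j)) = ⋃ s : Finset ι, ⋃ j ∈ s, Ioo (a j) (b j) := by
    rw [iUnion_eq_iUnion_finset]
  rw [hU, Directed.measure_iUnion]
  · exact iSup_le hfin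
  · exact directed_of_isDirected_le fun s t hst => biUnion_subset_biUnion_left hst

/-- The uncentred maximal function on the line, over intervals with rational endpoints. -/
def lineMax (g : ℝ → ℝ≥0∞) (x : ℝ) : ℝ≥0∞ :=
  ⨆ (J : ℚ × ℚ) (_ : x ∈ Ioo (J.1 : ℝ) J.2),
    (∫⁻ t in Ioo (J.1 : ℝ) J.2, g t) / ENNReal.ofReal (J.2 - J.1)

/-- Hölder's inequality in the form used for Muckenhoupt weights. -/
theorem rpow_lintegral_le_of_weight {X : Type*} [MeasurableSpace X] {μ : Measure X} {r : ℝ}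
    (hr : 1 < r) {u g : X → ℝ≥0∞} (hu : Measurable u) (hg : Measurable g)
    (hu0 : ∀ x, u x ≠ 0) (hut : ∀ x, u x ≠ ∞) :
    (∫⁻ x, g x ∂μ) ^ r ≤
      (∫⁻ x, g x ^ r * u x ∂μ) * (∫⁻ x, u x ^ (-1 / (r - 1)) ∂μ) ^ (r - 1) := by
  have hpq : r.HolderConjugate (r / (r - 1)) := Real.HolderConjugate.conjExponent hr
  have h1 : ∫⁻ x, g x ∂μ ≤ (∫⁻ x, g x ^ r * u x ∂μ) ^ (1 / r) *
      (∫⁻ x, u x ^ (-1 / (r - 1)) ∂μ) ^ ((r - 1) / r) := by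
    have := ENNReal.lintegral_mul_le_Lp_mul_Lq μ hpq (f := fun x => g x * u x ^ (1 / r))
      (g := fun x => u x ^ (-1 / r)) (by fun_prop) (by fun_prop)
    have e1 : ∀ x, (g x * u x ^ (1 / r)) * u x ^ (-1 / r) = g x := by
      intro x
      rw [mul_assoc, ← ENNReal.rpow_add _ _ (hu0 x) (hut x)]
      rw [← add_div, add_neg_cancel, zero_div, ENNReal.rpow_zero, mul_one]
    have e2 : ∀ x, (g x * u x ^ (1 / r)) ^ r = g x ^ r * u x := by
      intro x
      rw [ENNReal.mul_rpow_of_nonneg _ _ (by linarith), ← ENNReal.rpow_mul,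
        one_div_mul_cancel (by linarith), ENNReal.rpow_one]
    have e3 : ∀ x, (u x ^ (-1 / r)) ^ (r / (r - 1)) = u x ^ (-1 / (r - 1)) := by
      intro x
      rw [← ENNReal.rpow_mul]
      congr 1
      field_simp
    simp only [Pi.mul_apply, e1, e2, e3] at this
    rwa [one_div_div] at this
  calc (∫⁻ x, g x ∂μ) ^ r ≤ ((∫⁻ x, g x ^ r * u x ∂μ) ^ (1 / r) *
      (∫⁻ x, u x ^ (-1 / (r - 1)) ∂μ) ^ ((r - 1) / r)) ^ r := by gcongr
    _ = _ := by
      rw [ENNReal.mul_rpow_of_nonneg _ _ (by linarith), ← ENNReal.rpow_mul, ← ENNReal.rpow_mul,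
        one_div_mul_cancel (by linarith), ENNReal.rpow_one, div_mul_cancel₀ _ (by linarith)]

/-- The Muckenhoupt inequality controls averages by weighted averages. -/
theorem rpow_setLIntegral_mul_le {X : Type*} [MeasurableSpace X] {μ : Measure X} {r : ℝ}
    (hr : 1 < r) {u g : X → ℝ≥0∞} (hu : Measurable u) (hg : Measurable g)
    (hu0 : ∀ x, u x ≠ 0) (hut : ∀ x, u x ≠ ∞) (c : ℝ≥0∞)
    (hc : (∫⁻ x, u x ∂μ) * (∫⁻ x, u x ^ (-1 / (r - 1)) ∂μ) ^ (r - 1) ≤ c) :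
    (∫⁻ x, g x ∂μ) ^ r * ∫⁻ x, u x ∂μ ≤ c * ∫⁻ x, g x ^ r * u x ∂μ := by
  calc (∫⁻ x, g x ∂μ) ^ r * ∫⁻ x, u x ∂μ
      ≤ ((∫⁻ x, g x ^ r * u x ∂μ) * (∫⁻ x, u x ^ (-1 / (r - 1)) ∂μ) ^ (r - 1)) *
        ∫⁻ x, u x ∂μ := by
          gcongr
          exact rpow_lintegral_le_of_weight hr hu hg hu0 hut
    _ = (∫⁻ x, g x ^ r * u x ∂μ) * ((∫⁻ x, u x ∂μ) *
        (∫⁻ x, u x ^ (-1 / (r - 1)) ∂μ) ^ (r - 1)) := by ring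
    _ ≤ (∫⁻ x, g x ^ r * u x ∂μ) * c := by gcongr
    _ = _ := mul_comm _ _

/-- Weighted weak type `(r, r)` inequality for the maximal function on the line. -/
theorem lineMax_weak_type {r : ℝ} (hr : 1 < r) {u g : ℝ → ℝ≥0∞} (hu : Measurable u)
    (hg : Measurable g) (hu0 : ∀ x, u x ≠ 0) (hut : ∀ x, u x ≠ ∞) (K : ℝ≥0∞)
    (hK : ∀ a b : ℚ, (a : ℝ) < b → (∫⁻ x in Ioo (a : ℝ) b, u x) *
      (∫⁻ x in Ioo (a : ℝ) b, u x ^ (-1 / (r - 1))) ^ (r - 1) ≤ K * ENNReal.ofReal (b - a) ^ r)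
    (s : ℝ≥0∞) :
    s ^ r * ∫⁻ x in {x | s < lineMax g x}, u x ≤ 2 * K * ∫⁻ x, g x ^ r * u x := by
  -- Rational endpoints make this index type countable, as the covering lemma requires.
  let ι := {J : ℚ × ℚ // (J.1 : ℝ) < J.2 ∧
    s < (∫⁻ t in Ioo (J.1 : ℝ) J.2, g t) / ENNReal.ofReal (J.2 - J.1)}
  have hset : {x | s < lineMax g x} = ⋃ J : ι, Ioo (J.1.1 : ℝ) J.1.2 := by
    ext x
    simp only [lineMax, mem_ofPred_eq, lt_iSup_iff, mem_iUnion]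
    constructor
    · rintro ⟨J, hx, hs⟩
      exact ⟨⟨J, hx.1.trans hx.2, hs⟩, hx⟩
    · rintro ⟨⟨J, _, hs⟩, hx⟩
      exact ⟨J, hx, hs⟩
  -- The two measures are chosen so that the comparison on a single interval is exactly the
  -- Muckenhoupt inequality. No interval is dilated, which is why the weak constant is linear in
  -- `K`.
  have key := measure_iUnion_Ioo_le (ι := ι) (fun J => (J.1.1 : ℝ)) (fun J => (J.1.2 : ℝ))
    (volume.withDensity fun x => s ^ r * u x) (volume.withDensity fun x => K * (g x ^ r * u x)) ?_
  · rw [← hset, withDensity_apply', withDensity_apply', lintegral_const_mul _ hu,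
      setLIntegral_univ, lintegral_const_mul _ (by fun_prop)] at key
    rwa [mul_assoc]
  · rintro ⟨⟨a, b⟩, hab, hs⟩
    simp only at hab hs ⊢
    rw [withDensity_apply _ measurableSet_Ioo, withDensity_apply _ measurableSet_Ioo,
      lintegral_const_mul _ hu, lintegral_const_mul _ (by fun_prop)]
    set L := ENNReal.ofReal ((b : ℝ) - a) with hL
    have hL0 : L ≠ 0 := by simpa [hL] using hab
    have hLt : L ≠ ∞ := ENNReal.ofReal_ne_top
    have hLr0 : L ^ r ≠ 0 := by simp [ENNReal.rpow_eq_zero_iff, hL0, hLt]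
    have hLrt : L ^ r ≠ ∞ := ENNReal.rpow_ne_top_of_nonneg (by linarith) hLt
    have h1 := rpow_setLIntegral_mul_le (μ := volume.restrict (Ioo (a : ℝ) b)) hr hu hg hu0 hut _
      (hK a b hab)
    have h2 : s * L ≤ ∫⁻ t in Ioo (a : ℝ) b, g t := by
      rw [← ENNReal.le_div_iff_mul_le (Or.inl hL0) (Or.inl hLt)]
      exact hs.le
    have h3 : L ^ r * (s ^ r * ∫⁻ x in Ioo (a : ℝ) b, u x) ≤
        L ^ r * (K * ∫⁻ x in Ioo (a : ℝ) b, g x ^ r * u x) := by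
      calc L ^ r * (s ^ r * ∫⁻ x in Ioo (a : ℝ) b, u x)
          = (s * L) ^ r * ∫⁻ x in Ioo (a : ℝ) b, u x := by
            rw [ENNReal.mul_rpow_of_nonneg _ _ (by linarith)]; ring
        _ ≤ (∫⁻ t in Ioo (a : ℝ) b, g t) ^ r * ∫⁻ x in Ioo (a : ℝ) b, u x := by gcongr
        _ ≤ _ := h1
        _ = _ := by ring
    exact (ENNReal.mul_le_mul_iff_right hLr0 hLrt).1 h3

/-- Averages over arbitrary intervals are controlled by `lineMax`. -/
theorem setLIntegral_Ioo_le_lineMax (g : ℝ → ℝ≥0∞) {a b x : ℝ} (hx : x ∈ Ioo a b) :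
    ∫⁻ t in Ioo a b, g t ≤ ENNReal.ofReal (b - a) * lineMax g x := by
  have hab : a < b := hx.1.trans hx.2
  by_cases hM : lineMax g x = ∞
  · rw [hM, ENNReal.mul_top (by simpa using hab)]
    exact le_top
  have hstep : ∀ a' b' : ℚ, (a' : ℝ) ≤ a → b ≤ b' →
      ∫⁻ t in Ioo a b, g t ≤ ENNReal.ofReal (b' - a') * lineMax g x := by
    intro a' b' ha hb
    have hlt : (a' : ℝ) < b' := by linarith
    have h1 : (∫⁻ t in Ioo (a' : ℝ) b', g t) / ENNReal.ofReal (b' - a') ≤ lineMax g x :=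
      le_iSup₂_of_le (a', b') ⟨ha.trans_lt hx.1, hx.2.trans_le hb⟩ le_rfl
    rw [ENNReal.div_le_iff_le_mul (Or.inl (by simpa using hlt)) (Or.inl ENNReal.ofReal_ne_top),
      mul_comm] at h1
    exact (lintegral_mono_set (Ioo_subset_Ioo ha hb)).trans h1
  have hε : ∀ ε : ℝ, 0 < ε →
      ∫⁻ t in Ioo a b, g t ≤ ENNReal.ofReal (b - a + ε) * lineMax g x := by
    intro ε hε
    obtain ⟨a', ha1, ha2⟩ := exists_rat_btwn (show a - ε / 2 < a by linarith)
    obtain ⟨b', hb1, hb2⟩ := exists_rat_btwn (show b < b + ε / 2 by linarith)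
    refine (hstep a' b' ha2.le hb1.le).trans ?_
    gcongr
    linarith
  have hlim : Filter.Tendsto (fun ε : ℝ => ENNReal.ofReal (b - a + ε) * lineMax g x)
      (nhdsWithin 0 (Ioi 0)) (nhds (ENNReal.ofReal (b - a) * lineMax g x)) := by
    refine ENNReal.Tendsto.mul_const ?_ (Or.inr hM)
    refine (ENNReal.continuous_ofReal.tendsto _).comp ?_
    have : Filter.Tendsto (fun ε : ℝ => b - a + ε) (nhds 0) (nhds (b - a + 0)) :=
      (continuous_const.add continuous_id).tendsto 0
    rw [add_zero] at this
    exact this.mono_left nhdsWithin_le_nhds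
  exact ge_of_tendsto hlim (Filter.eventually_of_mem self_mem_nhdsWithin fun ε hε' => hε ε hε')

/-! ### Differentiation along rectangles of fixed eccentricity -/

theorem measurableSet_box {n : ℕ} (a b : Fin n → ℝ) : MeasurableSet (box a b) :=
  MeasurableSet.univ_pi fun _ => measurableSet_Ioo

theorem volume_box {n : ℕ} (a b : Fin n → ℝ) :
    volume (box a b) = ∏ i, ENNReal.ofReal (b i - a i) := Real.volume_pi_Ioo

theorem volume_box_ne_top {n : ℕ} (a b : Fin n → ℝ) : volume (box a b) ≠ ∞ := by
  rw [volume_box]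
  exact ENNReal.prod_ne_top fun i _ => ENNReal.ofReal_ne_top

theorem volume_box_ne_zero {n : ℕ} {a b : Fin n → ℝ} (h : ∀ i, a i < b i) :
    volume (box a b) ≠ 0 := by
  rw [volume_box, Finset.prod_ne_zero_iff]
  intro i _
  simpa using h i

theorem box_ae_eq_Icc {n : ℕ} (a b : Fin n → ℝ) : box a b =ᵐ[volume] Icc a b :=
  Measure.univ_pi_Ioo_ae_eq_Icc

/-- Rectangles homothetic to a fixed one are comparable to balls of the sup norm, so they belong to
a Vitali family. The exceptional null set does not depend on the sequence of rectangles, which may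
therefore be chosen in terms of `x`; the point need only lie in the closed rectangle. -/
theorem ae_tendsto_box_average_of_integrable {m : ℕ} (ℓ : Fin m → ℝ) (hℓ : ∀ i, 0 < ℓ i)
    {F : (Fin m → ℝ) → ℝ≥0∞} (hF : Measurable F) (hfin : ∫⁻ x, F x ≠ ∞) :
    ∀ᵐ x, ∀ (a : ℕ → Fin m → ℝ) (η : ℕ → ℝ), (∀ k, 0 < η k) →
      Filter.Tendsto η Filter.atTop (nhds 0) → (∀ k, x ∈ Icc (a k) (a k + η k • ℓ)) →
      Filter.Tendsto (fun k => (∫⁻ y in box (a k) (a k + η k • ℓ), F y) /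
        volume (box (a k) (a k + η k • ℓ))) Filter.atTop (nhds (F x)) := by
  set L : ℝ := ∑ i, ℓ i + 1 with hL
  have hLpos : 0 < L := by
    have := Finset.sum_nonneg fun i (_ : i ∈ Finset.univ) => (hℓ i).le
    linarith
  have hℓL : ∀ i, ℓ i ≤ L := fun i => by
    have := Finset.single_le_sum (fun i _ => (hℓ i).le) (Finset.mem_univ i)
    linarith
  have hP : 0 < ∏ i, ℓ i := Finset.prod_pos fun i _ => hℓ i
  -- `C` serves twice: `3^m` is the doubling constant under tripling of sup-norm balls, and `(6L)^m
  -- / ∏ ℓ` is the ratio of the volume of a ball of radius `3ηL` to that of the rectangle with sides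
  -- `η ℓ`.
  set C : NNReal := max (3 ^ m) (Real.toNNReal ((6 * L) ^ m / ∏ i, ℓ i)) with hC
  have hvol : ∀ (x : Fin m → ℝ) (ρ : ℝ), 0 ≤ ρ →
      volume (Metric.closedBall x ρ) = ENNReal.ofReal ((2 * ρ) ^ m) := by
    intro x ρ hρ
    rw [Real.volume_pi_closedBall _ hρ]; simp
  let v := Vitali.vitaliFamily (volume : Measure (Fin m → ℝ)) C (by
    intro x
    refine Filter.Eventually.frequently ?_
    filter_upwards [self_mem_nhdsWithin] with ρ (hρ : 0 < ρ)
    rw [hvol _ _ (by positivity), hvol _ _ hρ.le]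
    calc ENNReal.ofReal ((2 * (3 * ρ)) ^ m) = ((3 ^ m : NNReal) : ℝ≥0∞) *
          ENNReal.ofReal ((2 * ρ) ^ m) := by
          rw [show (2 * (3 * ρ)) = 3 * (2 * ρ) by ring, mul_pow,
            ENNReal.ofReal_mul (by positivity)]
          congr 1
          rw [ENNReal.ofReal_pow (by norm_num)]
          simp
      _ ≤ _ := by
        gcongr
        exact le_max_left _ _)
  filter_upwards [v.ae_tendsto_lintegral_div hF.aemeasurable hfin] with x hx
  intro a η hη hη0 hxa
  have hlim : Filter.Tendsto (fun k => Icc (a k) (a k + η k • ℓ)) Filter.atTop (v.filterAt x) := by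
    rw [VitaliFamily.tendsto_filterAt_iff]
    have hsub : ∀ k, Icc (a k) (a k + η k • ℓ) ⊆ Metric.closedBall x (η k * L) := by
      intro k y hy
      rw [Metric.mem_closedBall, dist_pi_le_iff (by have := hη k; positivity)]
      intro i
      have h1 := hy.1 i
      have h2 := hy.2 i
      have h3 := (hxa k).1 i
      have h4 := (hxa k).2 i
      simp only [Pi.add_apply, Pi.smul_apply, smul_eq_mul] at h2 h4
      have h5 : η k * ℓ i ≤ η k * L := mul_le_mul_of_nonneg_left (hℓL i) (hη k).le
      rw [Real.dist_eq, abs_le]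
      constructor <;> linarith
    constructor
    · refine Filter.Eventually.of_forall fun k => ?_
      refine ⟨isClosed_Icc, ?_, η k * L, hsub k, ?_⟩
      · have hsubset : box (a k) (a k + η k • ℓ) ⊆ interior (Icc (a k) (a k + η k • ℓ)) :=
          interior_maximal (fun y hy => ⟨fun i => (hy i (mem_univ i)).1.le,
            fun i => (hy i (mem_univ i)).2.le⟩) (isOpen_set_pi finite_univ fun _ _ => isOpen_Ioo)
        refine Nonempty.mono hsubset ⟨fun i => a k i + η k * ℓ i / 2, fun i _ => ?_⟩
        have := mul_pos (hη k) (hℓ i)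
        constructor <;> simp <;> linarith
      · rw [hvol _ _ (by have := hη k; positivity), Real.volume_Icc_pi]
        simp only [Pi.add_apply, Pi.smul_apply, smul_eq_mul, add_sub_cancel_left]
        rw [← ENNReal.ofReal_prod_of_nonneg fun i _ => (mul_pos (hη k) (hℓ i)).le,
          Finset.prod_mul_distrib]
        simp only [Finset.prod_const, Finset.card_univ, Fintype.card_fin]
        calc ENNReal.ofReal ((2 * (3 * (η k * L))) ^ m)
            = (Real.toNNReal ((6 * L) ^ m / ∏ i, ℓ i) : ℝ≥0∞) *
              ENNReal.ofReal (η k ^ m * ∏ i, ℓ i) := by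
              rw [ENNReal.ofNNReal_toNNReal, ← ENNReal.ofReal_mul (by positivity)]
              congr 1
              field_simp
              rw [← mul_pow]
              ring
          _ ≤ _ := by
            gcongr
            exact le_max_right _ _
    · intro ε hε
      have h0 : Filter.Tendsto (fun k => η k * L) Filter.atTop (nhds 0) := by
        simpa using hη0.mul_const L
      filter_upwards [h0.eventually (gt_mem_nhds hε)] with k hk
      exact (hsub k).trans (Metric.closedBall_subset_closedBall hk.le)
  refine (hx.comp hlim).congr fun k => ?_
  simp only [Function.comp]
  rw [measure_congr (box_ae_eq_Icc _ _), setLIntegral_congr (box_ae_eq_Icc _ _)]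

/-- Lebesgue differentiation along homothetic rectangles. -/
theorem ae_tendsto_box_average {m : ℕ} (ℓ : Fin m → ℝ) (hℓ : ∀ i, 0 < ℓ i)
    {F : (Fin m → ℝ) → ℝ≥0∞} (hF : Measurable F) (hfin : ∀ a b, ∫⁻ x in box a b, F x ≠ ∞) :
    ∀ᵐ x, ∀ (a : ℕ → Fin m → ℝ) (η : ℕ → ℝ), (∀ k, 0 < η k) →
      Filter.Tendsto η Filter.atTop (nhds 0) → (∀ k, x ∈ Icc (a k) (a k + η k • ℓ)) →
      Filter.Tendsto (fun k => (∫⁻ y in box (a k) (a k + η k • ℓ), F y) /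
        volume (box (a k) (a k + η k • ℓ))) Filter.atTop (nhds (F x)) := by
  have key : ∀ N : ℕ, _ := fun N => ae_tendsto_box_average_of_integrable ℓ hℓ
    (F := (box (fun _ => -(N : ℝ)) (fun _ => (N : ℝ))).indicator F)
    (hF.indicator (measurableSet_box _ _))
    (by rw [lintegral_indicator (measurableSet_box _ _)]; exact hfin _ _)
  filter_upwards [ae_all_iff.2 key] with x hx
  intro a η hη hη0 hxa
  obtain ⟨N, hN⟩ := exists_nat_gt (‖x‖ + 1)
  have hxN : x ∈ box (fun _ => -(N : ℝ)) (fun _ => (N : ℝ)) := by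
    intro i _
    have := norm_le_pi_norm x i
    rw [Real.norm_eq_abs, abs_le] at this
    constructor <;> linarith [this.1, this.2]
  have h := hx N a η hη hη0 hxa
  rw [indicator_of_mem hxN] at h
  refine h.congr' ?_
  obtain ⟨δ, hδ, hδs⟩ : ∃ δ > 0, δ * (∑ i, ℓ i) ≤ 1 := by
    have := Finset.sum_nonneg fun i (_ : i ∈ Finset.univ) => (hℓ i).le
    refine ⟨1 / (∑ i, ℓ i + 1), by positivity, ?_⟩
    rw [div_mul_eq_mul_div, one_mul, div_le_one (by positivity)]
    linarith
  filter_upwards [hη0.eventually (gt_mem_nhds hδ)] with k hk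
  congr 1
  refine setLIntegral_congr_fun (measurableSet_box _ _) fun y hy => ?_
  refine indicator_of_mem ?_ _
  intro i _
  have h1 := hy i (mem_univ i)
  have h3 := (hxa k).1 i
  have h4 := (hxa k).2 i
  simp only [Pi.add_apply, Pi.smul_apply, smul_eq_mul, mem_Ioo] at h1 h4
  have h5 : η k * ℓ i ≤ 1 := by
    have := Finset.single_le_sum (fun i _ => (hℓ i).le) (Finset.mem_univ i)
    calc η k * ℓ i ≤ δ * ∑ i, ℓ i := by
          apply mul_le_mul hk.le this (hℓ i).le hδ.le
      _ ≤ 1 := hδs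
  have := norm_le_pi_norm x i
  rw [Real.norm_eq_abs, abs_le] at this
  constructor <;> linarith [this.1, this.2]

/-! ### Muckenhoupt weights and directional maximal functions -/

/-- The strong Muckenhoupt condition `A_r` with constant `K`, for an everywhere positive and
finite weight, both the weight and its dual being locally integrable. -/
structure BoxMuckenhoupt {n : ℕ} (r : ℝ) (K : ℝ≥0∞) (W : (Fin n → ℝ) → ℝ≥0∞) : Prop where
  measurable : Measurable W
  ne_zero : ∀ x, W x ≠ 0
  ne_top : ∀ x, W x ≠ ∞
  lintegral_ne_top : ∀ a b, ∫⁻ x in box a b, W x ≠ ∞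
  lintegral_dual_ne_top : ∀ a b, ∫⁻ x in box a b, W x ^ (-1 / (r - 1)) ≠ ∞
  le : ∀ a b : Fin n → ℝ, (∀ i, a i < b i) → (∫⁻ x in box a b, W x) *
    (∫⁻ x in box a b, W x ^ (-1 / (r - 1))) ^ (r - 1) ≤ K * volume (box a b) ^ r

/-- Tonelli in the `i`-th coordinate. -/
theorem lintegral_insertNth {m : ℕ} (i : Fin (m + 1)) {F : (Fin (m + 1) → ℝ) → ℝ≥0∞}
    (hF : Measurable F) :
    ∫⁻ x, F x = ∫⁻ y : Fin m → ℝ, ∫⁻ t : ℝ, F (i.insertNth t y) := by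
  have h := (volume_preserving_piFinSuccAbove (fun _ : Fin (m + 1) => ℝ) i).symm
  rw [← h.lintegral_comp hF, Measure.volume_eq_prod, lintegral_prod_symm]
  · rfl
  · exact (hF.comp (MeasurableEquiv.measurable _)).aemeasurable

theorem measurable_insertNth {m : ℕ} (i : Fin (m + 1)) :
    Measurable fun z : ℝ × (Fin m → ℝ) => (i.insertNth z.1 z.2 : Fin (m + 1) → ℝ) :=
  (MeasurableEquiv.piFinSuccAbove (fun _ : Fin (m + 1) => ℝ) i).symm.measurable

theorem insertNth_mem_box {m : ℕ} (i : Fin (m + 1)) {a b t : ℝ} {a' b' y : Fin m → ℝ} :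
    (i.insertNth t y : Fin (m + 1) → ℝ) ∈ box (i.insertNth a a') (i.insertNth b b') ↔
      t ∈ Ioo a b ∧ y ∈ box a' b' := by
  simp only [box, mem_univ_pi]
  rw [Fin.forall_iff_succAbove i]
  simp

theorem setLIntegral_insertNth_box {m : ℕ} (i : Fin (m + 1)) {F : (Fin (m + 1) → ℝ) → ℝ≥0∞}
    (hF : Measurable F) (a b : ℝ) (a' b' : Fin m → ℝ) :
    ∫⁻ x in box (i.insertNth a a' : Fin (m + 1) → ℝ) (i.insertNth b b'), F x =
      ∫⁻ y in box a' b', ∫⁻ t in Ioo a b, F (i.insertNth t y) := by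
  rw [← lintegral_indicator (measurableSet_box _ _),
    lintegral_insertNth i (hF.indicator (measurableSet_box _ _)),
    ← lintegral_indicator (measurableSet_box _ _)]
  refine lintegral_congr fun y => ?_
  by_cases hy : y ∈ box a' b'
  · rw [indicator_of_mem hy, ← lintegral_indicator measurableSet_Ioo]
    refine lintegral_congr fun t => ?_
    by_cases ht : t ∈ Ioo a b
    · rw [indicator_of_mem ht, indicator_of_mem ((insertNth_mem_box i).2 ⟨ht, hy⟩)]
    · rw [indicator_of_notMem ht, indicator_of_notMem fun h => ht ((insertNth_mem_box i).1 h).1]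
  · rw [indicator_of_notMem hy]
    rw [← lintegral_zero (μ := (volume : Measure ℝ))]
    refine lintegral_congr fun t => ?_
    exact indicator_of_notMem (fun h => hy ((insertNth_mem_box i).1 h).2) _

theorem volume_insertNth_box {m : ℕ} (i : Fin (m + 1)) (a b : ℝ) (a' b' : Fin m → ℝ) :
    volume (box (i.insertNth a a' : Fin (m + 1) → ℝ) (i.insertNth b b')) =
      ENNReal.ofReal (b - a) * volume (box a' b') := by
  rw [volume_box, volume_box, Fin.prod_univ_succAbove _ i]
  simp

theorem measurable_setLIntegral_insertNth {m : ℕ} (i : Fin (m + 1))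
    {F : (Fin (m + 1) → ℝ) → ℝ≥0∞} (hF : Measurable F) (s : Set ℝ) :
    Measurable fun y : Fin m → ℝ => ∫⁻ t in s, F (i.insertNth t y) := by
  have : Measurable fun z : (Fin m → ℝ) × ℝ => F (i.insertNth z.2 z.1) :=
    hF.comp ((measurable_insertNth i).comp measurable_swap)
  exact this.lintegral_prod_right'

/-- Almost every line section of a strong `A_r` weight satisfies the one dimensional `A_r`
condition with the same constant. -/
theorem BoxMuckenhoupt.ae_section {m : ℕ} {r : ℝ} (hr : 1 < r) {K : ℝ≥0∞}
    {W : (Fin (m + 1) → ℝ) → ℝ≥0∞} (hW : BoxMuckenhoupt r K W) (i : Fin (m + 1)) :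
    ∀ᵐ y : Fin m → ℝ, ∀ a b : ℚ, (a : ℝ) < b →
      (∫⁻ t in Ioo (a : ℝ) b, W (i.insertNth t y)) *
        (∫⁻ t in Ioo (a : ℝ) b, W (i.insertNth t y) ^ (-1 / (r - 1))) ^ (r - 1) ≤
          K * ENNReal.ofReal (b - a) ^ r := by
  rw [ae_all_iff]; intro a
  rw [ae_all_iff]; intro b
  by_cases hab : (a : ℝ) < b
  swap
  · exact Filter.Eventually.of_forall fun _ h => absurd h hab
  have hV : Measurable fun x => W x ^ (-1 / (r - 1)) := hW.measurable.pow_const _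
  have hF := measurable_setLIntegral_insertNth i hW.measurable (Ioo (a : ℝ) b)
  have hG := measurable_setLIntegral_insertNth i hV (Ioo (a : ℝ) b)
  -- With the rational interval fixed, the A_r condition on its product with a cube shrinking to `y`
  -- becomes, in the limit, the condition on the line section at `y`. Only countably many intervals
  -- occur, so one null set suffices for all.
  set F := fun y : Fin m → ℝ => ∫⁻ t in Ioo (a : ℝ) b, W (i.insertNth t y) with hFdef
  set G := fun y : Fin m → ℝ => ∫⁻ t in Ioo (a : ℝ) b, W (i.insertNth t y) ^ (-1 / (r - 1))
    with hGdef
  have hFf : ∀ a' b', ∫⁻ y in box a' b', F y ≠ ∞ := fun a' b' => by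
    rw [hFdef, ← setLIntegral_insertNth_box i hW.measurable]
    exact hW.lintegral_ne_top _ _
  have hGf : ∀ a' b', ∫⁻ y in box a' b', G y ≠ ∞ := fun a' b' => by
    rw [hGdef, ← setLIntegral_insertNth_box i hV]
    exact hW.lintegral_dual_ne_top _ _
  have hfin : ∀ H : (Fin m → ℝ) → ℝ≥0∞, Measurable H → (∀ a' b', ∫⁻ y in box a' b', H y ≠ ∞) →
      ∀ᵐ y, H y ≠ ∞ := by
    intro H hH hHf
    have : ∀ N : ℕ, ∀ᵐ y, y ∈ box (fun _ : Fin m => -(N : ℝ)) (fun _ => (N : ℝ)) → H y ≠ ∞ := by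
      intro N
      have := ae_lt_top hH (hHf (fun _ => -(N : ℝ)) (fun _ => (N : ℝ)))
      rw [ae_restrict_iff' (measurableSet_box _ _)] at this
      exact this.mono fun y hy h => (hy h).ne
    filter_upwards [ae_all_iff.2 this] with y hy
    obtain ⟨N, hN⟩ := exists_nat_gt ‖y‖
    refine hy N fun i _ => ?_
    have := norm_le_pi_norm y i
    rw [Real.norm_eq_abs, abs_le] at this
    constructor <;> linarith [this.1, this.2]
  filter_upwards [ae_tendsto_box_average (fun _ : Fin m => 1) (fun _ => one_pos) hF hFf,
    ae_tendsto_box_average (fun _ : Fin m => 1) (fun _ => one_pos) hG hGf,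
    hfin F hF hFf, hfin G hG hGf] with y h1 h2 hFy hGy
  intro _
  let η : ℕ → ℝ := fun k => 1 / ((k : ℝ) + 1)
  have hη : ∀ k, 0 < η k := fun k => by positivity
  have hη0 : Filter.Tendsto η Filter.atTop (nhds 0) := tendsto_one_div_add_atTop_nhds_zero_nat
  have hmem : ∀ k, y ∈ Icc y (y + η k • fun _ => (1 : ℝ)) := fun k =>
    ⟨le_rfl, fun i => by simpa using (hη k).le⟩
  -- The limits `F y` and `G y` must be finite for the product to converge, since `0 * ∞` is not
  -- continuous.
  have hlim := ENNReal.Tendsto.mul (h1 (fun _ => y) η hη hη0 hmem) (Or.inr ?_)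
    ((h2 (fun _ => y) η hη hη0 hmem).ennrpow_const (r - 1)) (Or.inr hFy)
  · refine le_of_tendsto hlim (Filter.Eventually.of_forall fun k => ?_)
    set b' := y + η k • fun _ : Fin m => (1 : ℝ) with hb'
    have hlt : ∀ j, y j < b' j := fun j => by simpa [hb'] using hη k
    set v := volume (box y b') with hv
    have hv0 : v ≠ 0 := volume_box_ne_zero hlt
    have hvt : v ≠ ∞ := volume_box_ne_top _ _
    have h := hW.le (i.insertNth (a : ℝ) y) (i.insertNth (b : ℝ) b') (by
      rw [Fin.forall_iff_succAbove i]
      simpa using ⟨by exact_mod_cast hab, hlt⟩)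
    rw [setLIntegral_insertNth_box i hW.measurable, setLIntegral_insertNth_box i hV,
      volume_insertNth_box, ← hv, ENNReal.mul_rpow_of_nonneg _ _ (by linarith), ← mul_assoc] at h
    rw [ENNReal.div_rpow_of_nonneg _ _ (by linarith)]
    have hvr : v * v ^ (r - 1) = v ^ r := by
      nth_rewrite 1 [← ENNReal.rpow_one v]
      rw [← ENNReal.rpow_add _ _ hv0 hvt]
      congr 1; ring
    have hr0 : v ^ r ≠ 0 := by simp [ENNReal.rpow_eq_zero_iff, hv0, hvt]
    have hrt : v ^ r ≠ ∞ := ENNReal.rpow_ne_top_of_nonneg (by linarith) hvt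
    have hr10 : v ^ (r - 1) ≠ 0 := by simp [ENNReal.rpow_eq_zero_iff, hv0, hvt]
    rw [div_eq_mul_inv, div_eq_mul_inv, mul_mul_mul_comm,
      ← ENNReal.mul_inv (Or.inl hv0) (Or.inl hvt), hvr, ← div_eq_mul_inv]
    exact ENNReal.div_le_of_le_mul h
  · exact ENNReal.rpow_ne_top_of_nonneg (by linarith) hGy

/-- The maximal function in the direction of the `i`-th coordinate axis. -/
def dirMax {n : ℕ} (i : Fin n) (f : (Fin n → ℝ) → ℝ≥0∞) (x : Fin n → ℝ) : ℝ≥0∞ :=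
  lineMax (fun t => f (Function.update x i t)) (x i)

/-- The supremum runs over countably many rational intervals, each term being an indicator in `x i`
times a parametric integral. This is what the restriction to rational endpoints is for. -/
theorem measurable_dirMax {n : ℕ} (i : Fin n) {f : (Fin n → ℝ) → ℝ≥0∞} (hf : Measurable f) :
    Measurable (dirMax i f) := by
  unfold dirMax lineMax
  refine Measurable.iSup fun J => ?_
  have h : ∀ x : Fin n → ℝ, (⨆ (_ : x i ∈ Ioo (J.1 : ℝ) J.2),
      (∫⁻ t in Ioo (J.1 : ℝ) J.2, f (Function.update x i t)) / ENNReal.ofReal (J.2 - J.1)) =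
      ((fun x : Fin n → ℝ => x i) ⁻¹' Ioo (J.1 : ℝ) J.2).indicator (fun x =>
        (∫⁻ t in Ioo (J.1 : ℝ) J.2, f (Function.update x i t)) / ENNReal.ofReal (J.2 - J.1)) x := by
    intro x
    by_cases hx : x i ∈ Ioo (J.1 : ℝ) J.2 <;> simp [indicator, hx]
  simp_rw [h]
  refine Measurable.indicator ?_ ((measurable_pi_apply i) measurableSet_Ioo)
  refine Measurable.div_const ?_ _
  have : Measurable fun z : (Fin n → ℝ) × ℝ => f (Function.update z.1 i z.2) :=
    hf.comp measurable_update'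
  exact this.lintegral_prod_right'

/-- Weighted weak type `(r, r)` inequality for directional maximal functions. -/
theorem BoxMuckenhoupt.dirMax_weak_type {n : ℕ} {r : ℝ} (hr : 1 < r) {K : ℝ≥0∞}
    {W : (Fin n → ℝ) → ℝ≥0∞} (hW : BoxMuckenhoupt r K W) (i : Fin n)
    {f : (Fin n → ℝ) → ℝ≥0∞} (hf : Measurable f) (s : ℝ≥0∞) :
    s ^ r * ∫⁻ x in {x | s < dirMax i f x}, W x ≤ 2 * K * ∫⁻ x, f x ^ r * W x := by
  obtain ⟨m, rfl⟩ : ∃ m, n = m + 1 := ⟨n - 1, by have := i.pos; omega⟩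
  have hset : MeasurableSet {x | s < dirMax i f x} :=
    measurableSet_lt measurable_const (measurable_dirMax i hf)
  rw [← lintegral_indicator hset, lintegral_insertNth i (hW.measurable.indicator hset),
    lintegral_insertNth i (F := fun x => f x ^ r * W x) ((hf.pow_const r).mul hW.measurable)]
  have hI : ∀ {F : (Fin (m + 1) → ℝ) → ℝ≥0∞}, Measurable F →
      Measurable fun y : Fin m → ℝ => ∫⁻ t, F (i.insertNth t y) := fun {F} hF => by
    simpa using measurable_setLIntegral_insertNth i hF univ
  have hI1 := hI (hW.measurable.indicator hset)
  have hI2 := hI (F := fun x => f x ^ r * W x) ((hf.pow_const r).mul hW.measurable)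
  rw [← lintegral_const_mul _ hI1, ← lintegral_const_mul _ hI2]
  refine lintegral_mono_ae ?_
  filter_upwards [hW.ae_section hr i] with y hy
  have hins : Measurable fun t : ℝ => (i.insertNth t y : Fin (m + 1) → ℝ) :=
    (measurable_insertNth i).comp (measurable_id.prodMk measurable_const)
  have key := lineMax_weak_type hr (hW.measurable.comp hins) (hf.comp hins)
    (fun t => hW.ne_zero _) (fun t => hW.ne_top _) K hy s
  refine le_trans (le_of_eq ?_) key
  congr 1
  have hs : {t | s < lineMax (f ∘ fun t => (i.insertNth t y : Fin (m + 1) → ℝ)) t} =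
      (fun t : ℝ => (i.insertNth t y : Fin (m + 1) → ℝ)) ⁻¹' {x | s < dirMax i f x} := by
    ext t
    simp only [mem_ofPred_eq, mem_preimage, dirMax, Fin.update_insertNth, Fin.insertNth_apply_same]
    rfl
  rw [hs, ← lintegral_indicator (hins hset)]
  rfl

/-! ### Layer cake formula and interpolation -/

theorem setLIntegral_rpow_sub_one {p c : ℝ} (hp : 0 < p) (hc : 0 ≤ c) :
    ∫⁻ t in Ioc 0 c, ENNReal.ofReal (p * t ^ (p - 1)) = ENNReal.ofReal (c ^ p) := by
  have hint : IntervalIntegrable (fun t : ℝ => p * t ^ (p - 1)) volume 0 c :=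
    (intervalIntegral.intervalIntegrable_rpow' (by linarith)).const_mul p
  rw [← ofReal_integral_eq_lintegral_ofReal]
  · rw [← intervalIntegral.integral_of_le hc, intervalIntegral.integral_const_mul,
      integral_rpow (Or.inl (by linarith))]
    congr 1
    rw [sub_add_cancel, Real.zero_rpow hp.ne', sub_zero]
    field_simp
  · exact (intervalIntegrable_iff_integrableOn_Ioc_of_le hc).1 hint
  · filter_upwards [ae_restrict_mem measurableSet_Ioc] with t ht
    have := ht.1
    positivity

theorem lintegral_indicator_rpow_sub_one {p : ℝ} (hp : 0 < p) (y : ℝ≥0∞) :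
    ∫⁻ t in Ioi (0 : ℝ), {t : ℝ | ENNReal.ofReal t < y}.indicator
      (fun t => ENNReal.ofReal (p * t ^ (p - 1))) t = y ^ p := by
  have hmeas : ∀ y : ℝ≥0∞, MeasurableSet {t : ℝ | ENNReal.ofReal t < y} := fun y =>
    measurableSet_lt ENNReal.measurable_ofReal measurable_const
  have hfin : ∀ c : ℝ, 0 ≤ c → ∫⁻ t in Ioi (0 : ℝ), {t : ℝ | ENNReal.ofReal t <
      ENNReal.ofReal c}.indicator (fun t => ENNReal.ofReal (p * t ^ (p - 1))) t =
        ENNReal.ofReal (c ^ p) := by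
    intro c hc
    rw [lintegral_indicator (hmeas _), Measure.restrict_restrict (hmeas _),
      ← setLIntegral_rpow_sub_one hp hc, setLIntegral_congr Ioo_ae_eq_Ioc.symm]
    congr 2
    ext t
    simp only [mem_inter_iff, mem_ofPred_eq, mem_Ioi, mem_Ioo]
    constructor
    · rintro ⟨h1, h2⟩
      exact ⟨h2, (ENNReal.ofReal_lt_ofReal_iff_of_nonneg h2.le).1 h1⟩
    · rintro ⟨h1, h2⟩
      exact ⟨(ENNReal.ofReal_lt_ofReal_iff_of_nonneg h1.le).2 h2, h1⟩
  by_cases hy : y = ∞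
  · subst hy
    rw [ENNReal.top_rpow_of_pos hp, eq_top_iff]
    refine ENNReal.le_of_forall_nnreal_lt fun c _ => ?_
    calc (c : ℝ≥0∞) = ENNReal.ofReal (((c : ℝ) ^ (1 / p)) ^ p) := by
          rw [← Real.rpow_mul c.coe_nonneg, one_div_mul_cancel hp.ne', Real.rpow_one]; simp
      _ = _ := (hfin _ (by positivity)).symm
      _ ≤ _ := by
        refine lintegral_mono fun t => indicator_le_indicator_of_subset ?_ (by simp) t
        intro t _
        exact ENNReal.ofReal_lt_top
  · rw [← ENNReal.ofReal_toReal hy, hfin _ ENNReal.toReal_nonneg,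
      ENNReal.ofReal_rpow_of_nonneg ENNReal.toReal_nonneg hp.le]

/-- The layer cake formula for powers, for functions with values in `[0, ∞]`. -/
theorem lintegral_rpow_layercake {X : Type*} [MeasurableSpace X] (μ : Measure X) [SFinite μ]
    {F : X → ℝ≥0∞} (hF : Measurable F) {p : ℝ} (hp : 0 < p) :
    ∫⁻ x, F x ^ p ∂μ =
      ∫⁻ t in Ioi (0 : ℝ), ENNReal.ofReal (p * t ^ (p - 1)) * μ {x | ENNReal.ofReal t < F x} := by
  simp_rw [← lintegral_indicator_rpow_sub_one hp]
  have hS : MeasurableSet {z : X × ℝ | ENNReal.ofReal z.2 < F z.1} :=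
    measurableSet_lt (ENNReal.measurable_ofReal.comp measurable_snd) (hF.comp measurable_fst)
  rw [lintegral_lintegral_swap]
  · refine lintegral_congr fun t => ?_
    have hm : MeasurableSet {x | ENNReal.ofReal t < F x} := measurableSet_lt measurable_const hF
    rw [← setLIntegral_const, ← lintegral_indicator hm]
    rfl
  · have : Measurable ({z : X × ℝ | ENNReal.ofReal z.2 < F z.1}.indicator
        fun z => ENNReal.ofReal (p * z.2 ^ (p - 1))) :=
      Measurable.indicator (by fun_prop) hS
    exact this.aemeasurable

theorem antitone_distribution {X : Type*} [MeasurableSpace X] (μ : Measure X) (F : X → ℝ≥0∞) :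
    Antitone fun t : ℝ => μ {x | ENNReal.ofReal t < F x} := fun _ _ hst =>
  measure_mono fun _ hx => (ENNReal.ofReal_le_ofReal hst).trans_lt hx

theorem measurable_distribution {X : Type*} [MeasurableSpace X] (μ : Measure X) (F : X → ℝ≥0∞) :
    Measurable fun t : ℝ => μ {x | ENNReal.ofReal t < F x} :=
  (antitone_distribution μ F).measurable

/-- Truncation: an operator of weak type `(r, r)` which is subadditive with respect to adding
constants satisfies a localized weak type inequality. -/
theorem truncated_weak_type {X : Type*} [MeasurableSpace X] {μ : Measure X}
    {T : (X → ℝ≥0∞) → X → ℝ≥0∞} {r : ℝ} {A : ℝ≥0∞} (hr : 0 < r)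
    (hsub : ∀ f, Measurable f → ∀ (t : ℝ≥0∞) (x : X), T f x ≤ T ({y | t < f y}.indicator f) x + t)
    (hweak : ∀ f, Measurable f → ∀ s : ℝ≥0∞, s ^ r * μ {x | s < T f x} ≤ A * ∫⁻ x, f x ^ r ∂μ)
    {f : X → ℝ≥0∞} (hf : Measurable f) {s : ℝ} (hs : 0 < s) :
    μ {x | ENNReal.ofReal s < T f x} ≤
      A * ENNReal.ofReal ((s / 2) ^ (-r)) *
        ∫⁻ x in {x | ENNReal.ofReal (s / 2) < f x}, f x ^ r ∂μ := by
  set t := ENNReal.ofReal (s / 2) with ht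
  have ht0 : t ≠ 0 := by simpa [ht] using hs
  have htt : t ≠ ∞ := ENNReal.ofReal_ne_top
  have hS : MeasurableSet {x | t < f x} := measurableSet_lt measurable_const hf
  -- The part of `f` below `t` contributes at most `t` to `T f`; where `T f` exceeds `2t`, the
  -- operator applied to the upper part must exceed `t`.
  have h2 : ENNReal.ofReal s = t + t := by
    rw [ht, ← ENNReal.ofReal_add (by positivity) (by positivity), add_halves]
  have hsubset : {x | ENNReal.ofReal s < T f x} ⊆ {x | t < T ({y | t < f y}.indicator f) x} := by
    intro x hx
    simp only [mem_ofPred_eq] at hx ⊢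
    rw [h2] at hx
    exact lt_of_add_lt_add_right (hx.trans_le (hsub f hf t x))
  have h3 := hweak _ (hf.indicator hS) t
  have h4 : ∫⁻ x, ({y | t < f y}.indicator f x) ^ r ∂μ = ∫⁻ x in {x | t < f x}, f x ^ r ∂μ := by
    rw [← lintegral_indicator hS]
    refine lintegral_congr fun x => ?_
    by_cases hx : x ∈ {x | t < f x}
    · rw [indicator_of_mem hx, indicator_of_mem hx]
    · rw [indicator_of_notMem hx, indicator_of_notMem hx, ENNReal.zero_rpow_of_pos hr]
  rw [h4] at h3
  have h5 : ENNReal.ofReal ((s / 2) ^ (-r)) * t ^ r = 1 := by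
    rw [ht, ENNReal.ofReal_rpow_of_nonneg (by positivity) hr.le,
      ← ENNReal.ofReal_mul (by positivity), ← Real.rpow_add (by positivity)]
    simp
  calc μ {x | ENNReal.ofReal s < T f x} ≤ μ {x | t < T ({y | t < f y}.indicator f) x} :=
        measure_mono hsubset
    _ = ENNReal.ofReal ((s / 2) ^ (-r)) *
        (t ^ r * μ {x | t < T ({y | t < f y}.indicator f) x}) := by rw [← mul_assoc, h5, one_mul]
    _ ≤ ENNReal.ofReal ((s / 2) ^ (-r)) * (A * ∫⁻ x in {x | t < f x}, f x ^ r ∂μ) := by gcongr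
    _ = _ := by ring

/-- Marcinkiewicz interpolation between weak type `(r₀, r₀)` and `L^∞`. -/
theorem strong_type_of_weak_type {X : Type*} [MeasurableSpace X] {μ : Measure X} [SFinite μ]
    {T : (X → ℝ≥0∞) → X → ℝ≥0∞} {r₀ r : ℝ} {A : ℝ≥0∞} (hr₀ : 0 < r₀) (hr : r₀ < r)
    (hmeas : ∀ f, Measurable f → Measurable (T f))
    (hsub : ∀ f, Measurable f → ∀ (t : ℝ≥0∞) (x : X), T f x ≤ T ({y | t < f y}.indicator f) x + t)
    (hweak : ∀ f, Measurable f → ∀ s : ℝ≥0∞, s ^ r₀ * μ {x | s < T f x} ≤ A * ∫⁻ x, f x ^ r₀ ∂μ)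
    {f : X → ℝ≥0∞} (hf : Measurable f) :
    ∫⁻ x, T f x ^ r ∂μ ≤ ENNReal.ofReal (2 ^ r * (r / (r - r₀))) * A * ∫⁻ x, f x ^ r ∂μ := by
  have hr0 : 0 < r := hr₀.trans hr
  have hd : 0 < r - r₀ := by linarith
  -- The truncated moments in `truncated_weak_type` are the distribution function of `2f` under `ρ`.
  -- The layer cake formula, used backwards with exponent `r - r₀`, then recovers the r-th moment of
  -- `f`.
  set ρ := μ.withDensity fun x => f x ^ r₀ with hρ
  have h2f : Measurable fun x => 2 * f x := by fun_prop
  calc ∫⁻ x, T f x ^ r ∂μ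
      = ∫⁻ s in Ioi (0 : ℝ), ENNReal.ofReal (r * s ^ (r - 1)) *
          μ {x | ENNReal.ofReal s < T f x} := lintegral_rpow_layercake μ (hmeas f hf) hr0
    _ ≤ ∫⁻ s in Ioi (0 : ℝ), (A * ENNReal.ofReal (2 ^ r₀ * (r / (r - r₀)))) *
          (ENNReal.ofReal ((r - r₀) * s ^ (r - r₀ - 1)) *
          ρ {x | ENNReal.ofReal s < 2 * f x}) := by
        refine setLIntegral_mono' measurableSet_Ioi fun s (hs : 0 < s) => ?_
        have hset : {x | ENNReal.ofReal s < 2 * f x} = {x | ENNReal.ofReal (s / 2) < f x} := by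
          ext x
          simp only [mem_ofPred_eq]
          rw [ENNReal.ofReal_div_of_pos (by norm_num), ENNReal.div_lt_iff (by simp) (by simp),
            mul_comm]
          simp
        rw [hset, hρ, withDensity_apply _ (measurableSet_lt measurable_const hf)]
        refine (mul_le_mul_right (truncated_weak_type hr₀ hsub hweak hf hs) _).trans
          (le_of_eq ?_)
        have hreal : ENNReal.ofReal (r * s ^ (r - 1)) * ENNReal.ofReal ((s / 2) ^ (-r₀)) =
            ENNReal.ofReal (2 ^ r₀ * (r / (r - r₀))) *
              ENNReal.ofReal ((r - r₀) * s ^ (r - r₀ - 1)) := by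
          rw [← ENNReal.ofReal_mul (by positivity), ← ENNReal.ofReal_mul (by positivity)]
          congr 1
          rw [Real.div_rpow hs.le (by norm_num), Real.rpow_neg (by norm_num : (0 : ℝ) ≤ 2),
            div_inv_eq_mul, show r - r₀ - 1 = (r - 1) + (-r₀) by ring, Real.rpow_add hs]
          field_simp
        calc _ = A * (ENNReal.ofReal (r * s ^ (r - 1)) * ENNReal.ofReal ((s / 2) ^ (-r₀))) *
              ∫⁻ x in {x | ENNReal.ofReal (s / 2) < f x}, f x ^ r₀ ∂μ := by ring
          _ = _ := by rw [hreal]; ring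
    _ = (A * ENNReal.ofReal (2 ^ r₀ * (r / (r - r₀)))) * ∫⁻ x, (2 * f x) ^ (r - r₀) ∂ρ := by
        rw [lintegral_rpow_layercake ρ h2f hd, lintegral_const_mul]
        exact (by fun_prop : Measurable fun s : ℝ => ENNReal.ofReal ((r - r₀) * s ^ (r - r₀ - 1))).mul
          (measurable_distribution ρ _)
    _ = (A * ENNReal.ofReal (2 ^ r₀ * (r / (r - r₀)))) *
          ∫⁻ x, ENNReal.ofReal (2 ^ (r - r₀)) * f x ^ r ∂μ := by
        congr 1
        rw [hρ, lintegral_withDensity_eq_lintegral_mul _ (hf.pow_const _) (by fun_prop)]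
        refine lintegral_congr fun x => ?_
        simp only [Pi.mul_apply]
        rw [ENNReal.mul_rpow_of_nonneg _ _ hd.le, ← mul_assoc, mul_comm (f x ^ r₀), mul_assoc,
          ← ENNReal.rpow_add_of_nonneg _ _ hr₀.le hd.le, add_sub_cancel,
          ← ENNReal.ofReal_rpow_of_nonneg (by norm_num) hd.le]
        simp
    _ = _ := by
        rw [lintegral_const_mul _ (hf.pow_const _)]
        have : ENNReal.ofReal (2 ^ r * (r / (r - r₀))) =
            ENNReal.ofReal (2 ^ r₀ * (r / (r - r₀))) * ENNReal.ofReal (2 ^ (r - r₀)) := by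
          rw [← ENNReal.ofReal_mul (by positivity)]
          congr 1
          rw [mul_right_comm, ← Real.rpow_add (by norm_num), add_sub_cancel]
        rw [this]
        ring

/-! ### Iterating directional maximal functions -/

theorem le_indicator_add {X : Type*} (f : X → ℝ≥0∞) (t : ℝ≥0∞) (x : X) :
    f x ≤ {y | t < f y}.indicator f x + t := by
  by_cases hx : x ∈ {y | t < f y}
  · rw [indicator_of_mem hx]; exact le_self_add
  · rw [indicator_of_notMem hx, zero_add]; exact not_lt.1 hx

theorem lineMax_le_add {g h : ℝ → ℝ≥0∞} {t : ℝ≥0∞} (hgh : ∀ x, g x ≤ h x + t) (x : ℝ) :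
    lineMax g x ≤ lineMax h x + t := by
  refine iSup₂_le fun J hJ => ?_
  have hlt : (J.1 : ℝ) < J.2 := hJ.1.trans hJ.2
  have hL0 : ENNReal.ofReal ((J.2 : ℝ) - J.1) ≠ 0 := by simpa using hlt
  calc (∫⁻ t in Ioo (J.1 : ℝ) J.2, g t) / ENNReal.ofReal (J.2 - J.1)
      ≤ (∫⁻ y in Ioo (J.1 : ℝ) J.2, (h y + t)) / ENNReal.ofReal (J.2 - J.1) := by
        gcongr with y
        exact hgh y
    _ = (∫⁻ y in Ioo (J.1 : ℝ) J.2, h y) / ENNReal.ofReal (J.2 - J.1) + t := by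
        rw [lintegral_add_right _ measurable_const, setLIntegral_const, Real.volume_Ioo,
          ENNReal.add_div, ENNReal.mul_div_cancel_right hL0 ENNReal.ofReal_ne_top]
    _ ≤ _ := by
        gcongr
        exact le_iSup₂_of_le J hJ le_rfl

theorem dirMax_le_add {n : ℕ} (i : Fin n) {f : (Fin n → ℝ) → ℝ≥0∞} (t : ℝ≥0∞) (x : Fin n → ℝ) :
    dirMax i f x ≤ dirMax i ({y | t < f y}.indicator f) x + t :=
  lineMax_le_add (fun _ => le_indicator_add f t _) _

/-- The composition of the directional maximal functions along a list of directions. -/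
def iterMax {n : ℕ} (l : List (Fin n)) (f : (Fin n → ℝ) → ℝ≥0∞) : (Fin n → ℝ) → ℝ≥0∞ :=
  l.foldr dirMax f

theorem measurable_iterMax {n : ℕ} (l : List (Fin n)) {f : (Fin n → ℝ) → ℝ≥0∞}
    (hf : Measurable f) : Measurable (iterMax l f) := by
  induction l with
  | nil => exact hf
  | cons i l ih => exact measurable_dirMax i ih

/-- Integrating out one coordinate costs its side length times a directional maximal function
evaluated at the current point. As directions are not repeated, changing the coordinate `i` leaves
the remaining coordinates inside their intervals, and the induction proceeds. -/
theorem lmarginal_le_iterMax {n : ℕ} (a b : Fin n → ℝ) {f : (Fin n → ℝ) → ℝ≥0∞}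
    (hf : Measurable f) (l : List (Fin n)) (hl : l.Nodup) (y : Fin n → ℝ)
    (hy : ∀ i ∈ l, y i ∈ Ioo (a i) (b i)) :
    (∫⋯∫⁻_l.toFinset, f ∂fun i => volume.restrict (Ioo (a i) (b i))) y ≤
      (∏ i ∈ l.toFinset, ENNReal.ofReal (b i - a i)) * iterMax l f y := by
  induction l generalizing y with
  | nil => simp [iterMax]
  | cons i l ih =>
    rw [List.nodup_cons] at hl
    have hi : i ∉ l.toFinset := by simpa using hl.1
    rw [List.toFinset_cons, lmarginal_insert _ hf hi, Finset.prod_insert hi]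
    set P := ∏ j ∈ l.toFinset, ENNReal.ofReal (b j - a j)
    calc ∫⁻ t in Ioo (a i) (b i), (∫⋯∫⁻_l.toFinset, f ∂fun i => volume.restrict
          (Ioo (a i) (b i))) (Function.update y i t)
        ≤ ∫⁻ t in Ioo (a i) (b i), P * iterMax l f (Function.update y i t) := by
          refine lintegral_mono fun t => ih hl.2 _ fun j hj => ?_
          have hji : j ≠ i := fun h => hl.1 (h ▸ hj)
          rw [Function.update_of_ne hji]
          exact hy j (List.mem_cons_of_mem _ hj)
      _ = P * ∫⁻ t in Ioo (a i) (b i), iterMax l f (Function.update y i t) := by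
          exact lintegral_const_mul P ((measurable_iterMax l hf).comp (measurable_update y))
      _ ≤ P * (ENNReal.ofReal (b i - a i) * dirMax i (iterMax l f) y) := by
          gcongr
          exact setLIntegral_Ioo_le_lineMax _ (hy i List.mem_cons_self)
      _ = _ := by
          simp only [iterMax, List.foldr_cons]
          ring

theorem setLIntegral_box_le_iterMax {n : ℕ} {a b : Fin n → ℝ} {f : (Fin n → ℝ) → ℝ≥0∞}
    (hf : Measurable f) {x : Fin n → ℝ} (hx : x ∈ box a b) :
    ∫⁻ y in box a b, f y ≤ volume (box a b) * iterMax (List.finRange n) f x := by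
  have h := lmarginal_le_iterMax a b hf (List.finRange n) (List.nodup_finRange n) x
    fun i _ => hx i (mem_univ i)
  rw [List.toFinset_finRange, lmarginal_univ] at h
  rw [volume_box]
  refine le_trans (le_of_eq ?_) h
  rw [box, volume_pi, Measure.restrict_pi_pi]

theorem box_mem_rectangles {n : ℕ} {a b : Fin n → ℝ} (h : ∀ i, a i < b i) :
    box a b ∈ rectangles n := ⟨a, b, h, rfl⟩

/-- The strong maximal function is controlled by iterated directional maximal functions. -/
theorem strongMaximal_le_iterMax {n : ℕ} {f : (Fin n → ℝ) → ℝ≥0∞} (hf : Measurable f)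
    (x : Fin n → ℝ) : strongMaximal f x ≤ iterMax (List.finRange n) f x := by
  refine iSup₂_le ?_
  rintro R ⟨⟨a, b, hab, rfl⟩, hx⟩
  rw [setLAverage_eq]
  refine ENNReal.div_le_of_le_mul ?_
  rw [mul_comm]
  exact setLIntegral_box_le_iterMax hf hx

theorem strongMaximal_le_add {n : ℕ} {f : (Fin n → ℝ) → ℝ≥0∞} (t : ℝ≥0∞)
    (x : Fin n → ℝ) :
    strongMaximal f x ≤ strongMaximal ({y | t < f y}.indicator f) x + t := by
  refine iSup₂_le fun R hR => ?_
  obtain ⟨⟨a, b, hab, rfl⟩, hx⟩ := hR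
  calc ⨍⁻ y in box a b, ‖f y‖ₑ ∂volume
      ≤ ⨍⁻ y in box a b, ({y | t < f y}.indicator f y + t) ∂volume := by
        rw [setLAverage_eq, setLAverage_eq]
        gcongr with y
        exact le_indicator_add f t y
    _ = (⨍⁻ y in box a b, {y | t < f y}.indicator f y ∂volume) + t := by
        rw [setLAverage_eq, setLAverage_eq, lintegral_add_right _ measurable_const,
          setLIntegral_const, ENNReal.add_div, ENNReal.mul_div_cancel_right
            (volume_box_ne_zero hab) (volume_box_ne_top _ _)]
    _ ≤ _ := by
        gcongr
        exact le_iSup₂_of_le (box a b) ⟨⟨a, b, hab, rfl⟩, hx⟩ le_rfl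

theorem BoxMuckenhoupt.lintegral_iterMax_rpow_le {n : ℕ} {r₀ r : ℝ} (hr₀ : 1 < r₀) (hr : r₀ < r)
    {K : ℝ≥0∞} {W : (Fin n → ℝ) → ℝ≥0∞} (hW : BoxMuckenhoupt r₀ K W) (l : List (Fin n))
    {f : (Fin n → ℝ) → ℝ≥0∞} (hf : Measurable f) :
    ∫⁻ x, iterMax l f x ^ r * W x ≤
      (ENNReal.ofReal (2 ^ r * (r / (r - r₀))) * (2 * K)) ^ l.length * ∫⁻ x, f x ^ r * W x := by
  have hconv : ∀ {g : (Fin n → ℝ) → ℝ≥0∞} (r : ℝ), Measurable g →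
      ∫⁻ x, g x ^ r ∂(volume.withDensity W) = ∫⁻ x, g x ^ r * W x := by
    intro g r hg
    rw [lintegral_withDensity_eq_lintegral_mul _ hW.measurable (hg.pow_const _)]
    simp [mul_comm]
  induction l with
  | nil => simp [iterMax]
  | cons i l ih =>
    have hm := measurable_iterMax l hf
    have h := strong_type_of_weak_type (μ := volume.withDensity W) (T := dirMax i)
      (A := 2 * K) (by linarith) hr (fun f hf => measurable_dirMax i hf)
      (fun f _ t x => dirMax_le_add i t x) (fun g hg s => by
        rw [withDensity_apply _ (measurableSet_lt measurable_const (measurable_dirMax i hg)),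
          hconv r₀ hg]
        exact hW.dirMax_weak_type hr₀ i hg s) hm
    rw [hconv r hm, hconv r (measurable_dirMax i hm)] at h
    rw [List.length_cons, pow_succ', mul_assoc]
    exact h.trans (by gcongr)

/-- Weighted weak type `(r, r)` inequality for the strong maximal function. -/
theorem BoxMuckenhoupt.strongMaximal_weak_type {m : ℕ} {r₀ r : ℝ} (hr₀ : 1 < r₀) (hr : r₀ < r)
    {K₀ K : ℝ≥0∞} {W : (Fin (m + 1) → ℝ) → ℝ≥0∞} (hW₀ : BoxMuckenhoupt r₀ K₀ W)
    (hW : BoxMuckenhoupt r K W) {f : (Fin (m + 1) → ℝ) → ℝ≥0∞} (hf : Measurable f) (s : ℝ≥0∞) :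
    s ^ r * volume.withDensity W {x | s < strongMaximal f x} ≤
      2 * K * (ENNReal.ofReal (2 ^ r * (r / (r - r₀))) * (2 * K₀)) ^ m *
        ∫⁻ x, f x ^ r * W x := by
  set l := (List.finRange m).map Fin.succ with hl
  have hm := measurable_iterMax l hf
  -- The outermost direction is kept for the weak type bound at `r`, which has no interpolation
  -- loss. The other `m` directions must be bounded in the strong sense and each pays the factor
  -- `r/(r - r₀)`.
  have hsub : {x | s < strongMaximal f x} ⊆ {x | s < dirMax 0 (iterMax l f) x} := by
    intro x hx
    have := strongMaximal_le_iterMax hf x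
    rw [List.finRange_succ] at this
    exact lt_of_lt_of_le hx this
  calc s ^ r * volume.withDensity W {x | s < strongMaximal f x}
      ≤ s ^ r * volume.withDensity W {x | s < dirMax 0 (iterMax l f) x} := by gcongr
    _ = s ^ r * ∫⁻ x in {x | s < dirMax 0 (iterMax l f) x}, W x := by
        rw [withDensity_apply _ (measurableSet_lt measurable_const (measurable_dirMax 0 hm))]
    _ ≤ 2 * K * ∫⁻ x, iterMax l f x ^ r * W x := hW.dirMax_weak_type (by linarith) 0 hm s
    _ ≤ 2 * K * ((ENNReal.ofReal (2 ^ r * (r / (r - r₀))) * (2 * K₀)) ^ l.length *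
          ∫⁻ x, f x ^ r * W x) := by
        gcongr
        exact hW₀.lintegral_iterMax_rpow_le hr₀ hr l hf
    _ = _ := by
        rw [hl, List.length_map, List.length_finRange, ← mul_assoc]

/-! ### The reverse Hölder inequality -/

/-- The half-open rectangle `∏ i, [a i, b i)`. -/
def cell {n : ℕ} (a b : Fin n → ℝ) : Set (Fin n → ℝ) :=
  Set.pi Set.univ fun i => Set.Ico (a i) (b i)

theorem measurableSet_cell {n : ℕ} (a b : Fin n → ℝ) : MeasurableSet (cell a b) :=
  MeasurableSet.univ_pi fun _ => measurableSet_Ico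

theorem cell_ae_eq_box {n : ℕ} (a b : Fin n → ℝ) : cell a b =ᵐ[volume] box a b :=
  Measure.univ_pi_Ico_ae_eq_Icc.trans (box_ae_eq_Icc a b).symm

theorem volume_cell {n : ℕ} (a b : Fin n → ℝ) : volume (cell a b) = volume (box a b) :=
  measure_congr (cell_ae_eq_box a b)

theorem cell_eq_union {n : ℕ} {a b : Fin n → ℝ} (i : Fin n) {c : ℝ} (ha : a i ≤ c) (hb : c ≤ b i) :
    cell a b = cell a (Function.update b i c) ∪ cell (Function.update a i c) b := by
  ext x
  simp only [cell, mem_union, mem_univ_pi, mem_Ico]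
  constructor
  · intro h
    rcases lt_or_ge (x i) c with hx | hx
    · left
      intro j
      by_cases hj : j = i
      · subst hj; simpa using ⟨(h j).1, hx⟩
      · simpa [Function.update_of_ne hj] using h j
    · right
      intro j
      by_cases hj : j = i
      · subst hj; simpa using ⟨hx, (h j).2⟩
      · simpa [Function.update_of_ne hj] using h j
  · rintro (h | h) j
    · by_cases hj : j = i
      · subst hj
        have := h j
        simp only [Function.update_self] at this
        exact ⟨this.1, this.2.trans_le hb⟩
      · simpa [Function.update_of_ne hj] using h j
    · by_cases hj : j = i
      · subst hj
        have := h j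
        simp only [Function.update_self] at this
        exact ⟨ha.trans this.1, this.2⟩
      · simpa [Function.update_of_ne hj] using h j

theorem lt_of_mem_cell_left {n : ℕ} {a b : Fin n → ℝ} {i : Fin n} {c : ℝ} {x : Fin n → ℝ}
    (hx : x ∈ cell a (Function.update b i c)) : x i < c := by
  simpa using (hx i (mem_univ i)).2

theorem le_of_mem_cell_right {n : ℕ} {a b : Fin n → ℝ} {i : Fin n} {c : ℝ} {x : Fin n → ℝ}
    (hx : x ∈ cell (Function.update a i c) b) : c ≤ x i := by
  simpa using (hx i (mem_univ i)).1

theorem disjoint_cell {n : ℕ} (a b : Fin n → ℝ) (i : Fin n) (c : ℝ) :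
    Disjoint (cell a (Function.update b i c)) (cell (Function.update a i c) b) :=
  Set.disjoint_left.2 fun _ h1 h2 =>
    (lt_of_mem_cell_left h1).not_ge (le_of_mem_cell_right h2)

/-- Halving one side halves the volume. This factor 2, instead of the `2^n` of the usual dyadic
subdivision, keeps the threshold for `ε` in the reverse Hölder inequality free of the dimension. -/
theorem volume_cell_left {n : ℕ} (a b : Fin n → ℝ) (i : Fin n) :
    volume (cell a b) = 2 * volume (cell a (Function.update b i ((a i + b i) / 2))) := by
  rw [volume_cell, volume_cell, volume_box, volume_box,
    ← Finset.mul_prod_erase Finset.univ _ (Finset.mem_univ i),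
    ← Finset.mul_prod_erase Finset.univ (fun j => ENNReal.ofReal (Function.update b i _ j - a j))
      (Finset.mem_univ i), ← mul_assoc]
  congr 1
  · rw [Function.update_self, show (2 : ℝ≥0∞) = ENNReal.ofReal 2 by simp,
      ← ENNReal.ofReal_mul (by norm_num)]
    congr 1
    ring
  · refine Finset.prod_congr rfl fun j hj => ?_
    rw [Function.update_of_ne (Finset.ne_of_mem_erase hj)]

theorem volume_cell_right {n : ℕ} (a b : Fin n → ℝ) (i : Fin n) :
    volume (cell a b) = 2 * volume (cell (Function.update a i ((a i + b i) / 2)) b) := by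
  rw [volume_cell, volume_cell, volume_box, volume_box,
    ← Finset.mul_prod_erase Finset.univ _ (Finset.mem_univ i),
    ← Finset.mul_prod_erase Finset.univ (fun j => ENNReal.ofReal (b j - Function.update a i _ j))
      (Finset.mem_univ i), ← mul_assoc]
  congr 1
  · rw [Function.update_self, show (2 : ℝ≥0∞) = ENNReal.ofReal 2 by simp,
      ← ENNReal.ofReal_mul (by norm_num)]
    congr 1
    ring
  · refine Finset.prod_congr rfl fun j hj => ?_
    rw [Function.update_of_ne (Finset.ne_of_mem_erase hj)]

theorem update_right_gt {n : ℕ} {a b : Fin n → ℝ} (h : ∀ j, a j < b j) (i : Fin n) (j : Fin n) :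
    a j < Function.update b i ((a i + b i) / 2) j := by
  by_cases hj : j = i
  · subst hj; rw [Function.update_self]; linarith [h j]
  · rw [Function.update_of_ne hj]; exact h j

theorem update_left_lt {n : ℕ} {a b : Fin n → ℝ} (h : ∀ j, a j < b j) (i : Fin n) (j : Fin n) :
    Function.update a i ((a i + b i) / 2) j < b j := by
  by_cases hj : j = i
  · subst hj; rw [Function.update_self]; linarith [h j]
  · rw [Function.update_of_ne hj]; exact h j

/-- The average of `S` over a half-open rectangle. -/
def cellAvg {n : ℕ} (S : (Fin n → ℝ) → ℝ≥0∞) (a b : Fin n → ℝ) : ℝ≥0∞ :=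
  (∫⁻ x in cell a b, S x) / volume (cell a b)

/-- The maximal average of `S` over the successive rectangles containing `x` which are obtained
from `∏ i, [a i, b i)` by bisecting the sides along a list of directions. -/
def dyadMax {n : ℕ} (S : (Fin n → ℝ) → ℝ≥0∞) :
    List (Fin n) → (Fin n → ℝ) → (Fin n → ℝ) → (Fin n → ℝ) → ℝ≥0∞
  | [], a, b, _ => cellAvg S a b
  | i :: L, a, b, x => max (cellAvg S a b)
      (if x i < (a i + b i) / 2 then dyadMax S L a (Function.update b i ((a i + b i) / 2)) x
        else dyadMax S L (Function.update a i ((a i + b i) / 2)) b x)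

theorem measurable_dyadMax {n : ℕ} (S : (Fin n → ℝ) → ℝ≥0∞) (L : List (Fin n))
    (a b : Fin n → ℝ) : Measurable (dyadMax S L a b) := by
  induction L generalizing a b with
  | nil => exact measurable_const
  | cons i L ih =>
    exact measurable_const.max (Measurable.ite
      (measurableSet_lt (measurable_pi_apply i) measurable_const) (ih _ _) (ih _ _))

theorem dyadMax_cons_left {n : ℕ} (S : (Fin n → ℝ) → ℝ≥0∞) (i : Fin n) (L : List (Fin n))
    {a b x : Fin n → ℝ} (hx : x ∈ cell a (Function.update b i ((a i + b i) / 2))) :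
    dyadMax S (i :: L) a b x =
      max (cellAvg S a b) (dyadMax S L a (Function.update b i ((a i + b i) / 2)) x) := by
  rw [dyadMax, if_pos (lt_of_mem_cell_left hx)]

theorem dyadMax_cons_right {n : ℕ} (S : (Fin n → ℝ) → ℝ≥0∞) (i : Fin n) (L : List (Fin n))
    {a b x : Fin n → ℝ} (hx : x ∈ cell (Function.update a i ((a i + b i) / 2)) b) :
    dyadMax S (i :: L) a b x =
      max (cellAvg S a b) (dyadMax S L (Function.update a i ((a i + b i) / 2)) b x) := by
  rw [dyadMax, if_neg (le_of_mem_cell_right hx).not_gt]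

theorem cellAvg_le_dyadMax {n : ℕ} (S : (Fin n → ℝ) → ℝ≥0∞) (L : List (Fin n))
    (a b x : Fin n → ℝ) : cellAvg S a b ≤ dyadMax S L a b x := by
  cases L with
  | nil => exact le_rfl
  | cons i L => exact le_max_left _ _

theorem cellAvg_ne_top {n : ℕ} {S : (Fin n → ℝ) → ℝ≥0∞}
    (hS : ∀ a b, ∫⁻ x in box a b, S x ≠ ∞) {a b : Fin n → ℝ} (hab : ∀ i, a i < b i) :
    cellAvg S a b ≠ ∞ := by
  rw [cellAvg, setLIntegral_congr (cell_ae_eq_box a b), volume_cell]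
  exact ENNReal.div_ne_top (hS a b) (volume_box_ne_zero hab)

/-- Only finitely many averages occur. The bound itself is never used quantitatively; it makes the
moment to be absorbed in `reverse_holder` finite. -/
theorem dyadMax_bounded {n : ℕ} {S : (Fin n → ℝ) → ℝ≥0∞}
    (hS : ∀ a b, ∫⁻ x in box a b, S x ≠ ∞) (L : List (Fin n)) {a b : Fin n → ℝ}
    (hab : ∀ i, a i < b i) : ∃ C : ℝ≥0∞, C ≠ ∞ ∧ ∀ x, dyadMax S L a b x ≤ C := by
  induction L generalizing a b with
  | nil => exact ⟨_, cellAvg_ne_top hS hab, fun _ => le_rfl⟩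
  | cons i L ih =>
    obtain ⟨C1, h1, hC1⟩ := ih (update_right_gt hab i)
    obtain ⟨C2, h2, hC2⟩ := ih (update_left_lt hab i)
    refine ⟨max (cellAvg S a b) (max C1 C2),
      (max_lt (cellAvg_ne_top hS hab).lt_top (max_lt h1.lt_top h2.lt_top)).ne, fun x => ?_⟩
    rw [dyadMax]
    refine max_le_max le_rfl ?_
    split_ifs
    · exact (hC1 x).trans (le_max_left _ _)
    · exact (hC2 x).trans (le_max_right _ _)

/-- The averages over closed rectangles containing `x` are also bounded by the strong maximal
function. -/
theorem box_average_le_strongMaximal {n : ℕ} (g : (Fin n → ℝ) → ℝ≥0∞) {a b x : Fin n → ℝ}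
    (hab : ∀ i, a i < b i) (hx : x ∈ Icc a b) :
    (∫⁻ y in box a b, g y) / volume (box a b) ≤ strongMaximal g x := by
  rw [ENNReal.div_le_iff_le_mul (Or.inl (volume_box_ne_zero hab))
    (Or.inl (volume_box_ne_top _ _)), mul_comm]
  by_cases hM : strongMaximal g x = ∞
  · rw [hM, ENNReal.mul_top (volume_box_ne_zero hab)]
    exact le_top
  have hε : ∀ ε : ℝ, 0 < ε → ∫⁻ y in box a b, g y ≤
      (∏ i, ENNReal.ofReal (b i - a i + 2 * ε)) * strongMaximal g x := by
    intro ε hε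
    set a' : Fin n → ℝ := fun i => a i - ε with ha'
    set b' : Fin n → ℝ := fun i => b i + ε with hb'
    have hab' : ∀ i, a' i < b' i := fun i => by
      have := hab i
      simp only [ha', hb']; linarith
    have hx' : x ∈ box a' b' := fun i _ => by
      have h1 := hx.1 i
      have h2 := hx.2 i
      constructor <;> simp only [ha', hb'] <;> linarith
    have hsub : box a b ⊆ box a' b' := fun y hy i hi => by
      have := hy i hi
      constructor <;> simp only [ha', hb'] <;> linarith [this.1, this.2]
    have h1 : ⨍⁻ y in box a' b', ‖g y‖ₑ ∂volume ≤ strongMaximal g x :=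
      le_iSup₂_of_le (box a' b') ⟨⟨a', b', hab', rfl⟩, hx'⟩ le_rfl
    rw [setLAverage_eq, ENNReal.div_le_iff_le_mul (Or.inl (volume_box_ne_zero hab'))
      (Or.inl (volume_box_ne_top _ _)), mul_comm, volume_box] at h1
    refine (lintegral_mono_set hsub).trans (h1.trans (le_of_eq ?_))
    congr 1
    refine Finset.prod_congr rfl fun i _ => ?_
    congr 1
    simp only [ha', hb']; ring
  have hlim : Filter.Tendsto (fun ε : ℝ =>
      (∏ i, ENNReal.ofReal (b i - a i + 2 * ε)) * strongMaximal g x)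
      (nhdsWithin 0 (Ioi 0)) (nhds (volume (box a b) * strongMaximal g x)) := by
    refine ENNReal.Tendsto.mul_const ?_ (Or.inr hM)
    have hc : Continuous fun ε : ℝ => ENNReal.ofReal (∏ i, max (b i - a i + 2 * ε) 0) :=
      ENNReal.continuous_ofReal.comp (by fun_prop)
    have he : ∀ ε : ℝ, ∏ i, ENNReal.ofReal (b i - a i + 2 * ε) =
        ENNReal.ofReal (∏ i, max (b i - a i + 2 * ε) 0) := fun ε => by
      rw [ENNReal.ofReal_prod_of_nonneg fun i _ => le_max_right _ _]
      refine Finset.prod_congr rfl fun i _ => ?_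
      rw [ENNReal.ofReal_max]; simp
    simp_rw [he]
    have h0 := (hc.tendsto 0).mono_left (nhdsWithin_le_nhds (s := Ioi (0 : ℝ)))
    rw [← he 0] at h0
    simpa [volume_box] using h0
  exact ge_of_tendsto hlim (Filter.eventually_of_mem self_mem_nhdsWithin fun ε h => hε ε h)

/-- All successive rectangles stay inside `box A B`, so cutting `S` off outside it does not change
their averages. A half-open cell may contain `x` on its boundary, which is why the version for
closed rectangles is needed. -/
theorem dyadMax_le_strongMaximal {n : ℕ} (S : (Fin n → ℝ) → ℝ≥0∞) (L : List (Fin n))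
    {A B a b x : Fin n → ℝ} (hab : ∀ i, a i < b i) (hA : A ≤ a) (hB : b ≤ B) (hx : x ∈ cell a b) :
    dyadMax S L a b x ≤ strongMaximal ((box A B).indicator S) x := by
  have havg : ∀ {a b : Fin n → ℝ}, (∀ i, a i < b i) → A ≤ a → b ≤ B → x ∈ cell a b →
      cellAvg S a b ≤ strongMaximal ((box A B).indicator S) x := by
    intro a b hab hA hB hx
    have hx' : x ∈ Icc a b :=
      ⟨fun i => (hx i (mem_univ i)).1, fun i => (hx i (mem_univ i)).2.le⟩
    refine le_trans (le_of_eq ?_) (box_average_le_strongMaximal _ hab hx')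
    rw [cellAvg, setLIntegral_congr (cell_ae_eq_box a b), volume_cell]
    congr 1
    refine setLIntegral_congr_fun (measurableSet_box _ _) fun y hy => ?_
    refine (indicator_of_mem (fun i hi => ?_) _).symm
    exact ⟨(hA i).trans_lt (hy i hi).1, (hy i hi).2.trans_le (hB i)⟩
  induction L generalizing a b with
  | nil => exact havg hab hA hB hx
  | cons i L ih =>
    have hm1 : a i ≤ (a i + b i) / 2 := by linarith [hab i]
    have hm2 : (a i + b i) / 2 ≤ b i := by linarith [hab i]
    have hx2 := hx
    rw [cell_eq_union i hm1 hm2] at hx2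
    rcases hx2 with h | h
    · rw [dyadMax_cons_left S i L h]
      refine max_le (havg hab hA hB hx) (ih (update_right_gt hab i) hA (le_trans ?_ hB) h)
      exact update_le_iff.2 ⟨hm2, fun _ _ => le_rfl⟩
    · rw [dyadMax_cons_right S i L h]
      refine max_le (havg hab hA hB hx) (ih (update_left_lt hab i) (hA.trans ?_) hB h)
      exact le_update_iff.2 ⟨hm1, fun _ _ => le_rfl⟩

/-- The stopping time estimate on the level sets of the local dyadic maximal function. -/
theorem setLIntegral_dyadMax_level_le {n : ℕ} {S : (Fin n → ℝ) → ℝ≥0∞}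
    {g : List (Fin n) → (Fin n → ℝ) → (Fin n → ℝ) → (Fin n → ℝ) → ℝ≥0∞} {τ : ℝ≥0∞}
    (hg : ∀ L a b, (∀ i, a i < b i) → ∫⁻ x in cell a b, g L a b x ≤ τ * ∫⁻ x in cell a b, S x)
    (hleft : ∀ i L a b x, x ∈ cell a (Function.update b i ((a i + b i) / 2)) →
      cellAvg S a b < dyadMax S (i :: L) a b x →
      g (i :: L) a b x = g L a (Function.update b i ((a i + b i) / 2)) x)
    (hright : ∀ i L a b x, x ∈ cell (Function.update a i ((a i + b i) / 2)) b →
      cellAvg S a b < dyadMax S (i :: L) a b x →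
      g (i :: L) a b x = g L (Function.update a i ((a i + b i) / 2)) b x)
    (L : List (Fin n)) {a b : Fin n → ℝ} (hab : ∀ i, a i < b i) {t : ℝ≥0∞}
    (ht : cellAvg S a b ≤ t) :
    ∫⁻ x in cell a b ∩ {x | t < dyadMax S L a b x}, g L a b x ≤
      2 * τ * t * volume (cell a b ∩ {x | t < dyadMax S L a b x}) := by
  induction L generalizing a b with
  | nil =>
    have : {x | t < dyadMax S [] a b x} = ∅ := by
      ext x; simpa [dyadMax] using ht
    simp [this]
  | cons i L ih =>
    have hm1 : a i ≤ (a i + b i) / 2 := by linarith [hab i]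
    have hm2 : (a i + b i) / 2 ≤ b i := by linarith [hab i]
    have hSint : ∫⁻ x in cell a b, S x ≤ t * volume (cell a b) := by
      rw [cellAvg, volume_cell, ENNReal.div_le_iff_le_mul (Or.inl (volume_box_ne_zero hab))
        (Or.inl (volume_box_ne_top _ _))] at ht
      rwa [volume_cell]
    -- Both halves are treated alike. Above the level `t` the average over the parent is irrelevant,
    -- being at most `t`, so there both the maximal function and `g` coincide with those of the
    -- half.
    have hchild : ∀ {a' b' : Fin n → ℝ}, (∀ i, a' i < b' i) → cell a' b' ⊆ cell a b →
        volume (cell a b) = 2 * volume (cell a' b') →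
        (∀ x ∈ cell a' b', dyadMax S (i :: L) a b x =
          max (cellAvg S a b) (dyadMax S L a' b' x)) →
        (∀ x ∈ cell a' b', cellAvg S a b < dyadMax S (i :: L) a b x →
          g (i :: L) a b x = g L a' b' x) →
        ∫⁻ x in cell a' b' ∩ {x | t < dyadMax S (i :: L) a b x}, g (i :: L) a b x ≤
          2 * τ * t * volume (cell a' b' ∩ {x | t < dyadMax S (i :: L) a b x}) := by
      intro a' b' hab' hsub hvol hM hgg
      have hset : cell a' b' ∩ {x | t < dyadMax S (i :: L) a b x} =
          cell a' b' ∩ {x | t < dyadMax S L a' b' x} := by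
        ext x
        simp only [mem_inter_iff, mem_ofPred_eq]
        refine and_congr_right fun hx => ?_
        rw [hM x hx, lt_max_iff]
        exact ⟨fun h => h.resolve_left ht.not_gt, Or.inr⟩
      have hint : ∫⁻ x in cell a' b' ∩ {x | t < dyadMax S (i :: L) a b x}, g (i :: L) a b x =
          ∫⁻ x in cell a' b' ∩ {x | t < dyadMax S L a' b' x}, g L a' b' x := by
        rw [← hset]
        refine setLIntegral_congr_fun ((measurableSet_cell _ _).inter
          (measurableSet_lt measurable_const (measurable_dyadMax _ _ _ _))) fun x hx => ?_
        exact hgg x hx.1 (ht.trans_lt hx.2)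
      rw [hint, hset]
      -- Stopping time alternative: if the half has average at most `t`, recurse; otherwise stop. A
      -- stopped half lies entirely in the level set, and its integral is controlled through the
      -- parent, whose average is at most `t` and whose volume is twice as large.
      by_cases h : cellAvg S a' b' ≤ t
      · exact ih hab' h
      · have hall : cell a' b' ∩ {x | t < dyadMax S L a' b' x} = cell a' b' :=
          inter_eq_left.2 fun x _ => (not_le.1 h).trans_le (cellAvg_le_dyadMax S L a' b' x)
        rw [hall]
        calc ∫⁻ x in cell a' b', g L a' b' x ≤ τ * ∫⁻ x in cell a' b', S x := hg L a' b' hab'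
          _ ≤ τ * ∫⁻ x in cell a b, S x := by gcongr
          _ ≤ τ * (t * volume (cell a b)) := by gcongr
          _ = _ := by rw [hvol]; ring
    have hU := cell_eq_union i hm1 hm2
    have hmL : MeasurableSet {x | t < dyadMax S (i :: L) a b x} :=
      measurableSet_lt measurable_const (measurable_dyadMax _ _ _ _)
    have hD := (disjoint_cell a b i ((a i + b i) / 2)).mono
      (inter_subset_left (t := {x | t < dyadMax S (i :: L) a b x}))
      (inter_subset_left (t := {x | t < dyadMax S (i :: L) a b x}))
    have h1 := hchild (update_right_gt hab i) (hU ▸ subset_union_left) (volume_cell_left a b i)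
      (fun x hx => dyadMax_cons_left S i L hx) (fun x hx h => hleft i L a b x hx h)
    have h2 := hchild (update_left_lt hab i) (hU ▸ subset_union_right) (volume_cell_right a b i)
      (fun x hx => dyadMax_cons_right S i L hx) (fun x hx h => hright i L a b x hx h)
    rw [hU, union_inter_distrib_right,
      lintegral_union ((measurableSet_cell _ _).inter hmL) hD,
      measure_union hD ((measurableSet_cell _ _).inter hmL), mul_add]
    exact add_le_add h1 h2

/-- A Gehring type estimate: good control of `ν` by `μ` on the level sets of `M` above the level
`t₀` gives control of powers. -/
theorem lintegral_rpow_le_of_level_le {X : Type*} [MeasurableSpace X] {μ ν : Measure X}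
    [SFinite μ] [SFinite ν] {M : X → ℝ≥0∞} (hM : Measurable M) {t₀ c : ℝ≥0∞} {ε : ℝ} (hε : 0 < ε)
    (h : ∀ t : ℝ≥0∞, t₀ ≤ t → ν {x | t < M x} ≤ c * t * μ {x | t < M x}) :
    ∫⁻ x, M x ^ ε ∂ν ≤ t₀ ^ ε * ν univ +
      c * ENNReal.ofReal (ε / (1 + ε)) * ∫⁻ x, M x ^ (1 + ε) ∂μ := by
  have hmeas1 : Measurable ({t : ℝ | ENNReal.ofReal t < t₀}.indicator
      fun t => ENNReal.ofReal (ε * t ^ (ε - 1))) :=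
    Measurable.indicator (by fun_prop) (measurableSet_lt ENNReal.measurable_ofReal measurable_const)
  calc ∫⁻ x, M x ^ ε ∂ν
      = ∫⁻ t in Ioi (0 : ℝ), ENNReal.ofReal (ε * t ^ (ε - 1)) *
          ν {x | ENNReal.ofReal t < M x} := lintegral_rpow_layercake ν hM hε
    _ ≤ ∫⁻ t in Ioi (0 : ℝ), (({t : ℝ | ENNReal.ofReal t < t₀}.indicator
          (fun t => ENNReal.ofReal (ε * t ^ (ε - 1))) t) * ν univ +
          (c * ENNReal.ofReal (ε / (1 + ε))) * (ENNReal.ofReal ((1 + ε) * t ^ (1 + ε - 1)) *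
          μ {x | ENNReal.ofReal t < M x})) := by
        refine setLIntegral_mono' measurableSet_Ioi fun t (ht : 0 < t) => ?_
        -- Below `t₀` the distribution function is bounded by the total mass. Above it the
        -- hypothesis contributes an extra factor `t`, turning `ε t^(ε-1)` into `ε/(1+ε)` times the
        -- density for the exponent `1 + ε`.
        by_cases htt : ENNReal.ofReal t < t₀
        · rw [indicator_of_mem (by exact htt)]
          exact (mul_le_mul_right (measure_mono (subset_univ _)) _).trans le_self_add
        · refine le_trans ?_ le_add_self
          refine (mul_le_mul_right (h _ (not_lt.1 htt)) _).trans (le_of_eq ?_)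
          have hreal : ENNReal.ofReal (ε * t ^ (ε - 1)) * ENNReal.ofReal t =
              ENNReal.ofReal (ε / (1 + ε)) * ENNReal.ofReal ((1 + ε) * t ^ (1 + ε - 1)) := by
            rw [← ENNReal.ofReal_mul (by positivity), ← ENNReal.ofReal_mul (by positivity)]
            congr 1
            rw [show 1 + ε - 1 = (ε - 1) + 1 by ring, Real.rpow_add ht, Real.rpow_one]
            field_simp
          calc _ = c * (ENNReal.ofReal (ε * t ^ (ε - 1)) * ENNReal.ofReal t) *
                μ {x | ENNReal.ofReal t < M x} := by ring
            _ = _ := by rw [hreal]; ring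
    _ = _ := by
        rw [lintegral_add_left (hmeas1.mul_const _), lintegral_mul_const _ hmeas1,
          lintegral_indicator_rpow_sub_one hε,
          lintegral_rpow_layercake μ hM (by linarith : 0 < 1 + ε)]
        congr 1
        exact lintegral_const_mul _ ((by fun_prop : Measurable fun t : ℝ =>
          ENNReal.ofReal ((1 + ε) * t ^ (1 + ε - 1))).mul (measurable_distribution μ M))

/-- The rectangle containing `x` after the last bisection. -/
def lastCell {n : ℕ} : List (Fin n) → (Fin n → ℝ) → (Fin n → ℝ) → (Fin n → ℝ) →
    (Fin n → ℝ) × (Fin n → ℝ)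
  | [], a, b, _ => (a, b)
  | i :: L, a, b, x =>
      if x i < (a i + b i) / 2 then lastCell L a (Function.update b i ((a i + b i) / 2)) x
        else lastCell L (Function.update a i ((a i + b i) / 2)) b x

theorem cellAvg_lastCell_le {n : ℕ} (S : (Fin n → ℝ) → ℝ≥0∞) (L : List (Fin n))
    (a b x : Fin n → ℝ) :
    cellAvg S (lastCell L a b x).1 (lastCell L a b x).2 ≤ dyadMax S L a b x := by
  induction L generalizing a b with
  | nil => exact le_rfl
  | cons i L ih =>
    rw [lastCell, dyadMax]
    split_ifs
    · exact (ih _ _).trans (le_max_right _ _)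
    · exact (ih _ _).trans (le_max_right _ _)

theorem mem_lastCell {n : ℕ} (L : List (Fin n)) {a b x : Fin n → ℝ} (hab : ∀ i, a i < b i)
    (hx : x ∈ cell a b) : x ∈ cell (lastCell L a b x).1 (lastCell L a b x).2 := by
  induction L generalizing a b with
  | nil => exact hx
  | cons i L ih =>
    rw [cell_eq_union i (c := (a i + b i) / 2) (by linarith [hab i]) (by linarith [hab i])] at hx
    rcases hx with h | h
    · rw [lastCell, if_pos (lt_of_mem_cell_left h)]
      exact ih (update_right_gt hab i) h
    · rw [lastCell, if_neg (le_of_mem_cell_right h).not_gt]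
      exact ih (update_left_lt hab i) h

theorem lastCell_sub {n : ℕ} (L : List (Fin n)) (a b x : Fin n → ℝ) (j : Fin n) :
    (lastCell L a b x).2 j - (lastCell L a b x).1 j = (b j - a j) / 2 ^ L.count j := by
  induction L generalizing a b with
  | nil => simp [lastCell]
  | cons i L ih =>
    rw [lastCell]
    by_cases hj : j = i
    · subst hj
      rw [List.count_cons_self, pow_succ']
      split_ifs <;> rw [ih, Function.update_self] <;> field_simp <;> ring
    · rw [List.count_cons_of_ne (Ne.symm hj)]
      split_ifs <;> rw [ih, Function.update_of_ne hj]

/-- The list of directions running `k` times through all coordinates. -/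
def roundRobin (n : ℕ) : ℕ → List (Fin n)
  | 0 => []
  | k + 1 => List.finRange n ++ roundRobin n k

theorem count_roundRobin {n : ℕ} (k : ℕ) (j : Fin n) : (roundRobin n k).count j = k := by
  induction k with
  | zero => simp [roundRobin]
  | succ k ih =>
    rw [roundRobin, List.count_append, ih,
      List.count_eq_one_of_mem (List.nodup_finRange n) (List.mem_finRange j), add_comm]

/-- Reverse Hölder inequality for weights satisfying the strong Fujii-Wilson condition. -/
theorem reverse_holder {n : ℕ} {S : (Fin n → ℝ) → ℝ≥0∞} (hS : Measurable S)
    (hSt : ∀ x, S x ≠ ∞) (hSf : ∀ a b, ∫⁻ x in box a b, S x ≠ ∞) {τ : ℝ} (hτ : 0 < τ)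
    (hFW : ∀ a b : Fin n → ℝ, (∀ i, a i < b i) →
      ∫⁻ x in box a b, strongMaximal ((box a b).indicator S) x ≤
        ENNReal.ofReal τ * ∫⁻ x in box a b, S x)
    {ε : ℝ} (hε : 0 < ε) (hετ : ε ≤ 1 / (4 * τ)) {a b : Fin n → ℝ} (hab : ∀ i, a i < b i) :
    ∫⁻ x in box a b, S x ^ (1 + ε) ≤
      2 * ((∫⁻ x in box a b, S x) / volume (box a b)) ^ ε * ∫⁻ x in box a b, S x := by
  set I := ∫⁻ x in box a b, S x with hI
  set t₀ := cellAvg S a b with ht₀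
  have hcellS : ∀ a b, ∫⁻ x in cell a b, S x = ∫⁻ x in box a b, S x := fun a b =>
    setLIntegral_congr (cell_ae_eq_box a b)
  have ht₀' : t₀ = I / volume (box a b) := by rw [ht₀, cellAvg, hcellS, volume_cell]
  rw [← ht₀']
  have ht₀t : t₀ ≠ ∞ := cellAvg_ne_top hSf hab
  have hIt : I ≠ ∞ := hSf a b
  set μ := (volume : Measure (Fin n → ℝ)).restrict (cell a b) with hμ
  have hmax : ∀ L (a b : Fin n → ℝ), (∀ i, a i < b i) →
      ∫⁻ x in cell a b, dyadMax S L a b x ≤ ENNReal.ofReal τ * ∫⁻ x in cell a b, S x := by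
    intro L a b hab
    calc ∫⁻ x in cell a b, dyadMax S L a b x
        ≤ ∫⁻ x in cell a b, strongMaximal ((box a b).indicator S) x :=
          setLIntegral_mono' (measurableSet_cell _ _) fun x hx =>
            dyadMax_le_strongMaximal S L hab le_rfl le_rfl hx
      _ = ∫⁻ x in box a b, strongMaximal ((box a b).indicator S) x :=
          setLIntegral_congr (cell_ae_eq_box a b)
      _ ≤ _ := by rw [hcellS]; exact hFW a b hab
  have hτε : 4 * τ * ε ≤ 1 := by
    rw [le_div_iff₀ (by positivity)] at hετ
    linarith
  -- A bound uniform in the number of bisections; the limit is taken only afterwards.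
  have hmain : ∀ L, ∫⁻ x, dyadMax S L a b x ^ ε * S x ∂μ ≤ 2 * t₀ ^ ε * I := by
    intro L
    set M := dyadMax S L a b with hM
    have hMm : Measurable M := measurable_dyadMax _ _ _ _
    have hmset : ∀ t : ℝ≥0∞, MeasurableSet {x | t < M x} := fun t =>
      measurableSet_lt measurable_const hMm
    -- The stopping time estimate is used for two densities: for `M` itself, where the Fujii-Wilson
    -- condition supplies the constant `τ`, and for `S`, where the constant is 1.
    have hlev1 : ∀ t : ℝ≥0∞, t₀ ≤ t → μ.withDensity M {x | t < M x} ≤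
        2 * ENNReal.ofReal τ * t * μ {x | t < M x} := by
      intro t ht
      have := setLIntegral_dyadMax_level_le (S := S) (g := dyadMax S) hmax
        (fun i L a b x hx h => by
          rw [dyadMax_cons_left S i L hx] at h ⊢
          exact max_eq_right ((lt_max_iff.1 h).resolve_left (lt_irrefl _)).le)
        (fun i L a b x hx h => by
          rw [dyadMax_cons_right S i L hx] at h ⊢
          exact max_eq_right ((lt_max_iff.1 h).resolve_left (lt_irrefl _)).le) L hab ht
      rw [withDensity_apply _ (hmset t), hμ, Measure.restrict_restrict (hmset t),
        Measure.restrict_apply (hmset t), inter_comm]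
      exact this
    have hlev2 : ∀ t : ℝ≥0∞, t₀ ≤ t → μ.withDensity S {x | t < M x} ≤
        2 * t * μ {x | t < M x} := by
      intro t ht
      have := setLIntegral_dyadMax_level_le (S := S) (g := fun _ _ _ => S) (τ := 1)
        (fun _ _ _ _ => by rw [one_mul]) (fun _ _ _ _ _ _ _ => rfl)
        (fun _ _ _ _ _ _ _ => rfl) L hab ht
      rw [withDensity_apply _ (hmset t), hμ, Measure.restrict_restrict (hmset t),
        Measure.restrict_apply (hmset t), inter_comm]
      simpa using this
    set Y := ∫⁻ x, M x ^ (1 + ε) ∂μ with hY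
    have hYt : Y ≠ ∞ := by
      obtain ⟨C, hC, hMC⟩ := dyadMax_bounded hSf L hab
      refine ne_top_of_le_ne_top (b := C ^ (1 + ε) * volume (cell a b)) ?_ ?_
      · rw [volume_cell]
        exact ENNReal.mul_ne_top (ENNReal.rpow_ne_top_of_nonneg (by linarith) hC)
          (volume_box_ne_top _ _)
      · rw [hY, ← setLIntegral_const]
        refine lintegral_mono fun x => ?_
        gcongr
        exact hMC x
    -- Gehring's absorption: `Y` is at most `τ t₀^ε I` plus `2τ ε/(1+ε)` times `Y`. Since `4τε ≤ 1`
    -- the last coefficient is at most one half, and `Y` is finite, so this term moves to the left.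
    have hY1 : Y ≤ 2 * (ENNReal.ofReal τ * (t₀ ^ ε * I)) := by
      have h := lintegral_rpow_le_of_level_le (μ := μ) (ν := μ.withDensity M) hMm hε hlev1
      rw [lintegral_withDensity_eq_lintegral_mul _ hMm (hMm.pow_const _),
        withDensity_apply _ MeasurableSet.univ, Measure.restrict_univ] at h
      have h1 : ∫⁻ x, (M * fun x => M x ^ ε) x ∂μ = Y := by
        refine lintegral_congr fun x => ?_
        rw [Pi.mul_apply, ENNReal.rpow_add_of_nonneg _ _ zero_le_one hε.le, ENNReal.rpow_one]
      have h2 : 2 * ENNReal.ofReal τ * ENNReal.ofReal (ε / (1 + ε)) ≤ 2⁻¹ := by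
        rw [show (2 : ℝ≥0∞) = ENNReal.ofReal 2 by simp, ← ENNReal.ofReal_inv_of_pos (by norm_num),
          ← ENNReal.ofReal_mul (by norm_num), ← ENNReal.ofReal_mul (by positivity)]
        apply ENNReal.ofReal_le_ofReal
        rw [mul_div_assoc', div_le_iff₀ (by linarith)]
        linarith
      have h3 : ∫⁻ x, M x ∂μ ≤ ENNReal.ofReal τ * I := by
        rw [hI, ← hcellS]; exact hmax L a b hab
      rw [h1] at h
      have h4 : Y ≤ ENNReal.ofReal τ * (t₀ ^ ε * I) + 2⁻¹ * Y := by
        refine h.trans (add_le_add ?_ (by gcongr))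
        calc t₀ ^ ε * ∫⁻ x, M x ∂μ ≤ t₀ ^ ε * (ENNReal.ofReal τ * I) := by gcongr
          _ = _ := by ring
      have h5 : Y = 2⁻¹ * Y + 2⁻¹ * Y := by
        rw [← add_mul, ENNReal.inv_two_add_inv_two, one_mul]
      have h6 : 2⁻¹ * Y ≤ ENNReal.ofReal τ * (t₀ ^ ε * I) := by
        refine (ENNReal.add_le_add_iff_right (a := 2⁻¹ * Y) ?_).1 (h5 ▸ h4)
        exact ENNReal.mul_ne_top (by simp) hYt
      calc Y = 2 * (2⁻¹ * Y) := by
            rw [← mul_assoc, ENNReal.mul_inv_cancel (by simp) (by simp), one_mul]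
        _ ≤ _ := by gcongr
    have h := lintegral_rpow_le_of_level_le (μ := μ) (ν := μ.withDensity S) hMm hε hlev2
    rw [lintegral_withDensity_eq_lintegral_mul _ hS (hMm.pow_const _),
      withDensity_apply _ MeasurableSet.univ, Measure.restrict_univ, hμ, hcellS, ← hI, ← hμ,
      ← hY] at h
    have h2 : 2 * ENNReal.ofReal (ε / (1 + ε)) * (2 * ENNReal.ofReal τ) ≤ 1 := by
      rw [show (2 : ℝ≥0∞) = ENNReal.ofReal 2 by simp, ← ENNReal.ofReal_mul (by norm_num),
        ← ENNReal.ofReal_mul (by norm_num), ← ENNReal.ofReal_mul (by positivity)]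
      rw [← ENNReal.ofReal_one]
      apply ENNReal.ofReal_le_ofReal
      rw [mul_div_assoc', div_mul_eq_mul_div, div_le_iff₀ (by linarith)]
      linarith
    calc ∫⁻ x, M x ^ ε * S x ∂μ = ∫⁻ x, (S * fun x => M x ^ ε) x ∂μ :=
          lintegral_congr fun x => mul_comm _ _
      _ ≤ t₀ ^ ε * I + 2 * ENNReal.ofReal (ε / (1 + ε)) * Y := h
      _ ≤ t₀ ^ ε * I + 2 * ENNReal.ofReal (ε / (1 + ε)) *
            (2 * (ENNReal.ofReal τ * (t₀ ^ ε * I))) := by gcongr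
      _ = t₀ ^ ε * I + 2 * ENNReal.ofReal (ε / (1 + ε)) * (2 * ENNReal.ofReal τ) *
            (t₀ ^ ε * I) := by ring
      _ ≤ t₀ ^ ε * I + 1 * (t₀ ^ ε * I) := by gcongr
      _ = _ := by ring
  have hlim := ae_tendsto_box_average (fun i => b i - a i) (fun i => sub_pos.2 (hab i)) hS hSf
  have hfatou : ∫⁻ x, S x ^ (1 + ε) ∂μ ≤
      ∫⁻ x, Filter.liminf (fun k => dyadMax S (roundRobin n k) a b x ^ ε * S x) Filter.atTop
        ∂μ := by
    refine lintegral_mono_ae ?_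
    rw [hμ]
    refine (ae_restrict_iff' (measurableSet_cell a b)).2 ?_
    filter_upwards [hlim] with x hx hxc
    -- After `k` full rounds the last rectangle is a copy of the original one scaled by `2^(-k)`.
    -- The eccentricity is therefore fixed, Lebesgue differentiation applies, and `dyadMax` is
    -- asymptotically at least `S x`; Fatou's lemma concludes.
    let η : ℕ → ℝ := fun k => (1 / 2) ^ k
    let a' : ℕ → Fin n → ℝ := fun k => (lastCell (roundRobin n k) a b x).1
    have hb' : ∀ k, (lastCell (roundRobin n k) a b x).2 = a' k + η k • fun i => b i - a i := by
      intro k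
      funext j
      have := lastCell_sub (roundRobin n k) a b x j
      rw [count_roundRobin] at this
      simp only [Pi.add_apply, Pi.smul_apply, smul_eq_mul, a', η]
      rw [one_div, inv_pow, inv_mul_eq_div]
      linarith
    have hmem := fun k => mem_lastCell (roundRobin n k) hab hxc
    have h1 := hx a' η (fun k => by positivity)
      (tendsto_pow_atTop_nhds_zero_of_lt_one (by norm_num) (by norm_num)) (fun k => by
        have := hmem k
        rw [hb'] at this
        exact ⟨fun i => (this i (mem_univ i)).1, fun i => (this i (mem_univ i)).2.le⟩)
    have h2 := ENNReal.Tendsto.mul_const (h1.ennrpow_const ε) (Or.inr (hSt x))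
    have h3 : S x ^ (1 + ε) = S x ^ ε * S x := by
      rw [add_comm, ENNReal.rpow_add_of_nonneg _ _ hε.le zero_le_one, ENNReal.rpow_one]
    rw [h3, ← h2.liminf_eq]
    refine Filter.liminf_le_liminf (Filter.Eventually.of_forall fun k => ?_)
    gcongr
    rw [← hb', ← hcellS, ← volume_cell]
    exact cellAvg_lastCell_le S (roundRobin n k) a b x
  calc ∫⁻ x in box a b, S x ^ (1 + ε) = ∫⁻ x, S x ^ (1 + ε) ∂μ :=
        (setLIntegral_congr (cell_ae_eq_box a b)).symm
    _ ≤ _ := hfatou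
    _ ≤ Filter.liminf (fun k => ∫⁻ x, dyadMax S (roundRobin n k) a b x ^ ε * S x ∂μ)
          Filter.atTop :=
        lintegral_liminf_le fun k => ((measurable_dyadMax _ _ _ _).pow_const _).mul hS
    _ ≤ _ := Filter.liminf_le_of_le (by isBoundedDefault) fun c hc => by
        obtain ⟨k, hk⟩ := hc.exists
        exact hk.trans (hmain _)

/-! ### Quantitative properties of Muckenhoupt weights -/

theorem dual_ne_zero {X : Type*} {W : X → ℝ≥0∞} (h0 : ∀ x, W x ≠ 0) (ht : ∀ x, W x ≠ ∞) (c : ℝ)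
    (x : X) : W x ^ c ≠ 0 := by
  simp [ENNReal.rpow_eq_zero_iff, h0 x, ht x]

theorem dual_ne_top {X : Type*} {W : X → ℝ≥0∞} (h0 : ∀ x, W x ≠ 0) (ht : ∀ x, W x ≠ ∞) (c : ℝ)
    (x : X) : W x ^ c ≠ ∞ := by
  simp [ENNReal.rpow_eq_top_iff, h0 x, ht x]

/-- Openness of the Muckenhoupt condition, in quantitative form. -/
theorem BoxMuckenhoupt.self_improve {n : ℕ} {p : ℝ} (hp : 1 < p) {κ : ℝ≥0∞}
    {W : (Fin n → ℝ) → ℝ≥0∞} (hW : BoxMuckenhoupt p κ W) {τ : ℝ} (hτ : 0 < τ)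
    (hFW : ∀ a b : Fin n → ℝ, (∀ i, a i < b i) →
      ∫⁻ x in box a b, strongMaximal ((box a b).indicator fun x => W x ^ (-1 / (p - 1))) x ≤
        ENNReal.ofReal τ * ∫⁻ x in box a b, W x ^ (-1 / (p - 1)))
    {ε : ℝ} (hε : 0 < ε) (hετ : ε ≤ 1 / (4 * τ)) :
    BoxMuckenhoupt (1 + (p - 1) / (1 + ε)) (ENNReal.ofReal (2 ^ p) * κ) W := by
  have hp1 : 0 < p - 1 := by linarith
  -- The new exponent is chosen so that its dual weight is the power `1 + ε` of the old one, which
  -- is what the reverse Hölder inequality controls.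
  have hexp : -1 / (1 + (p - 1) / (1 + ε) - 1) = -1 / (p - 1) * (1 + ε) := by
    rw [add_sub_cancel_left]; field_simp
  have hpow : ∀ x, W x ^ (-1 / (1 + (p - 1) / (1 + ε) - 1)) =
      (W x ^ (-1 / (p - 1))) ^ (1 + ε) := fun x => by rw [hexp, ENNReal.rpow_mul]
  have hRH := fun {a b : Fin n → ℝ} (hab : ∀ i, a i < b i) =>
    reverse_holder (S := fun x => W x ^ (-1 / (p - 1))) (hW.measurable.pow_const _)
    (dual_ne_top hW.ne_zero hW.ne_top _) hW.lintegral_dual_ne_top hτ hFW hε hετ hab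
  refine ⟨hW.measurable, hW.ne_zero, hW.ne_top, hW.lintegral_ne_top, fun a b => ?_,
    fun a b hab => ?_⟩
  · by_cases hab : ∀ i, a i < b i
    · simp_rw [hpow]
      refine ne_top_of_le_ne_top ?_ (hRH hab)
      refine ENNReal.mul_ne_top (ENNReal.mul_ne_top (by simp) ?_) (hW.lintegral_dual_ne_top a b)
      exact ENNReal.rpow_ne_top_of_nonneg hε.le
        (ENNReal.div_ne_top (hW.lintegral_dual_ne_top a b) (volume_box_ne_zero hab))
    · have : box a b = ∅ := by
        push Not at hab
        obtain ⟨i, hi⟩ := hab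
        exact univ_pi_eq_empty (i := i) (Ioo_eq_empty hi.not_gt)
      simp [this]
  · simp_rw [hpow]
    rw [add_sub_cancel_left]
    set v := volume (box a b) with hv
    have hv0 : v ≠ 0 := volume_box_ne_zero hab
    have hvt : v ≠ ∞ := volume_box_ne_top _ _
    set I := ∫⁻ x in box a b, W x ^ (-1 / (p - 1)) with hI
    set w := ∫⁻ x in box a b, W x with hw
    have hθ : 0 ≤ (p - 1) / (1 + ε) := by positivity
    have hI1 : (I / v) ^ ε * I = I ^ (1 + ε) * v ^ (-ε) := by
      rw [ENNReal.div_rpow_of_nonneg _ _ hε.le, add_comm 1 ε,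
        ENNReal.rpow_add_of_nonneg _ _ hε.le zero_le_one, ENNReal.rpow_one, ENNReal.rpow_neg,
        div_eq_mul_inv]
      ring
    calc w * (∫⁻ x in box a b, (W x ^ (-1 / (p - 1))) ^ (1 + ε)) ^ ((p - 1) / (1 + ε))
        ≤ w * (2 * (I / v) ^ ε * I) ^ ((p - 1) / (1 + ε)) := by
          gcongr
          exact hRH hab
      _ = 2 ^ ((p - 1) / (1 + ε)) * (w * I ^ (p - 1)) * v ^ (-ε * ((p - 1) / (1 + ε))) := by
          rw [mul_assoc 2, hI1, ENNReal.mul_rpow_of_nonneg _ _ hθ,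
            ENNReal.mul_rpow_of_nonneg _ _ hθ, ← ENNReal.rpow_mul, ← ENNReal.rpow_mul,
            mul_div_cancel₀ _ (by positivity)]
          ring
      _ ≤ 2 ^ p * (κ * v ^ p) * v ^ (-ε * ((p - 1) / (1 + ε))) := by
          refine mul_le_mul' (mul_le_mul' ?_ (hW.le a b hab)) le_rfl
          refine ENNReal.rpow_le_rpow_of_exponent_le (by norm_num) ?_
          rw [div_le_iff₀ (by linarith)]
          nlinarith
      _ = ENNReal.ofReal (2 ^ p) * κ * v ^ (1 + (p - 1) / (1 + ε)) := by
          rw [← ENNReal.ofReal_rpow_of_nonneg (by norm_num) (by linarith)]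
          have : v ^ (1 + (p - 1) / (1 + ε)) = v ^ p * v ^ (-ε * ((p - 1) / (1 + ε))) := by
            rw [← ENNReal.rpow_add _ _ hv0 hvt]
            congr 1
            field_simp
            ring
          rw [this]
          simp only [ENNReal.ofReal_ofNat]
          ring

theorem boxMuckenhoupt_one (n : ℕ) (r : ℝ) :
    BoxMuckenhoupt r 1 (fun _ : Fin n → ℝ => 1) := by
  refine ⟨measurable_const, by simp, by simp, fun a b => ?_, fun a b => ?_, fun a b hab => ?_⟩
  · simpa using volume_box_ne_top a b
  · simpa using volume_box_ne_top a b
  · simp only [ENNReal.one_rpow, lintegral_const, one_mul, Measure.restrict_apply_univ]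
    refine le_of_eq ?_
    nth_rewrite 1 [← ENNReal.rpow_one (volume (box a b))]
    rw [← ENNReal.rpow_add _ _ (volume_box_ne_zero hab) (volume_box_ne_top _ _), add_sub_cancel]

/-- The unweighted `L²` bound for the iterated maximal function. -/
theorem lintegral_iterMax_sq_le {n : ℕ} {f : (Fin n → ℝ) → ℝ≥0∞} (hf : Measurable f) :
    ∫⁻ x, iterMax (List.finRange n) f x ^ (2 : ℝ) ≤ 32 ^ n * ∫⁻ x, f x ^ (2 : ℝ) := by
  -- Interpolating from `3/2` to `2` with `K = 1` costs `2^2 * (2/(1/2)) * 2 = 32` per direction.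
  have h := (boxMuckenhoupt_one n (3 / 2)).lintegral_iterMax_rpow_le (r := 2)
    (by norm_num) (by norm_num) (List.finRange n) hf
  simp only [mul_one, List.length_finRange] at h
  refine h.trans (le_of_eq ?_)
  congr 2
  rw [show (2 : ℝ≥0∞) = ENNReal.ofReal 2 by simp, ← ENNReal.ofReal_mul (by positivity)]
  norm_num

theorem box_inter {n : ℕ} (a b a' b' : Fin n → ℝ) :
    box a b ∩ box a' b' = box (a ⊔ a') (b ⊓ b') := by
  rw [box, box, ← pi_inter_distrib]
  simp only [Ioo_inter_Ioo]
  rfl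

/-- Hölder's inequality with exponent `1 + 2(p-1)` bounds the average of `W` from below by a power
of the average of the square root of the dual weight. Dividing the A_p condition by it leaves a
reverse Hölder inequality between the exponents 1 and 1/2. -/
theorem BoxMuckenhoupt.average_dual_le {n : ℕ} {p : ℝ} (hp : 1 < p) {κ : ℝ≥0∞}
    {W : (Fin n → ℝ) → ℝ≥0∞} (hW : BoxMuckenhoupt p κ W) {a b : Fin n → ℝ}
    (hab : ∀ i, a i < b i) :
    (∫⁻ x in box a b, W x ^ (-1 / (p - 1))) / volume (box a b) ≤ κ ^ (1 / (p - 1)) *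
      ((∫⁻ x in box a b, (W x ^ (-1 / (p - 1))) ^ (1 / 2 : ℝ)) / volume (box a b)) ^ (2 : ℝ) := by
  have hp1 : 0 < p - 1 := by linarith
  have hH := rpow_lintegral_le_of_weight (μ := volume.restrict (box a b)) (r := 1 + 2 * (p - 1))
    (by linarith) hW.measurable measurable_one hW.ne_zero hW.ne_top
  have hA := hW.le a b hab
  have hroot : ∀ x, (W x ^ (-1 / (p - 1))) ^ (1 / 2 : ℝ) =
      W x ^ (-1 / (1 + 2 * (p - 1) - 1)) := fun x => by
    rw [← ENNReal.rpow_mul]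
    congr 1
    rw [add_sub_cancel_left]
    field_simp
  simp_rw [hroot]
  simp only [Pi.one_apply, lintegral_one, Measure.restrict_apply_univ, ENNReal.one_rpow,
    one_mul] at hH
  set v := volume (box a b) with hv
  have hv0 : v ≠ 0 := volume_box_ne_zero hab
  have hvt : v ≠ ∞ := volume_box_ne_top _ _
  set I := ∫⁻ x in box a b, W x ^ (-1 / (p - 1)) with hI
  set w := ∫⁻ x in box a b, W x with hw
  set H := ∫⁻ x in box a b, W x ^ (-1 / (1 + 2 * (p - 1) - 1)) with hHdef
  rw [add_sub_cancel_left] at hH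
  have h1 : v ^ p * (v * I) ^ (p - 1) ≤ v ^ p * (κ * H ^ (2 * (p - 1))) := by
    calc v ^ p * (v * I) ^ (p - 1) = v ^ (1 + 2 * (p - 1)) * I ^ (p - 1) := by
          rw [ENNReal.mul_rpow_of_nonneg _ _ hp1.le, ← mul_assoc, ← ENNReal.rpow_add _ _ hv0 hvt]
          congr 2
          ring
      _ ≤ (w * H ^ (2 * (p - 1))) * I ^ (p - 1) := by gcongr
      _ = (w * I ^ (p - 1)) * H ^ (2 * (p - 1)) := by ring
      _ ≤ (κ * v ^ p) * H ^ (2 * (p - 1)) := by gcongr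
      _ = _ := by ring
  have h2 : (v * I) ^ (p - 1) ≤ κ * H ^ (2 * (p - 1)) :=
    (ENNReal.mul_le_mul_iff_right (by simp [ENNReal.rpow_eq_zero_iff, hv0, hvt])
      (ENNReal.rpow_ne_top_of_nonneg (by linarith) hvt)).1 h1
  have h3 : v * I ≤ κ ^ (1 / (p - 1)) * H ^ (2 : ℝ) := by
    have := ENNReal.rpow_le_rpow h2 (show 0 ≤ 1 / (p - 1) by positivity)
    rwa [← ENNReal.rpow_mul, mul_one_div_cancel hp1.ne', ENNReal.rpow_one,
      ENNReal.mul_rpow_of_nonneg _ _ (by positivity), ← ENNReal.rpow_mul, mul_assoc,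
      mul_one_div_cancel hp1.ne', mul_one] at this
  rw [ENNReal.div_rpow_of_nonneg _ _ (by norm_num), ENNReal.div_le_iff_le_mul (Or.inl hv0)
    (Or.inl hvt)]
  have hv2 : v ^ (2 : ℝ) = v * v := by
    rw [show (2 : ℝ) = 1 + 1 by norm_num, ENNReal.rpow_add _ _ hv0 hvt, ENNReal.rpow_one]
  calc I = v * I / v := by rw [mul_comm, ENNReal.mul_div_cancel_right hv0 hvt]
    _ ≤ κ ^ (1 / (p - 1)) * H ^ (2 : ℝ) / v := by gcongr
    _ = κ ^ (1 / (p - 1)) * (H ^ (2 : ℝ) / v ^ (2 : ℝ)) * v := by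
        rw [hv2, div_eq_mul_inv _ v, div_eq_mul_inv _ (v * v),
          ENNReal.mul_inv (Or.inl hv0) (Or.inl hvt)]
        calc _ = κ ^ (1 / (p - 1)) * (H ^ (2 : ℝ) * v⁻¹) * (v⁻¹ * v) := by
              rw [ENNReal.inv_mul_cancel hv0 hvt]; ring
          _ = _ := by ring

/-- The Fujii-Wilson constant of the dual weight is controlled by the `A_p` constant. -/
theorem BoxMuckenhoupt.fujiiWilson_dual_le {n : ℕ} {p : ℝ} (hp : 1 < p) {κ : ℝ≥0∞}
    {W : (Fin n → ℝ) → ℝ≥0∞} (hW : BoxMuckenhoupt p κ W) (a b : Fin n → ℝ) :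
    ∫⁻ x in box a b, strongMaximal ((box a b).indicator fun x => W x ^ (-1 / (p - 1))) x ≤
      κ ^ (1 / (p - 1)) * 32 ^ n * ∫⁻ x in box a b, W x ^ (-1 / (p - 1)) := by
  set S := fun x => W x ^ (-1 / (p - 1)) with hS
  have hSm : Measurable S := hW.measurable.pow_const _
  set H := (box a b).indicator fun x => S x ^ (1 / 2 : ℝ) with hH
  have hHm : Measurable H := (hSm.pow_const _).indicator (measurableSet_box _ _)
  -- The intersection of two rectangles is a rectangle, so the averages of `S` cut off to the box
  -- are at most averages over subrectangles, where `average_dual_le` applies. The squared maximal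
  -- function is then integrated by the unweighted `L²` bound.
  have hpt : ∀ x ∈ box a b, strongMaximal ((box a b).indicator S) x ≤
      κ ^ (1 / (p - 1)) * strongMaximal H x ^ (2 : ℝ) := by
    intro x hx
    refine iSup₂_le ?_
    rintro R ⟨⟨a', b', hab', rfl⟩, hx'⟩
    have hxi : x ∈ box a' b' ∩ box a b := ⟨hx', hx⟩
    rw [setLAverage_eq]
    have h1 : ∫⁻ y in box a' b', ‖(box a b).indicator S y‖ₑ =
        ∫⁻ y in box (a ⊔ a') (b ⊓ b'), S y := by
      simp only [enorm_eq_self]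
      rw [setLIntegral_indicator (measurableSet_box _ _), box_inter]
    rw [box_inter, sup_comm, inf_comm] at hxi
    have hlt : ∀ i, (a ⊔ a') i < (b ⊓ b') i := fun i =>
      (hxi i (mem_univ i)).1.trans (hxi i (mem_univ i)).2
    have hsub : box (a ⊔ a') (b ⊓ b') ⊆ box a' b' := by rw [← box_inter]; exact inter_subset_right
    have hsub' : box (a ⊔ a') (b ⊓ b') ⊆ box a b := by rw [← box_inter]; exact inter_subset_left
    rw [h1]
    calc (∫⁻ y in box (a ⊔ a') (b ⊓ b'), S y) / volume (box a' b')
        ≤ (∫⁻ y in box (a ⊔ a') (b ⊓ b'), S y) / volume (box (a ⊔ a') (b ⊓ b')) := by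
          gcongr
      _ ≤ _ := hW.average_dual_le hp hlt
      _ ≤ κ ^ (1 / (p - 1)) * strongMaximal H x ^ (2 : ℝ) := by
          gcongr
          refine le_iSup₂_of_le (box (a ⊔ a') (b ⊓ b')) ⟨⟨_, _, hlt, rfl⟩, hxi⟩ ?_
          rw [setLAverage_eq]
          refine ENNReal.div_le_div_right ?_ _
          refine (setLIntegral_congr_fun (measurableSet_box _ _) fun y hy => ?_).le
          simp only [enorm_eq_self]
          exact (indicator_of_mem (hsub' hy) fun x => S x ^ (1 / 2 : ℝ)).symm
  calc ∫⁻ x in box a b, strongMaximal ((box a b).indicator S) x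
      ≤ ∫⁻ x in box a b, κ ^ (1 / (p - 1)) * iterMax (List.finRange n) H x ^ (2 : ℝ) := by
        refine setLIntegral_mono' (measurableSet_box _ _) fun x hx => (hpt x hx).trans ?_
        gcongr
        exact strongMaximal_le_iterMax hHm x
    _ ≤ ∫⁻ x, κ ^ (1 / (p - 1)) * iterMax (List.finRange n) H x ^ (2 : ℝ) :=
        setLIntegral_le_lintegral _ _
    _ = κ ^ (1 / (p - 1)) * ∫⁻ x, iterMax (List.finRange n) H x ^ (2 : ℝ) :=
        lintegral_const_mul _ ((measurable_iterMax _ hHm).pow_const _)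
    _ ≤ κ ^ (1 / (p - 1)) * (32 ^ n * ∫⁻ x, H x ^ (2 : ℝ)) := by
        gcongr
        exact lintegral_iterMax_sq_le hHm
    _ = _ := by
        have : ∫⁻ x, H x ^ (2 : ℝ) = ∫⁻ x in box a b, S x := by
          rw [← lintegral_indicator (measurableSet_box _ _)]
          refine lintegral_congr fun x => ?_
          by_cases hx : x ∈ box a b
          · rw [hH, indicator_of_mem hx, indicator_of_mem hx, ← ENNReal.rpow_mul]
            norm_num
          · rw [hH, indicator_of_notMem hx, indicator_of_notMem hx]
            simp
        rw [this, mul_assoc]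

/-- The rectangle itself is admissible in the supremum. This gives `τ ≥ 1`. -/
theorem setLIntegral_le_setLIntegral_strongMaximal {n : ℕ} (S : (Fin n → ℝ) → ℝ≥0∞)
    {a b : Fin n → ℝ} (hab : ∀ i, a i < b i) :
    ∫⁻ x in box a b, S x ≤ ∫⁻ x in box a b, strongMaximal ((box a b).indicator S) x := by
  set v := volume (box a b) with hv
  have hv0 : v ≠ 0 := volume_box_ne_zero hab
  have hvt : v ≠ ∞ := volume_box_ne_top _ _
  calc ∫⁻ x in box a b, S x = ∫⁻ _ in box a b, (∫⁻ x in box a b, S x) / v := by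
        rw [setLIntegral_const, ← hv, ENNReal.div_mul_cancel hv0 hvt]
    _ ≤ _ := by
        refine setLIntegral_mono' (measurableSet_box _ _) fun x hx => ?_
        refine le_iSup₂_of_le (box a b) ⟨⟨_, _, hab, rfl⟩, hx⟩ ?_
        rw [setLAverage_eq]
        refine ENNReal.div_le_div_right ?_ _
        refine (setLIntegral_congr_fun (measurableSet_box _ _) fun y hy => ?_).le
        simp only [enorm_eq_self]
        exact (indicator_of_mem hy _).symm

/-! ### From weak type inequalities to Lorentz norms -/

theorem tsum_rpow_le_of_le_one (x : ℕ → ℝ≥0∞) {e : ℝ} (he : 0 < e) (he1 : e ≤ 1) :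
    (∑' k, x k) ^ e ≤ ∑' k, x k ^ e := by
  have hfin : ∀ s : Finset ℕ, (∑ k ∈ s, x k) ^ e ≤ ∑ k ∈ s, x k ^ e := by
    intro s
    induction s using Finset.induction_on with
    | empty => simp [he]
    | insert i s hi ih =>
      rw [Finset.sum_insert hi, Finset.sum_insert hi]
      exact (ENNReal.rpow_add_le_add_rpow _ _ he.le he1).trans (by gcongr)
  refine le_of_tendsto (ENNReal.summable.hasSum.ennrpow_const e)
    (Filter.Eventually.of_forall fun s => (hfin s).trans (ENNReal.sum_le_tsum s))

/-- Jensen's inequality for the weights `a`, obtained from the weighted Hölder inequality for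
counting measure with `u = a^(-(e-1))`. -/
theorem tsum_mul_rpow_le_of_one_le (a x : ℕ → ℝ≥0∞) (ha0 : ∀ k, a k ≠ 0) (hat : ∀ k, a k ≠ ∞)
    {e : ℝ} (he : 1 ≤ e) :
    (∑' k, a k * x k) ^ e ≤ (∑' k, a k) ^ (e - 1) * ∑' k, a k * x k ^ e := by
  rcases he.eq_or_lt with rfl | he
  · simp
  have h := rpow_lintegral_le_of_weight (μ := (Measure.count : Measure ℕ)) he
    (u := fun k => a k ^ (-(e - 1))) (g := fun k => a k * x k) (measurable_of_countable _)
    (measurable_of_countable _) (fun k => dual_ne_zero ha0 hat _ k)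
    (fun k => dual_ne_top ha0 hat _ k)
  have h1 : ∀ k, (a k * x k) ^ e * a k ^ (-(e - 1)) = a k * x k ^ e := by
    intro k
    rw [ENNReal.mul_rpow_of_nonneg _ _ (by linarith), mul_right_comm,
      ← ENNReal.rpow_add _ _ (ha0 k) (hat k)]
    congr 1
    rw [show e + -(e - 1) = 1 by ring, ENNReal.rpow_one]
  have h2 : ∀ k, (a k ^ (-(e - 1))) ^ (-1 / (e - 1)) = a k := by
    intro k
    have : e - 1 ≠ 0 := by linarith
    rw [← ENNReal.rpow_mul, show -(e - 1) * (-1 / (e - 1)) = 1 by field_simp, ENNReal.rpow_one]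
  simp only [h1, h2, lintegral_count] at h
  rwa [mul_comm]

/-- The sum is `4^x / (4^x - 1)`, and `4^x ≥ 1 + x` because `log 4 ≥ 1`. The factor `1/x` is what
later becomes `p' τ`. -/
theorem tsum_geometric_le {x : ℝ} (hx : 0 < x) :
    ∑' k : ℕ, ENNReal.ofReal ((4 : ℝ) ^ (-x)) ^ k ≤ ENNReal.ofReal (4 ^ x / x) := by
  have h4 : (1 : ℝ) + x ≤ 4 ^ x := by
    have h1 : x ≤ Real.log 4 * x := by
      have : (1 : ℝ) ≤ Real.log 4 := by
        rw [Real.le_log_iff_exp_le (by norm_num)]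
        exact Real.exp_one_lt_d9.le.trans (by norm_num)
      nlinarith
    rw [Real.rpow_def_of_pos (by norm_num)]
    linarith [Real.add_one_le_exp (Real.log 4 * x)]
  have h4p : (0 : ℝ) < 4 ^ x := by positivity
  rw [ENNReal.tsum_geometric, ← ENNReal.ofReal_one, ← ENNReal.ofReal_sub _ (by positivity),
    ← ENNReal.ofReal_inv_of_pos]
  · apply ENNReal.ofReal_le_ofReal
    rw [Real.rpow_neg (by norm_num), inv_le_comm₀, inv_div]
    · rw [div_le_iff₀ h4p, sub_mul, inv_mul_cancel₀ h4p.ne']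
      linarith
    · rw [sub_pos]
      exact inv_lt_one_of_one_lt₀ (by linarith)
    · positivity
  · rw [sub_pos, Real.rpow_neg (by norm_num)]
    exact inv_lt_one_of_one_lt₀ (by linarith)

/-- Decomposition of truncated moments along the dyadic level sets. -/
theorem setLIntegral_rpow_le_tsum {X : Type*} [MeasurableSpace X] (μ : Measure X)
    {f : X → ℝ≥0∞} (hf : Measurable f) (hft : ∀ x, f x ≠ ∞) {r t : ℝ} (hr : 0 < r) (ht : 0 < t) :
    ∫⁻ x in {x | ENNReal.ofReal t < f x}, f x ^ r ∂μ ≤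
      ∑' k : ℕ, ENNReal.ofReal (4 ^ (k + 1) * t) ^ r *
        μ {x | ENNReal.ofReal (4 ^ k * t) < f x} := by
  have hm : ∀ s : ℝ≥0∞, MeasurableSet {x | s < f x} := fun s =>
    measurableSet_lt measurable_const hf
  have h1 : ∀ k : ℕ, ENNReal.ofReal (4 ^ (k + 1) * t) ^ r *
      μ {x | ENNReal.ofReal (4 ^ k * t) < f x} =
      ∫⁻ x, {x | ENNReal.ofReal (4 ^ k * t) < f x}.indicator
        (fun _ => ENNReal.ofReal (4 ^ (k + 1) * t) ^ r) x ∂μ := fun k => by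
    rw [lintegral_indicator (hm _), setLIntegral_const]
  simp_rw [h1]
  rw [← lintegral_tsum fun k => (measurable_const.indicator (hm _)).aemeasurable,
    ← lintegral_indicator (hm _)]
  refine lintegral_mono fun x => ?_
  by_cases hx : x ∈ {x | ENNReal.ofReal t < f x}
  swap
  · rw [indicator_of_notMem hx]; exact zero_le
  rw [indicator_of_mem hx]
  -- The least such `k` also satisfies `4^k t < f x`: by minimality if `k > 0`, by the truncation if
  -- `k = 0`. A single term of the sum then dominates `f x ^ r`.
  have hex : ∃ k : ℕ, f x ≤ ENNReal.ofReal (4 ^ (k + 1) * t) := by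
    obtain ⟨k, hk⟩ := pow_unbounded_of_one_lt ((f x).toReal / t) (by norm_num : (1 : ℝ) < 4)
    refine ⟨k, ?_⟩
    rw [← ENNReal.ofReal_toReal (hft x)]
    apply ENNReal.ofReal_le_ofReal
    rw [div_lt_iff₀ ht] at hk
    have : (4 : ℝ) ^ k * t ≤ 4 ^ (k + 1) * t := by
      gcongr
      · norm_num
      · omega
    linarith
  classical
  have hle := Nat.find_spec hex
  have hlt : ENNReal.ofReal (4 ^ (Nat.find hex) * t) < f x := by
    rcases Nat.eq_zero_or_pos (Nat.find hex) with h0 | h0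
    · rw [h0, pow_zero, one_mul]; exact hx
    · have := Nat.find_min hex (Nat.sub_lt h0 one_pos)
      rw [show Nat.find hex - 1 + 1 = Nat.find hex by omega] at this
      exact not_le.1 this
  refine le_trans ?_ (ENNReal.le_tsum (Nat.find hex))
  rw [indicator_of_mem (by exact hlt)]
  gcongr

/-- The maximal distribution function is controlled by a weighted sum of dilates. -/
theorem ofReal_rpow_mul_distribution_le {X : Type*} [MeasurableSpace X] {μ : Measure X}
    {f : X → ℝ≥0∞} (hf : Measurable f) (hft : ∀ x, f x ≠ ∞) {ν : ℝ → ℝ≥0∞} {p r : ℝ} (hr : 0 < r)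
    (hrp : r < p) {A : ℝ≥0∞} {s : ℝ} (hs : 0 < s)
    (hν : ν s ≤ A * ENNReal.ofReal ((s / 2) ^ (-r)) *
      ∫⁻ x in {x | ENNReal.ofReal (s / 2) < f x}, f x ^ r ∂μ) :
    ENNReal.ofReal s ^ p * ν s ≤ A * ENNReal.ofReal (8 ^ p) *
      ∑' k : ℕ, ENNReal.ofReal (4 ^ (-(p - r))) ^ k *
        (ENNReal.ofReal (4 ^ k / 2 * s) ^ p * μ {x | ENNReal.ofReal (4 ^ k / 2 * s) < f x}) := by
  have hp : 0 < p := hr.trans hrp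
  calc ENNReal.ofReal s ^ p * ν s
      ≤ ENNReal.ofReal s ^ p * (A * ENNReal.ofReal ((s / 2) ^ (-r)) *
          ∑' k : ℕ, ENNReal.ofReal (4 ^ (k + 1) * (s / 2)) ^ r *
            μ {x | ENNReal.ofReal (4 ^ k * (s / 2)) < f x}) := by
        gcongr
        exact hν.trans (by gcongr; exact setLIntegral_rpow_le_tsum μ hf hft hr (by positivity))
    _ = A * ∑' k : ℕ, (ENNReal.ofReal s ^ p * ENNReal.ofReal ((s / 2) ^ (-r)) *
          ENNReal.ofReal (4 ^ (k + 1) * (s / 2)) ^ r) *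
            μ {x | ENNReal.ofReal (4 ^ k * (s / 2)) < f x} := by
        simp_rw [mul_assoc]
        rw [ENNReal.tsum_mul_left, ENNReal.tsum_mul_left]
        ring
    _ ≤ A * ∑' k : ℕ, (ENNReal.ofReal (8 ^ p) * (ENNReal.ofReal (4 ^ (-(p - r))) ^ k *
          ENNReal.ofReal (4 ^ k / 2 * s) ^ p)) *
            μ {x | ENNReal.ofReal (4 ^ k * (s / 2)) < f x} := by
        -- The powers of `s/2` cancel, leaving `s^p 4^((k+1)r)`. Here `4^(kr) = 4^(-(p-r)k) 4^(kp)`,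
        -- while `4^r ≤ 4^p` and `s^p = 2^p (s/2)^p` together produce the factor `8^p`.
        refine mul_le_mul' le_rfl (ENNReal.tsum_le_tsum fun k => mul_le_mul' ?_ le_rfl)
        rw [ENNReal.ofReal_rpow_of_nonneg hs.le hp.le,
          ENNReal.ofReal_rpow_of_nonneg (by positivity) hr.le,
          ENNReal.ofReal_rpow_of_nonneg (by positivity) hp.le,
          ← ENNReal.ofReal_pow (by positivity), ← ENNReal.ofReal_mul (by positivity),
          ← ENNReal.ofReal_mul (by positivity), ← ENNReal.ofReal_mul (by positivity),
          ← ENNReal.ofReal_mul (by positivity)]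
        apply ENNReal.ofReal_le_ofReal
        have e1 : (4 ^ (k + 1) * (s / 2)) ^ r = ((4 : ℝ) ^ k) ^ r * 4 ^ r * (s / 2) ^ r := by
          rw [pow_succ, Real.mul_rpow (by positivity) (by positivity),
            Real.mul_rpow (by positivity) (by norm_num)]
        have e2 : (s / 2) ^ (-r) * (s / 2) ^ r = 1 := by
          rw [← Real.rpow_add (by positivity)]; simp
        have e3 : ((4 : ℝ) ^ (-(p - r))) ^ k * (4 ^ k / 2 * s) ^ p =
            ((4 : ℝ) ^ k) ^ r * (s ^ p / 2 ^ p) := by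
          rw [div_mul_eq_mul_div, mul_div_assoc, Real.mul_rpow (by positivity) (by positivity),
            Real.div_rpow hs.le (by norm_num), ← Real.rpow_natCast (4 ^ (-(p - r))),
            ← Real.rpow_natCast 4, ← Real.rpow_mul (by norm_num), ← Real.rpow_mul (by norm_num),
            ← Real.rpow_mul (by norm_num), ← mul_assoc, ← Real.rpow_add (by norm_num)]
          congr 2
          ring
        have e4 : (8 : ℝ) ^ p / 2 ^ p = 4 ^ p := by
          rw [← Real.div_rpow (by norm_num) (by norm_num)]; norm_num
        have e5 : (4 : ℝ) ^ r ≤ 4 ^ p := Real.rpow_le_rpow_of_exponent_le (by norm_num) hrp.le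
        calc s ^ p * (s / 2) ^ (-r) * (4 ^ (k + 1) * (s / 2)) ^ r
            = s ^ p * (((4 : ℝ) ^ k) ^ r * 4 ^ r) * ((s / 2) ^ (-r) * (s / 2) ^ r) := by
              rw [e1]; ring
          _ = ((4 : ℝ) ^ k) ^ r * s ^ p * 4 ^ r := by rw [e2]; ring
          _ ≤ ((4 : ℝ) ^ k) ^ r * s ^ p * 4 ^ p := by gcongr
          _ = _ := by rw [e3, ← e4]; ring
    _ = _ := by
        rw [mul_assoc A, ← ENNReal.tsum_mul_left (a := ENNReal.ofReal (8 ^ p))]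
        congr 2
        funext k
        rw [show (4 : ℝ) ^ k * (s / 2) = 4 ^ k / 2 * s by ring]
        ring

/-- Dilation invariance of the measure `ds / s` on the half line. -/
theorem lintegral_comp_mul_div (G : ℝ → ℝ≥0∞) {β : ℝ} (hβ : 0 < β) :
    ∫⁻ s in Ioi (0 : ℝ), G (β * s) / ENNReal.ofReal s =
      ∫⁻ s in Ioi (0 : ℝ), G s / ENNReal.ofReal s := by
  have h := lintegral_image_eq_lintegral_abs_deriv_mul (s := Ioi (0 : ℝ)) (f := fun s => β * s)
    (f' := fun _ => β) measurableSet_Ioi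
    (fun x _ => by simpa using ((hasDerivAt_id x).const_mul β).hasDerivWithinAt)
    (fun x _ y _ hxy => mul_left_cancel₀ hβ.ne' hxy) (fun s => G s / ENNReal.ofReal s)
  have himg : (fun s => β * s) '' Ioi (0 : ℝ) = Ioi 0 := by
    ext y
    constructor
    · rintro ⟨x, hx, rfl⟩
      exact mul_pos hβ hx
    · intro hy
      exact ⟨y / β, div_pos hy hβ, mul_div_cancel₀ y hβ.ne'⟩
  rw [himg] at h
  rw [h]
  refine setLIntegral_congr_fun measurableSet_Ioi fun s (hs : 0 < s) => ?_
  have hβ0 : ENNReal.ofReal β ≠ 0 := by simpa using hβ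
  rw [abs_of_pos hβ, ENNReal.ofReal_mul hβ.le, div_eq_mul_inv, div_eq_mul_inv,
    ENNReal.mul_inv (Or.inl hβ0) (Or.inl ENNReal.ofReal_ne_top), mul_left_comm,
    ← mul_assoc _ _ (ENNReal.ofReal s)⁻¹,
    ENNReal.mul_inv_cancel hβ0 ENNReal.ofReal_ne_top, one_mul]

/-- By dilation invariance of `ds/s` all terms of the sum have the same integral, so only the sum of
the weights remains. The hypothesis `hw` covers both regimes: Jensen for `e ≥ 1`, and subadditivity
with `G = 1` for `e ≤ 1`. -/
theorem lintegral_rpow_tsum_dilates_le {c D : ℝ → ℝ≥0∞} (hc : Measurable c) {x : ℝ}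
    {B : ℝ≥0∞} (hD : ∀ s : ℝ, 0 < s → D s ≤ B * ∑' k : ℕ, ENNReal.ofReal (4 ^ (-x)) ^ k *
      c (4 ^ k / 2 * s)) {e : ℝ} (he : 0 < e) (w : ℕ → ℝ≥0∞) (G : ℝ≥0∞)
    (hw : ∀ y : ℕ → ℝ≥0∞, (∑' k : ℕ, ENNReal.ofReal (4 ^ (-x)) ^ k * y k) ^ e ≤
      G * ∑' k, w k * y k ^ e) :
    ∫⁻ s in Ioi (0 : ℝ), D s ^ e / ENNReal.ofReal s ≤
      B ^ e * (G * ∑' k, w k) * ∫⁻ s in Ioi (0 : ℝ), c s ^ e / ENNReal.ofReal s := by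
  have hm : ∀ k : ℕ, Measurable fun s : ℝ => c (4 ^ k / 2 * s) ^ e / ENNReal.ofReal s := by
    intro k
    have : Measurable fun s : ℝ => c (4 ^ k / 2 * s) := hc.comp (by fun_prop)
    exact (this.pow_const e).div (by fun_prop)
  calc ∫⁻ s in Ioi (0 : ℝ), D s ^ e / ENNReal.ofReal s
      ≤ ∫⁻ s in Ioi (0 : ℝ), B ^ e * (G * ∑' k : ℕ, w k *
          (c (4 ^ k / 2 * s) ^ e / ENNReal.ofReal s)) := by
        refine setLIntegral_mono' measurableSet_Ioi fun s (hs : 0 < s) => ?_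
        calc D s ^ e / ENNReal.ofReal s
            ≤ (B ^ e * (G * ∑' k, w k * c (4 ^ k / 2 * s) ^ e)) / ENNReal.ofReal s := by
              refine ENNReal.div_le_div_right ?_ _
              refine (ENNReal.rpow_le_rpow (hD s hs) he.le).trans ?_
              rw [ENNReal.mul_rpow_of_nonneg _ _ he.le]
              gcongr
              exact hw _
          _ = _ := by
              simp only [div_eq_mul_inv, ← mul_assoc, ENNReal.tsum_mul_right]
    _ = B ^ e * (G * ∑' k : ℕ, w k *
          ∫⁻ s in Ioi (0 : ℝ), c (4 ^ k / 2 * s) ^ e / ENNReal.ofReal s) := by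
        have hms : Measurable fun s : ℝ => ∑' k : ℕ, w k *
            (c (4 ^ k / 2 * s) ^ e / ENNReal.ofReal s) :=
          Measurable.tsum fun k => (hm k).const_mul _
        rw [lintegral_const_mul _ (hms.const_mul _), lintegral_const_mul _ hms,
          lintegral_tsum fun k => ((hm k).const_mul _).aemeasurable]
        simp_rw [lintegral_const_mul _ (hm _)]
    _ = _ := by
        have h : ∀ k : ℕ, ∫⁻ s in Ioi (0 : ℝ), c (4 ^ k / 2 * s) ^ e / ENNReal.ofReal s =
            ∫⁻ s in Ioi (0 : ℝ), c s ^ e / ENNReal.ofReal s := fun k =>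
          lintegral_comp_mul_div (fun s => c s ^ e) (by positivity)
        simp_rw [h]
        rw [ENNReal.tsum_mul_right]
        ring

/-- The integrand of the Lorentz norm is the power `q/p ≥ 1` of `s^p w{|f| > s}`. Jensen's
inequality preserves the geometric series, whose sum therefore enters to the power `1/p`; for `q =
∞` each term is bounded by the supremum. -/
theorem lorentzNorm_le_of_le_exponent {n : ℕ} {E : Type*} [ENorm E] {p x : ℝ} (hp : 1 < p)
    (hx : 0 < x) {q : ℝ≥0∞} (hpq : ENNReal.ofReal p ≤ q) {w : (Fin n → ℝ) → ℝ}
    {F : (Fin n → ℝ) → E} {f : (Fin n → ℝ) → ℝ≥0∞} {B : ℝ≥0∞}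
    (h : ∀ s : ℝ, 0 < s → ENNReal.ofReal s ^ p * weightMeasure w {y | ENNReal.ofReal s < ‖F y‖ₑ} ≤
      B * ∑' k : ℕ, ENNReal.ofReal (4 ^ (-x)) ^ k * (ENNReal.ofReal (4 ^ k / 2 * s) ^ p *
        weightMeasure w {y | ENNReal.ofReal (4 ^ k / 2 * s) < f y})) :
    lorentzNorm p q w F ≤ (B * ENNReal.ofReal (4 ^ x / x)) ^ (1 / p) * lorentzNorm p q w f := by
  have hp0 : 0 < p := by linarith
  have hgeo := tsum_geometric_le hx
  unfold lorentzNorm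
  by_cases hq : q = ∞
  · rw [if_pos hq, if_pos hq]
    refine iSup₂_le fun s (hs : 0 < s) => ?_
    set N := ⨆ s ∈ Set.Ioi (0 : ℝ),
      ENNReal.ofReal s * weightMeasure w {y | ENNReal.ofReal s < ‖f y‖ₑ} ^ (1 / p) with hN
    have hroot : ∀ (t : ℝ) (y : ℝ≥0∞), (ENNReal.ofReal t * y ^ (1 / p)) ^ p =
        ENNReal.ofReal t ^ p * y := fun t y => by
      rw [ENNReal.mul_rpow_of_nonneg _ _ hp0.le, ← ENNReal.rpow_mul, one_div_mul_cancel hp0.ne',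
        ENNReal.rpow_one]
    have hk : ∀ k : ℕ, ENNReal.ofReal (4 ^ k / 2 * s) ^ p *
        weightMeasure w {y | ENNReal.ofReal (4 ^ k / 2 * s) < f y} ≤ N ^ p := fun k => by
      rw [← hroot]
      gcongr
      exact le_iSup₂_of_le (4 ^ k / 2 * s) (by simp only [mem_Ioi]; positivity) le_rfl
    have h1 : (ENNReal.ofReal s * weightMeasure w {y | ENNReal.ofReal s < ‖F y‖ₑ} ^ (1 / p)) ^ p ≤
        B * ENNReal.ofReal (4 ^ x / x) * N ^ p := by
      rw [hroot]
      refine (h s hs).trans ?_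
      calc _ ≤ B * ∑' k : ℕ, ENNReal.ofReal (4 ^ (-x)) ^ k * N ^ p := by
            gcongr with k
            exact hk k
        _ = B * (∑' k : ℕ, ENNReal.ofReal (4 ^ (-x)) ^ k) * N ^ p := by
            rw [ENNReal.tsum_mul_right, mul_assoc]
        _ ≤ _ := by gcongr
    have h2 := ENNReal.rpow_le_rpow h1 (show 0 ≤ 1 / p by positivity)
    rwa [← ENNReal.rpow_mul, mul_one_div_cancel hp0.ne', ENNReal.rpow_one,
      ENNReal.mul_rpow_of_nonneg _ _ (by positivity), ← ENNReal.rpow_mul,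
      mul_one_div_cancel hp0.ne', ENNReal.rpow_one] at h2
  · rw [if_neg hq, if_neg hq]
    set Q := q.toReal with hQ
    have hpQ : p ≤ Q := (ENNReal.ofReal_le_iff_le_toReal hq).1 hpq
    have hQ0 : 0 < Q := by linarith
    have he : 1 ≤ Q / p := by rwa [one_le_div hp0]
    have hint : ∀ (s : ℝ) (_ : 0 < s) (y : ℝ≥0∞), ENNReal.ofReal (s ^ Q) * y ^ (Q / p) =
        (ENNReal.ofReal s ^ p * y) ^ (Q / p) := fun s hs y => by
      rw [ENNReal.mul_rpow_of_nonneg _ _ (by positivity), ← ENNReal.rpow_mul,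
        mul_div_cancel₀ _ hp0.ne', ENNReal.ofReal_rpow_of_nonneg hs.le hQ0.le]
    have hint' : ∀ G : ℝ → ℝ≥0∞, ∫⁻ s in Ioi (0 : ℝ), ENNReal.ofReal (s ^ Q) * G s ^ (Q / p) /
        ENNReal.ofReal s = ∫⁻ s in Ioi (0 : ℝ), (ENNReal.ofReal s ^ p * G s) ^ (Q / p) /
        ENNReal.ofReal s := fun G =>
      setLIntegral_congr_fun measurableSet_Ioi fun s hs => by
        rw [hint s hs]
    rw [hint', hint']
    have ha0 : ENNReal.ofReal (4 ^ (-x)) ≠ 0 := by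
      simp only [ne_eq, ENNReal.ofReal_eq_zero, not_le]; positivity
    have key := lintegral_rpow_tsum_dilates_le (e := Q / p)
      (((by fun_prop : Measurable fun s : ℝ => ENNReal.ofReal s ^ p)).mul
        (measurable_distribution (weightMeasure w) f)) h (by positivity)
      (fun k => ENNReal.ofReal (4 ^ (-x)) ^ k) _ (fun y => tsum_mul_rpow_le_of_one_le _ y
        (fun k => pow_ne_zero k ha0) (fun k => ENNReal.pow_ne_top ENNReal.ofReal_ne_top) he)
    have hG : (∑' k : ℕ, ENNReal.ofReal (4 ^ (-x)) ^ k) ^ (Q / p - 1) *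
        ∑' k : ℕ, ENNReal.ofReal (4 ^ (-x)) ^ k ≤ ENNReal.ofReal (4 ^ x / x) ^ (Q / p) := by
      calc _ = (∑' k : ℕ, ENNReal.ofReal (4 ^ (-x)) ^ k) ^ (Q / p - 1) *
            (∑' k : ℕ, ENNReal.ofReal (4 ^ (-x)) ^ k) ^ (1 : ℝ) := by rw [ENNReal.rpow_one]
        _ = (∑' k : ℕ, ENNReal.ofReal (4 ^ (-x)) ^ k) ^ (Q / p) := by
            rw [← ENNReal.rpow_add_of_nonneg _ _ (by linarith) zero_le_one, sub_add_cancel]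
        _ ≤ _ := by gcongr
    have hfin : ENNReal.ofReal p * ∫⁻ s in Ioi (0 : ℝ), (ENNReal.ofReal s ^ p *
          weightMeasure w {y | ENNReal.ofReal s < ‖F y‖ₑ}) ^ (Q / p) / ENNReal.ofReal s ≤
        (B * ENNReal.ofReal (4 ^ x / x)) ^ (Q / p) * (ENNReal.ofReal p *
          ∫⁻ s in Ioi (0 : ℝ), (ENNReal.ofReal s ^ p *
          weightMeasure w {y | ENNReal.ofReal s < f y}) ^ (Q / p) / ENNReal.ofReal s) := by
      rw [ENNReal.mul_rpow_of_nonneg _ _ (by positivity)]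
      calc _ ≤ ENNReal.ofReal p * (B ^ (Q / p) * ENNReal.ofReal (4 ^ x / x) ^ (Q / p) *
            ∫⁻ s in Ioi (0 : ℝ), (ENNReal.ofReal s ^ p *
              weightMeasure w {y | ENNReal.ofReal s < f y}) ^ (Q / p) / ENNReal.ofReal s) := by
            refine mul_le_mul' le_rfl (key.trans ?_)
            exact mul_le_mul' (mul_le_mul' le_rfl hG) le_rfl
        _ = _ := by ring
    refine (ENNReal.rpow_le_rpow hfin (show 0 ≤ 1 / Q by positivity)).trans (le_of_eq ?_)
    rw [ENNReal.mul_rpow_of_nonneg _ _ (by positivity), ← ENNReal.rpow_mul,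
      show Q / p * (1 / Q) = 1 / p by field_simp]
    rfl

/-- Here the power `q/p ≤ 1` is applied termwise, so the ratio of the series becomes `4^(-x q/p)`.
Its sum, of order `p/(x q)`, enters to the power `1/q`. -/
theorem lorentzNorm_le_of_exponent_le {n : ℕ} {E : Type*} [ENorm E] {p x : ℝ} (hp : 1 < p)
    (hx : 0 < x) {q : ℝ≥0∞} (hq0 : 0 < q) (hqp : q ≤ ENNReal.ofReal p) {w : (Fin n → ℝ) → ℝ}
    {F : (Fin n → ℝ) → E} {f : (Fin n → ℝ) → ℝ≥0∞} {B : ℝ≥0∞}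
    (h : ∀ s : ℝ, 0 < s → ENNReal.ofReal s ^ p * weightMeasure w {y | ENNReal.ofReal s < ‖F y‖ₑ} ≤
      B * ∑' k : ℕ, ENNReal.ofReal (4 ^ (-x)) ^ k * (ENNReal.ofReal (4 ^ k / 2 * s) ^ p *
        weightMeasure w {y | ENNReal.ofReal (4 ^ k / 2 * s) < f y})) :
    lorentzNorm p q w F ≤ B ^ (1 / p) *
      ENNReal.ofReal (4 ^ (x * (q.toReal / p)) / (x * (q.toReal / p))) ^ (1 / q.toReal) *
        lorentzNorm p q w f := by
  have hp0 : 0 < p := by linarith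
  have hq : q ≠ ∞ := ne_top_of_le_ne_top ENNReal.ofReal_ne_top hqp
  unfold lorentzNorm
  rw [if_neg hq, if_neg hq]
  set Q := q.toReal with hQ
  have hQ0 : 0 < Q := ENNReal.toReal_pos hq0.ne' hq
  have hQp : Q ≤ p := ENNReal.toReal_le_of_le_ofReal hp0.le hqp
  have he : Q / p ≤ 1 := by rwa [div_le_one hp0]
  have he0 : 0 < Q / p := by positivity
  have hint : ∀ (s : ℝ) (_ : 0 < s) (y : ℝ≥0∞), ENNReal.ofReal (s ^ Q) * y ^ (Q / p) =
      (ENNReal.ofReal s ^ p * y) ^ (Q / p) := fun s hs y => by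
    rw [ENNReal.mul_rpow_of_nonneg _ _ (by positivity), ← ENNReal.rpow_mul,
      mul_div_cancel₀ _ hp0.ne', ENNReal.ofReal_rpow_of_nonneg hs.le hQ0.le]
  have hint' : ∀ G : ℝ → ℝ≥0∞, ∫⁻ s in Ioi (0 : ℝ), ENNReal.ofReal (s ^ Q) * G s ^ (Q / p) /
      ENNReal.ofReal s = ∫⁻ s in Ioi (0 : ℝ), (ENNReal.ofReal s ^ p * G s) ^ (Q / p) /
      ENNReal.ofReal s := fun G =>
    setLIntegral_congr_fun measurableSet_Ioi fun s hs => by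
      rw [hint s hs]
  rw [hint', hint']
  have hpow : ∀ k : ℕ, (ENNReal.ofReal (4 ^ (-x)) ^ k) ^ (Q / p) =
      ENNReal.ofReal (4 ^ (-(x * (Q / p)))) ^ k := fun k => by
    rw [← ENNReal.rpow_natCast, ← ENNReal.rpow_natCast, ← ENNReal.rpow_mul, mul_comm (k : ℝ),
      ENNReal.rpow_mul, ENNReal.ofReal_rpow_of_nonneg (by positivity) he0.le,
      ← Real.rpow_mul (by norm_num), neg_mul]
  have key := lintegral_rpow_tsum_dilates_le (e := Q / p)
    (((by fun_prop : Measurable fun s : ℝ => ENNReal.ofReal s ^ p)).mul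
      (measurable_distribution (weightMeasure w) f)) h he0
    (fun k => ENNReal.ofReal (4 ^ (-(x * (Q / p)))) ^ k) 1 (fun y => by
      rw [one_mul]
      refine (tsum_rpow_le_of_le_one _ he0 he).trans (le_of_eq ?_)
      refine tsum_congr fun k => ?_
      rw [ENNReal.mul_rpow_of_nonneg _ _ he0.le, hpow])
  rw [one_mul] at key
  have hgeo := tsum_geometric_le (x := x * (Q / p)) (by positivity)
  have hfin : ENNReal.ofReal p * ∫⁻ s in Ioi (0 : ℝ), (ENNReal.ofReal s ^ p *
        weightMeasure w {y | ENNReal.ofReal s < ‖F y‖ₑ}) ^ (Q / p) / ENNReal.ofReal s ≤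
      B ^ (Q / p) * ENNReal.ofReal (4 ^ (x * (Q / p)) / (x * (Q / p))) * (ENNReal.ofReal p *
        ∫⁻ s in Ioi (0 : ℝ), (ENNReal.ofReal s ^ p *
        weightMeasure w {y | ENNReal.ofReal s < f y}) ^ (Q / p) / ENNReal.ofReal s) := by
    calc _ ≤ ENNReal.ofReal p * (B ^ (Q / p) *
          ENNReal.ofReal (4 ^ (x * (Q / p)) / (x * (Q / p))) *
          ∫⁻ s in Ioi (0 : ℝ), (ENNReal.ofReal s ^ p *
            weightMeasure w {y | ENNReal.ofReal s < f y}) ^ (Q / p) / ENNReal.ofReal s) := by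
          refine mul_le_mul' le_rfl (key.trans ?_)
          exact mul_le_mul' (mul_le_mul' le_rfl hgeo) le_rfl
      _ = _ := by ring
  refine (ENNReal.rpow_le_rpow hfin (show 0 ≤ 1 / Q by positivity)).trans (le_of_eq ?_)
  rw [ENNReal.mul_rpow_of_nonneg _ _ (by positivity),
    ENNReal.mul_rpow_of_nonneg _ _ (by positivity), ← ENNReal.rpow_mul,
    show Q / p * (1 / Q) = 1 / p by field_simp]
  rfl

/-! ### Regular representatives -/

theorem strongMaximal_congr_ae {n : ℕ} {E E' : Type*} [ENorm E] [ENorm E']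
    {f : (Fin n → ℝ) → E} {g : (Fin n → ℝ) → E'} (h : ∀ᵐ x, ‖f x‖ₑ = ‖g x‖ₑ) :
    strongMaximal f = strongMaximal g := by
  funext x
  unfold strongMaximal
  refine iSup_congr fun R => iSup_congr fun _ => ?_
  exact laverage_congr (ae_restrict_of_ae h)

theorem lorentzNorm_congr_ae {n : ℕ} {E E' : Type*} [ENorm E] [ENorm E'] (p : ℝ) (q : ℝ≥0∞)
    (w : (Fin n → ℝ) → ℝ) {f : (Fin n → ℝ) → E} {g : (Fin n → ℝ) → E'}
    (h : ∀ᵐ x, ‖f x‖ₑ = ‖g x‖ₑ) : lorentzNorm p q w f = lorentzNorm p q w g := by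
  have : ∀ s : ℝ, weightMeasure w {x | ENNReal.ofReal s < ‖f x‖ₑ} =
      weightMeasure w {x | ENNReal.ofReal s < ‖g x‖ₑ} := fun s => by
    refine measure_congr ?_
    filter_upwards [(withDensity_absolutelyContinuous _ _ : weightMeasure w ≪ volume).ae_le h]
      with x hx
    exact congrArg (fun y => ENNReal.ofReal s < y) hx
  simp only [lorentzNorm, this]

/-- A strong `A_p` weight has an everywhere positive and finite Borel representative. -/
theorem MemAp.exists_boxMuckenhoupt {n : ℕ} {p : ℝ} (hp : 1 < p) {w : (Fin n → ℝ) → ℝ}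
    (hw : MemAp p w) : ∃ W : (Fin n → ℝ) → ℝ≥0∞, BoxMuckenhoupt p (apConst p w) W ∧
      weightMeasure w = volume.withDensity W ∧
      ∀ᵐ x, ENNReal.ofReal (dualWeight p w x) = W x ^ (-1 / (p - 1)) ∧
        ‖dualWeight p w x‖ₑ = W x ^ (-1 / (p - 1)) := by
  classical
  have hp1 : 0 < p - 1 := by linarith
  have hae : AEMeasurable w := hw.isWeight.locallyIntegrable.aestronglyMeasurable.aemeasurable
  set w₀ := hae.mk w with hw₀
  -- The value 1 is assigned only on a null set; it makes `W` positive and finite everywhere, so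
  -- that negative powers of it need no care.
  set W : (Fin n → ℝ) → ℝ≥0∞ := fun x => if 0 < w₀ x then ENNReal.ofReal (w₀ x) else 1 with hWdef
  have hWm : Measurable W := Measurable.ite
    (measurableSet_lt measurable_const hae.measurable_mk) (by fun_prop) measurable_const
  have hW0 : ∀ x, W x ≠ 0 := fun x => by
    simp only [hWdef]; split_ifs with h <;> simp [h]
  have hWt : ∀ x, W x ≠ ∞ := fun x => by
    simp only [hWdef]; split_ifs with h <;> simp
  have hWae : ∀ᵐ x, 0 < w x ∧ W x = ENNReal.ofReal (w x) := by
    filter_upwards [hw.isWeight.pos, hae.ae_eq_mk] with x h1 h2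
    refine ⟨h1, ?_⟩
    rw [h2] at h1
    simp only [hWdef]
    rw [if_pos h1, h2]
  have hexp : 1 - p.conjExponent = -1 / (p - 1) := by
    rw [Real.conjExponent]; field_simp; ring
  have hdual : ∀ᵐ x, ENNReal.ofReal (w x ^ (-1 / (p - 1))) = W x ^ (-1 / (p - 1)) := by
    filter_upwards [hWae] with x hx
    rw [hx.2, ENNReal.ofReal_rpow_of_pos hx.1]
  have hWint : ∀ s : Set (Fin n → ℝ), ∫⁻ x in s, ENNReal.ofReal (w x) = ∫⁻ x in s, W x := fun s =>
    lintegral_congr_ae (ae_restrict_of_ae (hWae.mono fun x hx => hx.2.symm))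
  have hSint : ∀ s : Set (Fin n → ℝ), ∫⁻ x in s, ENNReal.ofReal (w x ^ (-1 / (p - 1))) =
      ∫⁻ x in s, W x ^ (-1 / (p - 1)) := fun s =>
    lintegral_congr_ae (ae_restrict_of_ae hdual)
  have hAp : ∀ a b : Fin n → ℝ, (∀ i, a i < b i) →
      ((∫⁻ x in box a b, W x) / volume (box a b)) *
        ((∫⁻ x in box a b, W x ^ (-1 / (p - 1))) / volume (box a b)) ^ (p - 1) ≤
          apConst p w := by
    intro a b hab
    refine le_iSup₂_of_le (box a b) (box_mem_rectangles hab) ?_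
    rw [setLAverage_eq, setLAverage_eq, hWint, hSint]
  have hpos : ∀ a b : Fin n → ℝ, (∀ i, a i < b i) → ∫⁻ x in box a b, W x ≠ 0 := by
    intro a b hab h
    rw [lintegral_eq_zero_iff hWm, Filter.EventuallyEq, ae_iff] at h
    have huniv : {x | ¬ W x = (0 : (Fin n → ℝ) → ℝ≥0∞) x} = univ := by
      ext x; simpa using hW0 x
    rw [huniv, Measure.restrict_apply_univ] at h
    exact volume_box_ne_zero hab h
  have hempty : ∀ a b : Fin n → ℝ, ¬ (∀ i, a i < b i) → box a b = ∅ := by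
    intro a b hab
    push Not at hab
    obtain ⟨i, hi⟩ := hab
    exact univ_pi_eq_empty (i := i) (Ioo_eq_empty hi.not_gt)
  refine ⟨W, ⟨hWm, hW0, hWt, fun a b => ?_, fun a b => ?_, fun a b hab => ?_⟩, ?_, ?_⟩
  · rw [← hWint]
    have hI : IntegrableOn w (box a b) :=
      (hw.isWeight.locallyIntegrable.integrableOn_isCompact isCompact_Icc).mono_set
        (fun x hx => (⟨fun i => (hx i (mem_univ i)).1.le, fun i => (hx i (mem_univ i)).2.le⟩ :
          x ∈ Icc a b))
    refine ne_top_of_le_ne_top hI.2.ne (lintegral_mono fun x => ?_)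
    exact Real.ofReal_le_enorm _
  · by_cases hab : ∀ i, a i < b i
    -- The integral of `W` over the box is positive, so an infinite dual integral would make the A_p
    -- constant infinite.
    · intro htop
      have h := hAp a b hab
      rw [htop, ENNReal.top_div_of_ne_top (volume_box_ne_top a b), ENNReal.top_rpow_of_pos hp1,
        ENNReal.mul_top (ENNReal.div_ne_zero.2 ⟨hpos a b hab, volume_box_ne_top a b⟩)] at h
      exact hw.apConst_lt_top.not_ge h
    · simp [hempty a b hab]
  · have h := hAp a b hab
    set v := volume (box a b) with hv
    have hv0 : v ≠ 0 := volume_box_ne_zero hab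
    have hvt : v ≠ ∞ := volume_box_ne_top _ _
    have hvr : v * v ^ (p - 1) = v ^ p := by
      nth_rewrite 1 [← ENNReal.rpow_one v]
      rw [← ENNReal.rpow_add _ _ hv0 hvt, add_sub_cancel]
    have hvp0 : v ^ p ≠ 0 := by simp [ENNReal.rpow_eq_zero_iff, hv0, hvt]
    have hvpt : v ^ p ≠ ∞ := ENNReal.rpow_ne_top_of_nonneg (by linarith) hvt
    rwa [ENNReal.div_rpow_of_nonneg _ _ hp1.le, div_eq_mul_inv, div_eq_mul_inv, mul_mul_mul_comm,
      ← ENNReal.mul_inv (Or.inl hv0) (Or.inl hvt), hvr, ← div_eq_mul_inv,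
      ENNReal.div_le_iff_le_mul (Or.inl hvp0) (Or.inl hvpt)] at h
  · exact withDensity_congr_ae (hWae.mono fun x hx => hx.2.symm)
  -- Both forms are needed: `weightMeasure` reads the weight through `ENNReal.ofReal`,
  -- `strongMaximal` through its norm.
  · filter_upwards [hWae, hdual] with x h1 h2
    simp only [dualWeight, hexp]
    refine ⟨h2, ?_⟩
    rw [Real.enorm_eq_ofReal (Real.rpow_nonneg h1.1.le _), h2]

theorem setLIntegral_strongMaximal_indicator_congr {n : ℕ} {σ : (Fin n → ℝ) → ℝ}
    {S : (Fin n → ℝ) → ℝ≥0∞} (h : ∀ᵐ x, ‖σ x‖ₑ = S x) (R : Set (Fin n → ℝ)) :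
    strongMaximal (R.indicator σ) = strongMaximal (R.indicator S) := by
  refine strongMaximal_congr_ae ?_
  filter_upwards [h] with x hx
  by_cases hxR : x ∈ R
  · rw [indicator_of_mem hxR, indicator_of_mem hxR, hx, enorm_eq_self]
  · rw [indicator_of_notMem hxR, indicator_of_notMem hxR]
    simp

/-- The Fujii-Wilson constant in terms of a representative of the weight. -/
theorem aInftyConst_eq {n : ℕ} {σ : (Fin n → ℝ) → ℝ} {S : (Fin n → ℝ) → ℝ≥0∞}
    (h : ∀ᵐ x, ENNReal.ofReal (σ x) = S x ∧ ‖σ x‖ₑ = S x) :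
    aInftyConst σ = ⨆ R ∈ rectangles n,
      (∫⁻ x in R, strongMaximal (R.indicator S) x) / ∫⁻ x in R, S x := by
  unfold aInftyConst
  refine iSup_congr fun R => iSup_congr fun hR => ?_
  obtain ⟨a, b, hab, rfl⟩ := hR
  rw [setLIntegral_strongMaximal_indicator_congr (h.mono fun x hx => hx.2), weightMeasure,
    withDensity_apply _ (measurableSet_box _ _)]
  congr 1
  exact lintegral_congr_ae (ae_restrict_of_ae (h.mono fun x hx => hx.1))

/-! ### The main estimates -/

/-- The dimensional constant in the weak type estimate for `m + 1` variables. -/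
def weakConst (m : ℕ) : ℝ := 4 * (128 * 32 ^ (m + 1)) ^ m

theorem weakConst_pos (m : ℕ) : 0 < weakConst m := by unfold weakConst; positivity

/-- The gap `r - r₀` is comparable to `(p-1)/τ`, so the interpolation factor `r/(r - r₀)` is at most
`16 p' τ`. Each of the `m` factors then contains `κ τ`, which the bound on `τ` turns into
`κ^(p/(p-1))`. -/
theorem weak_type_constant_le (m : ℕ) {p κ τ : ℝ} (hp : 1 < p) (hκ : 0 ≤ κ) (hτ : 1 ≤ τ)
    (hτκ : τ ≤ κ ^ (1 / (p - 1)) * 32 ^ (m + 1)) :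
    2 * (2 ^ p * κ) * ((2 : ℝ) ^ (1 + (p - 1) / (1 + 1 / (8 * τ))) *
      ((1 + (p - 1) / (1 + 1 / (8 * τ))) /
        ((1 + (p - 1) / (1 + 1 / (8 * τ))) - (1 + (p - 1) / (1 + 1 / (4 * τ))))) *
          (2 * (2 ^ p * κ))) ^ m ≤
      weakConst m ^ p * κ ^ (1 + p * m / (p - 1)) * p.conjExponent ^ m := by
  have hp1 : 0 < p - 1 := by linarith
  have hτ0 : 0 < τ := by linarith
  set r := 1 + (p - 1) / (1 + 1 / (8 * τ)) with hr
  set r₀ := 1 + (p - 1) / (1 + 1 / (4 * τ)) with hr₀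
  have hrp : r ≤ p := by
    have : (p - 1) / (1 + 1 / (8 * τ)) ≤ p - 1 := div_le_self hp1.le (by simp; positivity)
    linarith
  have hr1 : 0 < r := by positivity
  have hsub : r - r₀ = (p - 1) * (8 * τ) / ((8 * τ + 1) * (8 * τ + 2)) := by
    rw [hr, hr₀]
    field_simp
    ring
  have hpc : p.conjExponent = p / (p - 1) := rfl
  have hpc0 : 0 < p.conjExponent := by rw [hpc]; positivity
  have hquot : r / (r - r₀) ≤ 16 * (p.conjExponent * τ) := by
    rw [hsub, hpc, div_div_eq_mul_div, div_le_iff₀ (by positivity)]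
    calc r * ((8 * τ + 1) * (8 * τ + 2)) ≤ p * ((9 * τ) * (10 * τ)) := by
          gcongr <;> linarith
      _ ≤ p * (16 * τ * (8 * τ)) := by
          have : 0 ≤ p * τ ^ 2 := by positivity
          nlinarith
      _ = 16 * (p / (p - 1) * τ) * ((p - 1) * (8 * τ)) := by field_simp
  have hquot0 : 0 ≤ r / (r - r₀) := by rw [hsub]; positivity
  have h2p : (2 : ℝ) ^ p * 2 ^ p = 4 ^ p := by
    rw [← Real.mul_rpow (by norm_num) (by norm_num)]; norm_num
  -- Absolute constants are enlarged to p-th powers, so that they become independent of `p` once the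
  -- p-th root is taken.
  have hself : ∀ c : ℝ, 1 ≤ c → c ≤ c ^ p := fun c hc =>
    Real.self_le_rpow_of_one_le hc hp.le
  have hD : (1 : ℝ) ≤ 32 ^ (m + 1) := one_le_pow₀ (by norm_num)
  have hin : (2 : ℝ) ^ r * (r / (r - r₀)) * (2 * (2 ^ p * κ)) ≤
      (128 * 32 ^ (m + 1)) ^ p * (p.conjExponent * κ ^ (p / (p - 1))) := by
    have hκp : κ * κ ^ (1 / (p - 1)) = κ ^ (p / (p - 1)) := by
      nth_rewrite 1 [← Real.rpow_one κ]
      rw [← Real.rpow_add_of_nonneg hκ zero_le_one (by positivity)]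
      congr 1
      field_simp
      ring
    have h32 : (32 : ℝ) ≤ 32 ^ p := hself 32 (by norm_num)
    calc (2 : ℝ) ^ r * (r / (r - r₀)) * (2 * (2 ^ p * κ))
        ≤ 2 ^ p * (16 * (p.conjExponent * τ)) * (2 * (2 ^ p * κ)) := by
          gcongr
          norm_num
      _ = 32 * (2 ^ p * 2 ^ p) * (p.conjExponent * (κ * τ)) := by ring
      _ ≤ 32 ^ p * 4 ^ p * (p.conjExponent * (κ * (κ ^ (1 / (p - 1)) * 32 ^ (m + 1)))) := by
          rw [h2p]
          gcongr
      _ = (32 ^ p * 4 ^ p) * 32 ^ (m + 1) * (p.conjExponent * κ ^ (p / (p - 1))) := by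
          rw [← hκp]; ring
      _ ≤ 128 ^ p * (32 ^ (m + 1)) ^ p * (p.conjExponent * κ ^ (p / (p - 1))) := by
          rw [← Real.mul_rpow (by norm_num) (by norm_num)]
          norm_num only
          gcongr
          exact hself _ hD
      _ = _ := by rw [← Real.mul_rpow (by norm_num) (by positivity)]
  have hout : 2 * ((2 : ℝ) ^ p * κ) ≤ 4 ^ p * κ := by
    rw [← mul_assoc, ← h2p]
    gcongr
    exact hself 2 (by norm_num)
  calc _ ≤ 4 ^ p * κ * ((128 * 32 ^ (m + 1)) ^ p * (p.conjExponent * κ ^ (p / (p - 1)))) ^ m := by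
        gcongr
    _ = _ := by
        have hκm : κ * (κ ^ (p / (p - 1))) ^ m = κ ^ (1 + p * m / (p - 1)) := by
          nth_rewrite 1 [← Real.rpow_one κ]
          rw [← Real.rpow_natCast (κ ^ (p / (p - 1))), ← Real.rpow_mul hκ,
            ← Real.rpow_add_of_nonneg hκ zero_le_one (by positivity)]
          congr 2
          ring
        have hswap : ((128 * 32 ^ (m + 1) : ℝ) ^ p) ^ m = ((128 * 32 ^ (m + 1) : ℝ) ^ m) ^ p :=
          Real.rpow_pow_comm (by positivity) p m
        rw [mul_pow _ (p.conjExponent * _), mul_pow p.conjExponent, ← hκm, weakConst, hswap,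
          Real.mul_rpow (x := 4) (y := (128 * 32 ^ (m + 1)) ^ m) (by norm_num) (by positivity)]
        ring

/-- The lower bound comes from testing on the unit box. The upper bound makes the constant finite
and lets it be traded for a power of the A_p constant. -/
theorem MemAp.aInftyConst_bounds {n : ℕ} {p : ℝ} (hp : 1 < p) {w : (Fin n → ℝ) → ℝ}
    (hw : MemAp p w) :
    1 ≤ aInftyConst (dualWeight p w) ∧
      aInftyConst (dualWeight p w) ≤ apConst p w ^ (1 / (p - 1)) * 32 ^ n := by
  obtain ⟨W, hW, -, hσ⟩ := hw.exists_boxMuckenhoupt hp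
  rw [aInftyConst_eq hσ]
  constructor
  · have hab : ∀ i : Fin n, (0 : Fin n → ℝ) i < (1 : Fin n → ℝ) i := fun i => by simp
    refine le_iSup₂_of_le (box 0 1) (box_mem_rectangles hab) ?_
    have hI0 : ∫⁻ x in box (0 : Fin n → ℝ) 1, W x ^ (-1 / (p - 1)) ≠ 0 := by
      intro h
      rw [lintegral_eq_zero_iff (hW.measurable.pow_const _), Filter.EventuallyEq, ae_iff] at h
      have huniv : {x | ¬ W x ^ (-1 / (p - 1)) = (0 : (Fin n → ℝ) → ℝ≥0∞) x} = univ :=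
        eq_univ_of_forall fun x => dual_ne_zero hW.ne_zero hW.ne_top _ x
      rw [huniv, Measure.restrict_apply_univ] at h
      exact volume_box_ne_zero hab h
    rw [ENNReal.le_div_iff_mul_le (Or.inl hI0) (Or.inl (hW.lintegral_dual_ne_top _ _)), one_mul]
    exact setLIntegral_le_setLIntegral_strongMaximal _ hab
  · refine iSup₂_le ?_
    rintro R ⟨a, b, -, rfl⟩
    exact ENNReal.div_le_of_le_mul (hW.fujiiWilson_dual_le hp a b)

/-- The distribution function of the strong maximal function on a weighted space. -/
theorem MemAp.distribution_strongMaximal_le {m : ℕ} {p : ℝ} (hp : 1 < p)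
    {w : (Fin (m + 1) → ℝ) → ℝ} (hw : MemAp p w) {f : (Fin (m + 1) → ℝ) → ℝ≥0∞}
    (hf : Measurable f) (hft : ∀ x, f x ≠ ∞) {s : ℝ} (hs : 0 < s) :
    ENNReal.ofReal s ^ p * weightMeasure w {y | ENNReal.ofReal s < ‖strongMaximal f y‖ₑ} ≤
      ENNReal.ofReal (weakConst m ^ p * (apConst p w).toReal ^ (1 + p * m / (p - 1)) *
        p.conjExponent ^ m * 8 ^ p) *
      ∑' k : ℕ, ENNReal.ofReal (4 ^ (-((p - 1) /
        (8 * (aInftyConst (dualWeight p w)).toReal + 1)))) ^ k *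
        (ENNReal.ofReal (4 ^ k / 2 * s) ^ p *
          weightMeasure w {y | ENNReal.ofReal (4 ^ k / 2 * s) < f y}) := by
  have hp1 : 0 < p - 1 := by linarith
  obtain ⟨W, hW, hwm, hσ⟩ := hw.exists_boxMuckenhoupt hp
  obtain ⟨hτ1, hτκ⟩ := hw.aInftyConst_bounds hp
  have hκt : apConst p w ≠ ∞ := hw.apConst_lt_top.ne
  have hτt : aInftyConst (dualWeight p w) ≠ ∞ := by
    refine ne_top_of_le_ne_top (ENNReal.mul_ne_top ?_ (by simp)) hτκ
    exact ENNReal.rpow_ne_top_of_nonneg (by positivity) hκt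
  set κ := (apConst p w).toReal with hκ
  set τ := (aInftyConst (dualWeight p w)).toReal with hτ
  have hκ0 : 0 ≤ κ := ENNReal.toReal_nonneg
  have hκE : apConst p w = ENNReal.ofReal κ := (ENNReal.ofReal_toReal hκt).symm
  have hτE : aInftyConst (dualWeight p w) = ENNReal.ofReal τ := (ENNReal.ofReal_toReal hτt).symm
  have hτ1' : 1 ≤ τ := by
    rw [hτE] at hτ1
    simpa using hτ1
  have hτ0 : 0 < τ := by linarith
  have hτκ' : τ ≤ κ ^ (1 / (p - 1)) * 32 ^ (m + 1) := by
    have := ENNReal.toReal_mono (by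
      exact ENNReal.mul_ne_top (ENNReal.rpow_ne_top_of_nonneg (by positivity) hκt) (by simp)) hτκ
    simpa [ENNReal.toReal_mul, ← ENNReal.toReal_rpow] using this
  have hFW : ∀ a b : Fin (m + 1) → ℝ, (∀ i, a i < b i) →
      ∫⁻ x in box a b, strongMaximal ((box a b).indicator fun x => W x ^ (-1 / (p - 1))) x ≤
        ENNReal.ofReal τ * ∫⁻ x in box a b, W x ^ (-1 / (p - 1)) := by
    intro a b hab
    have hle : (∫⁻ x in box a b, strongMaximal ((box a b).indicator fun x =>
        W x ^ (-1 / (p - 1))) x) / ∫⁻ x in box a b, W x ^ (-1 / (p - 1)) ≤ ENNReal.ofReal τ := by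
      rw [← hτE, aInftyConst_eq hσ]
      exact le_iSup₂_of_le (box a b) (box_mem_rectangles hab) le_rfl
    by_cases hI : ∫⁻ x in box a b, W x ^ (-1 / (p - 1)) = 0
    · rw [hI, mul_zero]
      have := hW.fujiiWilson_dual_le hp a b
      rwa [hI, mul_zero] at this
    · rwa [ENNReal.div_le_iff_le_mul (Or.inl hI) (Or.inl (hW.lintegral_dual_ne_top _ _))] at hle
  -- One reverse Hölder inequality supplies two exponents below `p`. The larger, `r`, carries the
  -- weak type estimate, and `p - r = (p-1)/(8τ+1)` governs the geometric series; the smaller, `r₀`,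
  -- is the starting point of the interpolation.
  have hWr := hW.self_improve hp hτ0 hFW (ε := 1 / (8 * τ)) (by positivity)
    (one_div_le_one_div_of_le (by positivity) (by linarith))
  have hWr₀ := hW.self_improve hp hτ0 hFW (ε := 1 / (4 * τ)) (by positivity) le_rfl
  set r := 1 + (p - 1) / (1 + 1 / (8 * τ)) with hr
  set r₀ := 1 + (p - 1) / (1 + 1 / (4 * τ)) with hr₀
  have hr₀1 : 1 < r₀ := by rw [hr₀]; simp only [lt_add_iff_pos_right]; positivity
  have hr₀r : r₀ < r := by
    rw [hr, hr₀]
    gcongr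
    linarith
  have hxr : p - r = (p - 1) / (8 * τ + 1) := by
    rw [hr]; field_simp; ring
  have hrp : r < p := by
    have : 0 < p - r := by rw [hxr]; positivity
    linarith
  set A := 2 * (ENNReal.ofReal (2 ^ p) * apConst p w) *
    (ENNReal.ofReal (2 ^ r * (r / (r - r₀))) * (2 * (ENNReal.ofReal (2 ^ p) * apConst p w))) ^ m
    with hA
  have hAle : A ≤ ENNReal.ofReal (weakConst m ^ p * κ ^ (1 + p * m / (p - 1)) *
      p.conjExponent ^ m) := by
    refine le_trans (le_of_eq ?_)
      (ENNReal.ofReal_le_ofReal (weak_type_constant_le m hp hκ0 hτ1' hτκ'))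
    have hd : 0 < r - r₀ := by linarith
    have he : ENNReal.ofReal (2 * (2 ^ p * κ)) = 2 * (ENNReal.ofReal (2 ^ p) * ENNReal.ofReal κ) := by
      rw [ENNReal.ofReal_mul (by norm_num), ENNReal.ofReal_mul (by positivity)]
      simp
    rw [hA, hκE, ← hr, ← hr₀, ENNReal.ofReal_mul (p := 2 * (2 ^ p * κ)) (by positivity),
      ENNReal.ofReal_pow (by positivity),
      ENNReal.ofReal_mul (p := 2 ^ r * (r / (r - r₀))) (by positivity), he]
  have hmu : ∀ g : (Fin (m + 1) → ℝ) → ℝ≥0∞, Measurable g →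
      ∫⁻ x, g x ^ r ∂(weightMeasure w) = ∫⁻ x, g x ^ r * W x := fun g hg => by
    rw [hwm, lintegral_withDensity_eq_lintegral_mul _ hW.measurable (hg.pow_const _)]
    simp [mul_comm]
  have hν := truncated_weak_type (μ := weightMeasure w) (T := strongMaximal) (r := r) (A := A)
    (by linarith) (fun f _ t x => strongMaximal_le_add t x)
    (fun g hg t => by
      rw [hmu g hg, hwm]
      exact hWr₀.strongMaximal_weak_type hr₀1 hr₀r hWr hg t) hf hs
  have h := ofReal_rpow_mul_distribution_le
    (ν := fun s => weightMeasure w {y | ENNReal.ofReal s < strongMaximal f y})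
    hf hft (by linarith) hrp hs hν
  rw [hxr] at h
  refine h.trans ?_
  have hpc0 : 0 < p.conjExponent := by rw [Real.conjExponent]; positivity
  have hwc := weakConst_pos m
  rw [ENNReal.ofReal_mul (by positivity)]
  gcongr

/-- Both sides depend on `f` only through the almost everywhere class of `|f|`, so `f` may be
replaced by the norm of a Borel representative. -/
theorem lorentzOpNorm_strongMaximal_le {n : ℕ} {p : ℝ} {q : ℝ≥0∞} {w : (Fin n → ℝ) → ℝ} {c : ℝ≥0∞}
    (h : ∀ f : (Fin n → ℝ) → ℝ≥0∞, Measurable f → (∀ x, f x ≠ ∞) →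
      lorentzNorm p q w (strongMaximal f) ≤ c * lorentzNorm p q w f) :
    lorentzOpNorm p q w strongMaximal ≤ c := by
  refine iSup₂_le fun f hf => ?_
  obtain ⟨⟨hfm, -⟩, -⟩ := hf
  refine ENNReal.div_le_of_le_mul ?_
  set g : (Fin n → ℝ) → ℝ≥0∞ := fun x => ‖hfm.mk f x‖ₑ with hg
  have hfg : ∀ᵐ x, ‖f x‖ₑ = ‖g x‖ₑ := by
    filter_upwards [hfm.ae_eq_mk] with x hx
    rw [hg, enorm_eq_self, hx]
  rw [strongMaximal_congr_ae hfg, lorentzNorm_congr_ae p q w hfg]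
  exact h g hfm.measurable_mk.enorm fun x => enorm_ne_top

/-- The dimensional constant in the Lorentz bounds for `m + 1` variables. -/
def lorentzConst (m : ℕ) : ℝ := 288 * weakConst m

theorem lorentzConst_pos (m : ℕ) : 0 < lorentzConst m :=
  mul_pos (by norm_num) (weakConst_pos m)

/-- The Lorentz bounds for the strong maximal function, without logarithmic factors. -/
theorem MemAp.lorentzOpNorm_le {m : ℕ} {p : ℝ} (hp : 1 < p) {q : ℝ≥0∞} (hq0 : 0 < q)
    {w : (Fin (m + 1) → ℝ) → ℝ} (hw : MemAp p w) :
    (ENNReal.ofReal p ≤ q → lorentzOpNorm p q w strongMaximal ≤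
      ENNReal.ofReal (lorentzConst m * p.conjExponent ^ (((m : ℝ) + 1) / p)) *
        apConst p w ^ (1 / p + (m : ℝ) / (p - 1)) *
        aInftyConst (dualWeight p w) ^ (1 / p)) ∧
    (q ≤ ENNReal.ofReal p → lorentzOpNorm p q w strongMaximal ≤
      ENNReal.ofReal (lorentzConst m * (2 ^ (m + 4) / q.toReal) ^ (1 / q.toReal) *
        p.conjExponent ^ (1 / q.toReal + (m : ℝ) / p)) *
        apConst p w ^ (1 / p + (m : ℝ) / (p - 1)) *
        aInftyConst (dualWeight p w) ^ (1 / q.toReal)) := by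
  unfold lorentzConst
  have hp0 : 0 < p := by linarith
  have hp1 : 0 < p - 1 := by linarith
  have hwc := weakConst_pos m
  obtain ⟨hτ1, hτκ⟩ := hw.aInftyConst_bounds hp
  have hκt : apConst p w ≠ ∞ := hw.apConst_lt_top.ne
  have hτt : aInftyConst (dualWeight p w) ≠ ∞ := by
    refine ne_top_of_le_ne_top (ENNReal.mul_ne_top ?_ (by simp)) hτκ
    exact ENNReal.rpow_ne_top_of_nonneg (by positivity) hκt
  have hdist := fun (f : (Fin (m + 1) → ℝ) → ℝ≥0∞) (hf : Measurable f) (hft : ∀ x, f x ≠ ∞)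
    (s : ℝ) (hs : 0 < s) => hw.distribution_strongMaximal_le hp hf hft hs
  set κ := (apConst p w).toReal with hκ
  set τ := (aInftyConst (dualWeight p w)).toReal with hτ
  have hκ0 : 0 ≤ κ := ENNReal.toReal_nonneg
  have hκE : apConst p w = ENNReal.ofReal κ := (ENNReal.ofReal_toReal hκt).symm
  have hτE : aInftyConst (dualWeight p w) = ENNReal.ofReal τ := (ENNReal.ofReal_toReal hτt).symm
  have hτ1' : 1 ≤ τ := by
    rw [hτE] at hτ1
    simpa using hτ1
  have hτ0 : 0 < τ := by linarith
  have hpc : p.conjExponent = p / (p - 1) := rfl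
  have hpc0 : 0 < p.conjExponent := by rw [hpc]; positivity
  set P := p.conjExponent with hP
  set x := (p - 1) / (8 * τ + 1) with hx
  have hx0 : 0 < x := by positivity
  have hxp : x ≤ p := by
    rw [hx, div_le_iff₀ (by positivity)]
    nlinarith
  set B := weakConst m ^ p * κ ^ (1 + p * m / (p - 1)) * P ^ m * 8 ^ p with hB
  have hB0 : 0 ≤ B := by positivity
  clear_value B
  have hroot : ∀ c : ℝ, 0 ≤ c → (c ^ p) ^ (1 / p) = c := fun c hc => by
    rw [← Real.rpow_mul hc, mul_one_div_cancel hp0.ne', Real.rpow_one]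
  have hBroot : B ^ (1 / p) = 8 * weakConst m * κ ^ (1 / p + (m : ℝ) / (p - 1)) *
      P ^ ((m : ℝ) / p) := by
    rw [hB, Real.mul_rpow (by positivity) (by positivity),
      Real.mul_rpow (by positivity) (by positivity),
      Real.mul_rpow (by positivity) (by positivity), hroot _ hwc.le, hroot _ (by norm_num),
      ← Real.rpow_mul hκ0, ← Real.rpow_natCast P m, ← Real.rpow_mul hpc0.le,
      show (1 + p * m / (p - 1)) * (1 / p) = 1 / p + (m : ℝ) / (p - 1) by field_simp,
      show (m : ℝ) * (1 / p) = m / p by ring]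
    ring
  have hexp0 : 0 ≤ 1 / p + (m : ℝ) / (p - 1) := by positivity
  constructor
  · intro hpq
    refine lorentzOpNorm_strongMaximal_le fun f hf hft => ?_
    refine (lorentzNorm_le_of_le_exponent hp hx0 hpq (hdist f hf hft)).trans ?_
    refine mul_le_mul' ?_ le_rfl
    rw [← ENNReal.ofReal_mul hB0, ENNReal.ofReal_rpow_of_nonneg (by positivity) (by positivity),
      hκE, hτE, ENNReal.ofReal_rpow_of_nonneg hκ0 hexp0,
      ENNReal.ofReal_rpow_of_nonneg hτ0.le (by positivity),
      ← ENNReal.ofReal_mul (by positivity), ← ENNReal.ofReal_mul (by positivity)]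
    apply ENNReal.ofReal_le_ofReal
    -- Since `x ≤ p` the numerator is at most `4^p`, and `1/x = (8τ+1)/(p-1)` is at most `9 p' τ`.
    -- Writing `9 ≤ 9^p` leaves the constant 36 after the p-th root.
    have h4 : (4 : ℝ) ^ x / x ≤ 36 ^ p * (P * τ) := by
      rw [div_le_iff₀ hx0]
      have h9 : (9 : ℝ) ≤ 9 ^ p := Real.self_le_rpow_of_one_le (by norm_num) hp.le
      have hPx : 1 ≤ 9 * (P * τ) * x := by
        rw [hpc, hx]
        have : 9 * (p / (p - 1) * τ) * ((p - 1) / (8 * τ + 1)) = 9 * p * τ / (8 * τ + 1) := by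
          field_simp
        rw [this, le_div_iff₀ (by positivity)]
        nlinarith
      calc (4 : ℝ) ^ x ≤ 4 ^ p * 1 := by
            rw [mul_one]; exact Real.rpow_le_rpow_of_exponent_le (by norm_num) hxp
        _ ≤ 4 ^ p * (9 * (P * τ) * x) := by gcongr
        _ ≤ 4 ^ p * (9 ^ p * (P * τ) * x) := by gcongr
        _ = _ := by
          rw [show (36 : ℝ) = 4 * 9 by norm_num, Real.mul_rpow (by norm_num) (by norm_num)]
          ring
    calc (B * (4 ^ x / x)) ^ (1 / p) ≤ (B * (36 ^ p * (P * τ))) ^ (1 / p) := by gcongr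
      _ = B ^ (1 / p) * (36 * (P ^ (1 / p) * τ ^ (1 / p))) := by
          rw [Real.mul_rpow hB0 (by positivity), Real.mul_rpow (by positivity) (by positivity),
            Real.mul_rpow hpc0.le hτ0.le, hroot _ (by norm_num)]
      _ = _ := by
          rw [hBroot, add_div, Real.rpow_add hpc0]
          ring
  · intro hqp
    have hqt : q ≠ ∞ := ne_top_of_le_ne_top ENNReal.ofReal_ne_top hqp
    refine lorentzOpNorm_strongMaximal_le fun f hf hft => ?_
    refine (lorentzNorm_le_of_exponent_le hp hx0 hq0 hqp (hdist f hf hft)).trans ?_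
    refine mul_le_mul' ?_ le_rfl
    set Q := q.toReal with hQ
    have hQ0 : 0 < Q := ENNReal.toReal_pos hq0.ne' hqt
    rw [ENNReal.ofReal_rpow_of_nonneg hB0 (by positivity),
      ENNReal.ofReal_rpow_of_nonneg (by positivity) (by positivity),
      hκE, hτE, ENNReal.ofReal_rpow_of_nonneg hκ0 hexp0,
      ENNReal.ofReal_rpow_of_nonneg hτ0.le (by positivity),
      ← ENNReal.ofReal_mul (by positivity), ← ENNReal.ofReal_mul (by positivity),
      ← ENNReal.ofReal_mul (by positivity)]
    apply ENNReal.ofReal_le_ofReal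
    set y := x * (Q / p) with hy
    have hy0 : 0 < y := by positivity
    -- Only `9 ≤ 2^(m+4)` is used; since `m + 1` is the dimension, `m + 4` is the `n + 3` of the
    -- theorem.
    have hyinv : 1 / y ≤ 2 ^ (m + 4) / Q * (P * τ) := by
      have h16 : (9 : ℝ) ≤ 2 ^ (m + 4) := by
        calc (9 : ℝ) ≤ 2 ^ 4 := by norm_num
          _ ≤ 2 ^ (m + 4) := pow_le_pow_right₀ (by norm_num) (by omega)
      have : 1 / y = 1 / Q * (P * (8 * τ + 1)) := by
        rw [hy, hx, hpc]; field_simp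
      rw [this, div_mul_eq_mul_div, div_mul_eq_mul_div, one_mul]
      refine div_le_div_of_nonneg_right ?_ hQ0.le
      calc P * (8 * τ + 1) ≤ P * (9 * τ) := by gcongr; linarith
        _ ≤ P * (2 ^ (m + 4) * τ) := by gcongr
        _ = _ := by ring
    have h4 : ((4 : ℝ) ^ y / y) ^ (1 / Q) ≤
        4 * ((2 ^ (m + 4) / Q) ^ (1 / Q) * (P ^ (1 / Q) * τ ^ (1 / Q))) := by
      rw [div_eq_mul_one_div, Real.mul_rpow (by positivity) (by positivity),
        ← Real.rpow_mul (by norm_num)]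
      have hyQ : y * (1 / Q) ≤ 1 := by
        have : y * (1 / Q) = x / p := by rw [hy]; field_simp
        rw [this, div_le_one hp0]
        exact hxp
      calc (4 : ℝ) ^ (y * (1 / Q)) * (1 / y) ^ (1 / Q)
          ≤ 4 ^ (1 : ℝ) * (2 ^ (m + 4) / Q * (P * τ)) ^ (1 / Q) := by
            gcongr
            norm_num
        _ = _ := by
            rw [Real.rpow_one, Real.mul_rpow (by positivity) (by positivity),
              Real.mul_rpow hpc0.le hτ0.le]
    calc B ^ (1 / p) * ((4 : ℝ) ^ y / y) ^ (1 / Q)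
        ≤ B ^ (1 / p) * (36 * ((2 ^ (m + 4) / Q) ^ (1 / Q) * (P ^ (1 / Q) * τ ^ (1 / Q)))) := by
          gcongr
          -- The factor 4 is raised to 36 so that both cases share the constant `288 = 8 * 36`.
          refine h4.trans ?_
          gcongr
          norm_num
      _ = _ := by
          rw [hBroot, Real.rpow_add hpc0]
          ring

/-! ### Weakening the sharper bounds to the stated ones. -/

theorem one_le_log_exp_add {x : ℝ} (hx : 0 ≤ x) : 1 ≤ Real.log (Real.exp 1 + x) := by
  rw [Real.le_log_iff_exp_le (by positivity)]
  linarith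

theorem one_le_conjExponent {p : ℝ} (hp : 1 < p) : 1 ≤ p.conjExponent := by
  rw [Real.conjExponent, one_le_div (by linarith)]
  linarith

end StrongMaximal

end

theorem corollary3p2 (n : ℕ) (hn : 1 ≤ n) :
    (∃ C : ℝ, 0 < C ∧ ∀ (p : ℝ) (q : ℝ≥0∞) (w : (Fin n → ℝ) → ℝ),
      1 < p → 0 < q → StrongMaximal.MemAp p w →
        (ENNReal.ofReal p ≤ q →
          StrongMaximal.lorentzOpNorm p q w StrongMaximal.strongMaximal ≤
            ENNReal.ofReal
                (C * p.conjExponent ^ n *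
                  Real.log (Real.exp 1 + (StrongMaximal.apConst p w).toReal) ^ (1 / p)) *
              StrongMaximal.apConst p w ^ (1 / p + ((n : ℝ) - 1) / (p - 1)) *
              StrongMaximal.aInftyConst (StrongMaximal.dualWeight p w) ^ (1 / p)) ∧
        (q ≤ ENNReal.ofReal p →
          StrongMaximal.lorentzOpNorm p q w StrongMaximal.strongMaximal ≤
            ENNReal.ofReal
                (C * (2 ^ (n + 3) / q.toReal) ^ (1 / q.toReal) *
                  p.conjExponent ^ (1 / q.toReal + ((n : ℝ) - 1)) *
                  Real.log (Real.exp 1 + (StrongMaximal.apConst p w).toReal) ^ (1 / q.toReal)) *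
              StrongMaximal.apConst p w ^ (1 / p + ((n : ℝ) - 1) / (p - 1)) *
              StrongMaximal.aInftyConst (StrongMaximal.dualWeight p w) ^ (1 / q.toReal))) ∧
    (∀ q : ℝ≥0∞, 0 < q → ∃ C : ℝ, 0 < C ∧ ∀ (p m : ℝ) (w : (Fin n → ℝ) → ℝ),
      1 < p → m = (min (ENNReal.ofReal p) q).toReal → StrongMaximal.MemAp p w →
        StrongMaximal.lorentzOpNorm p q w StrongMaximal.strongMaximal ≤
          ENNReal.ofReal
              (C * p.conjExponent ^ ((n : ℝ) - 1 + 1 / m) *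
                Real.log (Real.exp 1 + (StrongMaximal.apConst p w).toReal) ^ (1 / m)) *
            StrongMaximal.apConst p w ^ (1 / p + ((n : ℝ) - 1) / (p - 1)) *
            StrongMaximal.aInftyConst (StrongMaximal.dualWeight p w) ^ (1 / m)) := by
  obtain ⟨d, rfl⟩ : ∃ d, n = d + 1 := ⟨n - 1, by omega⟩
  have hcast : ((d + 1 : ℕ) : ℝ) - 1 = d := by push_cast; ring
  rw [hcast]
  set C₀ := StrongMaximal.lorentzConst d
  have hC₀pos : 0 < C₀ := StrongMaximal.lorentzConst_pos d
  have hlog : ∀ (x : ℝ≥0∞) (e : ℝ), 0 ≤ e → 1 ≤ Real.log (Real.exp 1 + x.toReal) ^ e :=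
    fun x e he => Real.one_le_rpow (StrongMaximal.one_le_log_exp_add ENNReal.toReal_nonneg) he
  have hdiv : ∀ p : ℝ, 1 < p → (d : ℝ) / p ≤ d := fun p hp =>
    div_le_self (Nat.cast_nonneg d) hp.le
  refine ⟨⟨C₀, hC₀pos, fun p q w hp hq hw => ⟨fun hpq => ?_, fun hqp => ?_⟩⟩, fun q hq => ?_⟩
  · refine ((hw.lorentzOpNorm_le hp hq).1 hpq).trans ?_
    have hP := StrongMaximal.one_le_conjExponent hp
    have hl := hlog (StrongMaximal.apConst p w) (1 / p) (by positivity)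
    refine mul_le_mul' (mul_le_mul' (ENNReal.ofReal_le_ofReal ?_) le_rfl) le_rfl
    refine (le_mul_of_one_le_right (by positivity) hl).trans ?_
    gcongr
    rw [← Real.rpow_natCast]
    refine Real.rpow_le_rpow_of_exponent_le hP ?_
    push_cast
    exact div_le_self (by positivity) hp.le
  · refine ((hw.lorentzOpNorm_le hp hq).2 hqp).trans ?_
    have hP := StrongMaximal.one_le_conjExponent hp
    have hl := hlog (StrongMaximal.apConst p w) (1 / q.toReal) (by positivity)
    refine mul_le_mul' (mul_le_mul' (ENNReal.ofReal_le_ofReal ?_) le_rfl) le_rfl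
    refine (le_mul_of_one_le_right (by positivity) hl).trans ?_
    gcongr
    exact hdiv p hp
  · refine ⟨C₀ * max 1 ((2 ^ (d + 4) / q.toReal) ^ (1 / q.toReal)), by positivity,
      fun p m w hp hm hw => ?_⟩
    have hP := StrongMaximal.one_le_conjExponent hp
    have hm0 : 0 ≤ m := hm ▸ ENNReal.toReal_nonneg
    have hl := hlog (StrongMaximal.apConst p w) (1 / m) (by positivity)
    rcases le_total (ENNReal.ofReal p) q with hpq | hqp
    · rw [min_eq_left hpq, ENNReal.toReal_ofReal (by linarith)] at hm
      subst hm
      refine ((hw.lorentzOpNorm_le hp hq).1 hpq).trans ?_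
      refine mul_le_mul' (mul_le_mul' (ENNReal.ofReal_le_ofReal ?_) le_rfl) le_rfl
      refine (le_mul_of_one_le_right (by positivity) hl).trans ?_
      gcongr
      · exact le_mul_of_one_le_right hC₀pos.le (le_max_left _ _)
      · rw [add_div]
        gcongr
        exact hdiv m hp
    · rw [min_eq_right hqp] at hm
      subst hm
      refine ((hw.lorentzOpNorm_le hp hq).2 hqp).trans ?_
      refine mul_le_mul' (mul_le_mul' (ENNReal.ofReal_le_ofReal ?_) le_rfl) le_rfl
      refine (le_mul_of_one_le_right (by positivity) hl).trans ?_
      rw [add_comm (d : ℝ) (1 / q.toReal)]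
      gcongr
      · exact le_max_right _ _
      · exact hdiv p hp
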